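/- Conventions. For a locally finite simplicial complex $K$ and a subcomplex $L\subset K$, the pair $(K,L)$ is called a triangulated rational homology $n$-manifold with boundary $L$ (compact or not) if for every point $x$ of the geometric realization $|K|$ the local singular homology $H_*(|K|,|K|\setminus\{x\};\mathbb{Q})$ is $\mathbb{Q}$ in degree $n$ and $0$ in all other degrees when $x\notin|L|$, and vanishes in all degrees when $x\in|L|$. The star $\mathrm{Star}(X')$ of a subcomplex $X'\subset K$ is the union of all closed simplices of $K$ that contain a vertex of $X'$. The barycentric subdivision of $K$ is denoted $K_b$. Let $(K,L)$ be a triangulated rational homology $n$-manifold with boundary $L$. (1) For every subcomplex $X'\subset K$ there are subcomplexes $Y\subset X$ of $K_b$ with $X'\subset X\subset \mathrm{Star}(X')$ such that $(X,Y)$ is a triangulated rational homology $n$-manifold with boundary $Y$ and such that $X\cap L\subset Y$ (but $Y$ need not be contained in $L$). (2) Assume moreover that $K$ is finite and non-empty, and let $p\colon \overline K\to K$ be a regular covering of $K$, with the lifted triangulation, whose covering group $\Gamma$ is amenable and generated by a finite set $S$; let $d$ be the word metric $d(g,h)=\ell_S(g^{-1}h)$ on $\Gamma$. Choose for each simplex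 $\sigma$ of $K_b$ a lift $\overline\sigma$ in $\overline K_b$. Write $|Z|$ for the number of simplices of a finite complex, or finite set of simplices, $Z$. For a subcomplex $Z\subset\overline K_b$ and $R>0$ let $U_R(Z)$ be the set of all simplices $\gamma\overline\sigma$ ($\sigma$ a simplex of $K_b$, $\gamma\in\Gamma$) for which there is $\gamma_1\in\Gamma$ with $d(\gamma_1,\gamma)<R$ and $\gamma_1\overline\sigma\cap Z\neq\emptyset$ (closed simplices). Then there is a sequence $X_0\subset X_1\subset X_2\subset\cdots$ of finite subcomplexes of $\overline K_b$ with $\bigcup_k X_k=\overline K_b$ which is - amenable: $|U_R(X_k)|/|X_k|\to 1$ as $k\to\infty$, for every $R>0$; - balanced: $|X_k\cap\Gamma\sigma|/|X_k|\to 1/|K_b|$ as $k\to\infty$, for every simplex $\sigma$ of $\overline K_b$; and subcomplexes $Y_k\subset X_k$ such that each $(X_k,Y_k)$ is a triangulated rational homology $n$-manifold with boundary $Y_k$. -/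

import Mathlib

open Filter Topology CategoryTheory
open scoped Pointwise

universe u v w

/-! ### Simplicial complexes and their geometric realizations

A simplicial complex on a vertex set contained in `V` is a `PreAbstractSimplicialComplex V`: a
family of nonempty finite subsets of `V` (the simplices) that is closed under passing to nonempty
subsets.  Not every element of `V` needs to be a vertex, so subcomplexes of `K` are the complexes
`X` with `X ≤ K`. -/

namespace PreAbstractSimplicialComplex

/-- The closed simplex spanned by the finite set `σ`, in barycentric coordinates. -/
def closedSimplex {V : Type u} (σ : Finset V) : Set (V → ℝ) :=
  {x | (∀ v, 0 ≤ x v) ∧ (∀ v, v ∉ σ → x v = 0) ∧ ∑ v ∈ σ, x v = 1}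

/-- The underlying set of the geometric realization of `K`: the union of its closed simplices. -/
def polyhedron {V : Type u} (K : PreAbstractSimplicialComplex V) : Set (V → ℝ) :=
  {x | ∃ σ ∈ K, x ∈ closedSimplex σ}

/-- The geometric realization of `K`. -/
def Realization {V : Type u} (K : PreAbstractSimplicialComplex V) : Type u :=
  {x : V → ℝ // x ∈ polyhedron K}

/-- The inclusion of a closed simplex of `K` into the geometric realization of `K`. -/
def simplexInclusion {V : Type u} (K : PreAbstractSimplicialComplex V) (σ : {σ // σ ∈ K}) :
    closedSimplex σ.1 → K.Realization :=
  fun x => ⟨x.1, σ.1, σ.2, x.2⟩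

/-- The weak topology: a subset of the realization is open if and only if it meets every closed
simplex in an open subset of that simplex. -/
instance {V : Type u} (K : PreAbstractSimplicialComplex V) : TopologicalSpace K.Realization :=
  ⨆ σ : {σ // σ ∈ K}, TopologicalSpace.coinduced (simplexInclusion K σ) inferInstance

/-- The subset of the realization of `K` that is covered by the simplices of `L`
(for a subcomplex `L` of `K`, the realization of `L` as a subset of that of `K`). -/
def realizedSubset {V : Type u} (K L : PreAbstractSimplicialComplex V) : Set K.Realization :=
  {x | x.1 ∈ polyhedron L}

/-- `K` is locally finite: every vertex belongs to only finitely many simplices. -/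
def IsLocallyFinite {V : Type u} (K : PreAbstractSimplicialComplex V) : Prop :=
  ∀ v : V, {σ | σ ∈ K ∧ v ∈ σ}.Finite

/-- The star in `K` of a subcomplex `X`: the union, over the vertices `v` of `X`, of all closed
simplices of `K` that contain `v`. -/
def star {V : Type u} (K X : PreAbstractSimplicialComplex V) :
    PreAbstractSimplicialComplex V where
  faces := {σ | σ.Nonempty ∧ ∃ v, {v} ∈ X ∧ ∃ τ ∈ K, v ∈ τ ∧ σ ⊆ τ}
  isRelLowerSet_faces := by
    rintro σ ⟨hσ, v, hv, τ, hτ, hvτ, hστ⟩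
    exact ⟨hσ, fun ρ hρ hne => ⟨hne, v, hv, τ, hτ, hvτ, le_trans hρ hστ⟩⟩

/-- The barycentric subdivision of `K`: its vertices are the simplices of `K` (standing for their
barycenters), its simplices are the nonempty finite chains of simplices of `K`. -/
def barycentric {V : Type u} (K : PreAbstractSimplicialComplex V) :
    PreAbstractSimplicialComplex (Finset V) where
  faces := {c | c.Nonempty ∧ (∀ σ ∈ c, σ ∈ K) ∧ IsChain (· ⊆ ·) (c : Set (Finset V))}
  isRelLowerSet_faces := by
    rintro c ⟨hc, hK, hch⟩
    exact ⟨hc, fun d hd hne =>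
      ⟨hne, fun σ hσ => hK σ (hd hσ), hch.mono (Finset.coe_subset.2 hd)⟩⟩

end PreAbstractSimplicialComplex

/-! ### Rational homology manifolds -/

/-- The inclusion of `M \ {x}` into `M`. -/
def punctureInclusion (M : Type u) [TopologicalSpace M] (x : M) :
    TopCat.of {y : M // y ≠ x} ⟶ TopCat.of M :=
  TopCat.ofHom ⟨Subtype.val, continuous_subtype_val⟩

/-- The local homology `H_i(M, M \ {x}; ℚ)`: the homology of the quotient of the rational
singular chain complex of `M` by that of `M \ {x}`. -/
noncomputable def localHomology (M : Type u) [TopologicalSpace M] (x : M) (i : ℕ) :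
    ModuleCat.{u} ℚ :=
  (Limits.cokernel
    (((AlgebraicTopology.singularChainComplexFunctor (ModuleCat.{u} ℚ)).obj
      (ModuleCat.of ℚ (ULift.{u} ℚ))).map (punctureInclusion M x))).homology i

/-- The local homology condition for `M` to be a rational homology `n`-manifold with boundary `B`:
`H_*(M, M \ {x}; ℚ)` is `ℚ` concentrated in degree `n` for `x ∉ B`, and vanishes for `x ∈ B`. -/
structure IsRationalHomologyManifold (n : ℕ) (M : Type u) [TopologicalSpace M] (B : Set M) :
    Prop where
  interior_top : ∀ x ∉ B, Nonempty (localHomology M x n ≃ₗ[ℚ] ℚ)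
  interior_zero : ∀ x ∉ B, ∀ i, i ≠ n → Subsingleton (localHomology M x i)
  boundary_zero : ∀ x ∈ B, ∀ i, Subsingleton (localHomology M x i)

/-- `(K, L)` is a triangulated rational homology `n`-manifold with boundary `L` (compact or not):
`K` is a locally finite simplicial complex, `L` is a subcomplex, and the realization of `K` is a
rational homology `n`-manifold whose boundary is the realization of `L`. -/
structure IsTriangulatedRationalHomologyManifold {V : Type u} (n : ℕ)
    (K L : PreAbstractSimplicialComplex V) : Prop where
  le : L ≤ K
  locallyFinite : K.IsLocallyFinite
  manifold : IsRationalHomologyManifold n K.Realization (K.realizedSubset L)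

/-! ### Coverings, amenability and exhaustions -/

/-- The simplicial map `p : E → K` is a regular (normal) covering of simplicial complexes with
covering group `Γ`: the group acts on `E` over `K` by simplicial automorphisms, freely, and
transitively on the set of lifts of each simplex of `K`. -/
structure IsRegularCovering {V : Type u} {W : Type v} (Γ : Type w) [DecidableEq V]
    [DecidableEq W] [Group Γ] [MulAction Γ W] (E : PreAbstractSimplicialComplex W)
    (K : PreAbstractSimplicialComplex V) (p : W → V) : Prop where
  map_eq : E.map p = K
  injOn : ∀ σ ∈ E, Set.InjOn p (σ : Set W)
  smul_mem : ∀ (γ : Γ), ∀ σ ∈ E, γ • σ ∈ E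
  map_smul : ∀ (γ : Γ) (x : W), {x} ∈ E → p (γ • x) = p x
  free : ∀ (γ : Γ) (x : W), {x} ∈ E → γ • x = x → γ = 1
  transitive : ∀ σ ∈ E, ∀ τ ∈ E, σ.image p = τ.image p → ∃ γ : Γ, γ • σ = τ

/-- Amenability of a discrete group, by Følner's condition: for every finite `T ⊆ Γ` and `ε > 0`
there is a nonempty finite `F ⊆ Γ` that each `t ∈ T` moves out of itself in at most `ε |F|`
points. -/
def IsAmenableGroup (Γ : Type w) [Group Γ] : Prop :=
  ∀ (T : Finset Γ) (ε : ℝ), 0 < ε → ∃ F : Finset Γ, F.Nonempty ∧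
    ∀ t ∈ T, ({g | g ∈ F ∧ t * g ∉ F}.ncard : ℝ) ≤ ε * (F.card : ℝ)

/-- The word length of `g` with respect to the generating set `S`. -/
noncomputable def wordLength {Γ : Type w} [Group Γ] (S : Finset Γ) (g : Γ) : ℕ :=
  sInf {m | ∃ l : List Γ, l.length = m ∧ (∀ s ∈ l, s ∈ S ∨ s⁻¹ ∈ S) ∧ l.prod = g}

/-- The left invariant word metric with respect to the generating set `S`. -/
noncomputable def wordDist {Γ : Type w} [Group Γ] (S : Finset Γ) (g h : Γ) : ℕ :=
  wordLength S (g⁻¹ * h)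

/-- `lift` chooses, for each simplex of `K`, a simplex of `E` above it. -/
def IsLiftChoice {V : Type u} {W : Type v} [DecidableEq V] (E : PreAbstractSimplicialComplex W)
    (K : PreAbstractSimplicialComplex V) (p : W → V) (lift : Finset V → Finset W) : Prop :=
  ∀ σ ∈ K, lift σ ∈ E ∧ (lift σ).image p = σ

/-- The `R`-neighbourhood `U_R(Z)` of a subcomplex `Z` of the covering: all translates
`γ • lift σ` of chosen lifts for which there is `γ₁` at distance `< R` from `γ` such that the
closed simplex `γ₁ • lift σ` meets `Z`. -/
def wordNeighborhood {V : Type u} {W : Type v} {Γ : Type w} [DecidableEq W] [Group Γ]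
    [MulAction Γ W] (K : PreAbstractSimplicialComplex V) (S : Finset Γ)
    (lift : Finset V → Finset W) (R : ℝ) (Z : PreAbstractSimplicialComplex W) :
    Set (Finset W) :=
  {τ | ∃ σ ∈ K, ∃ γ γ₁ : Γ, τ = γ • lift σ ∧ (wordDist S γ₁ γ : ℝ) < R ∧
    ∃ ρ ∈ Z, (γ₁ • lift σ ∩ ρ).Nonempty}

/-- `X 0 ≤ X 1 ≤ …` is an amenable exhaustion of the covering `E` of `K`. -/
structure IsAmenableExhaustion {V : Type u} {W : Type v} {Γ : Type w} [DecidableEq W] [Group Γ]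
    [MulAction Γ W] (E : PreAbstractSimplicialComplex W) (K : PreAbstractSimplicialComplex V)
    (S : Finset Γ) (lift : Finset V → Finset W) (X : ℕ → PreAbstractSimplicialComplex W) :
    Prop where
  monotone : Monotone X
  finite : ∀ k, (X k).faces.Finite
  union : ⋃ k, (X k).faces = E.faces
  tendsto : ∀ R : ℝ, 0 < R →
    Tendsto (fun k => ((wordNeighborhood K S lift R (X k)).ncard : ℝ) / ((X k).faces.ncard : ℝ))
      atTop (𝓝 1)

/-- The exhaustion `X` of the covering `E` of the finite complex `K` with covering group `Γ` is
balanced: all `Γ`-orbits of simplices of `E` have the same asymptotic density in it. -/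
def IsBalancedExhaustion {V : Type u} {W : Type v} (Γ : Type w) [DecidableEq W] [Group Γ]
    [MulAction Γ W] (E : PreAbstractSimplicialComplex W) (K : PreAbstractSimplicialComplex V)
    (X : ℕ → PreAbstractSimplicialComplex W) : Prop :=
  ∀ σ ∈ E, Tendsto
    (fun k => ({τ | τ ∈ X k ∧ ∃ γ : Γ, τ = γ • σ}.ncard : ℝ) / ((X k).faces.ncard : ℝ))
    atTop (𝓝 (1 / (K.faces.ncard : ℝ)))

/-! For a set `A` of vertices let the thickening be the full subcomplex of the barycentric
subdivision spanned by the simplices that meet `A`. In the barycentric coordinates `x` of the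
original complex it is the region where some coordinate in `A` dominates all coordinates outside `A`
(`mem_polyhedron_thickening_iff`). Its frontier consists of the chains of simplices that meet both
`A` and its complement. Away from the frontier the thickening is open in the ambient polyhedron, so
by excision its local homology is the ambient one. At the frontier the local homology vanishes,
whatever the ambient local homology is: multiplying the coordinates outside `A` by `1 - t` and
renormalizing keeps the thickening inside itself, and for every `t > 0` makes the dominance strict,
hence moves everything off the frontier (`subsingleton_localHomology_frontier`). So the thickening
is a rational homology manifold whose boundary is the frontier together with its part in `L`. Taking
for `A` the vertices of `X'` proves (1). For (2), open stars of vertices of the covering are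
homeomorphic to open stars downstairs, so the covering is again a rational homology manifold and its
thickenings are available. Let `D` be the finite set of vertices occurring in the chosen lifts, and
thicken `G • D` for finite `G ⊆ Γ`. The result contains all translates by `G` of the lifts and only
translates by `G * T`, with `T` finite and independent of `G`; its `R`-neighbourhood contains only
translates by `G * T'`. The action is free, so counting simplices becomes counting group elements.
Along Følner sets `|G * T| / |G|` tends to `1`, which squeezes all the ratios (`exists_exhaustion`).
Two facts about local homology carry the topology: invariance under open embeddings
(`nonempty_localHomology_equiv`) and vanishing under an instantaneous push
(`subsingleton_localHomology_of_homotopy`). The first rests on excision, proved by barycentric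
subdivision of concrete singular chains, which are then compared with the categorical chain complex.
The second is homotopy invariance and the long exact sequence. -/

/-! ### Ordered chains and their barycentric subdivision -/

/-- Rational chains of ordered tuples of `m` points of `E`. -/
abbrev OrderedChain (m : ℕ) (E : Type u) : Type u := (Fin m → E) →₀ ℚ

namespace OrderedChain

variable {E : Type u} {F : Type v} {m : ℕ}

/-- The alternating sum of the faces. -/
noncomputable def boundary (m : ℕ) (E : Type u) : OrderedChain (m + 1) E →ₗ[ℚ] OrderedChain m E :=
  Finsupp.linearCombination ℚ fun v =>
    ∑ i : Fin (m + 1), (-1 : ℚ) ^ (i : ℕ) • Finsupp.single (v ∘ i.succAbove) 1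

/-- The cone with apex `b`. -/
noncomputable def cone (b : E) (m : ℕ) : OrderedChain m E →ₗ[ℚ] OrderedChain (m + 1) E :=
  Finsupp.lmapDomain ℚ ℚ fun v => (Fin.cons b v : Fin (m + 1) → E)

/-- The map induced on chains by a map of points. -/
noncomputable def map (f : E → F) (m : ℕ) : OrderedChain m E →ₗ[ℚ] OrderedChain m F :=
  Finsupp.lmapDomain ℚ ℚ fun v => f ∘ v

theorem boundary_single (v : Fin (m + 1) → E) :
    boundary m E (Finsupp.single v 1) =
      ∑ i : Fin (m + 1), (-1 : ℚ) ^ (i : ℕ) • Finsupp.single (v ∘ i.succAbove) 1 := by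
  simp [boundary]

theorem cone_single (b : E) (v : Fin m → E) :
    cone b m (Finsupp.single v 1) = Finsupp.single (Fin.cons b v : Fin (m + 1) → E) 1 := by
  simp [cone]

theorem map_single (f : E → F) (v : Fin m → E) :
    map f m (Finsupp.single v 1) = Finsupp.single (f ∘ v) 1 := by
  simp [map]

/-- Chains are indexed by the number of vertices, so index `0` is the augmentation, spanned by the
empty tuple; there is no further boundary and hence no correction term. -/
theorem boundary_cone_zero (b : E) (c : OrderedChain 0 E) : boundary 0 E (cone b 0 c) = c := by
  suffices h : boundary 0 E ∘ₗ cone b 0 = LinearMap.id from LinearMap.congr_fun h c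
  ext1 v
  ext1
  simp only [LinearMap.comp_apply, Finsupp.lsingle_apply, cone_single, boundary_single]
  rw [Fin.sum_univ_succ, Fin.sum_univ_zero, add_zero, Fin.val_zero, pow_zero, one_smul,
    LinearMap.id_apply]
  congr 1

theorem boundary_cone_succ (b : E) (c : OrderedChain (m + 1) E) :
    boundary (m + 1) E (cone b (m + 1) c) = c - cone b m (boundary m E c) := by
  suffices h : boundary (m + 1) E ∘ₗ cone b (m + 1) = LinearMap.id - cone b m ∘ₗ boundary m E from
    LinearMap.congr_fun h c
  ext1 v
  ext1
  simp only [LinearMap.comp_apply, Finsupp.lsingle_apply, cone_single, boundary_single,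
    LinearMap.sub_apply, LinearMap.id_apply, map_sum, map_smul]
  rw [Fin.sum_univ_succ, sub_eq_add_neg, ← Finset.sum_neg_distrib]
  congr 1
  · simp only [Fin.val_zero, pow_zero, one_smul]
    congr 1
  · refine Finset.sum_congr rfl fun i _ => ?_
    rw [Fin.val_succ, pow_succ, mul_neg_one, neg_smul]
    congr 3
    ext j
    refine Fin.cases ?_ (fun j => ?_) j <;> simp

/-- Every tuple is the cone over its tail with apex its head, so the cone formula gives the identity
by induction, without cancelling pairs of faces. -/
theorem boundary_boundary : ∀ (m : ℕ) (c : OrderedChain (m + 2) E),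
    boundary m E (boundary (m + 1) E c) = 0 := by
  intro m
  induction m with
  | zero =>
    intro c
    suffices h : boundary 0 E ∘ₗ boundary 1 E = 0 from LinearMap.congr_fun h c
    ext1 v
    ext1
    simp only [LinearMap.comp_apply, Finsupp.lsingle_apply, LinearMap.zero_apply]
    rw [← Fin.cons_self_tail v, ← cone_single, boundary_cone_succ, map_sub, boundary_cone_zero,
      sub_self]
  | succ m ih =>
    intro c
    suffices h : boundary (m + 1) E ∘ₗ boundary (m + 2) E = 0 from LinearMap.congr_fun h c
    ext1 v
    ext1
    simp only [LinearMap.comp_apply, Finsupp.lsingle_apply, LinearMap.zero_apply]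
    rw [← Fin.cons_self_tail v, ← cone_single, boundary_cone_succ, map_sub, boundary_cone_succ,
      ih, map_zero, sub_zero, sub_self]

theorem boundary_map (f : E → F) (c : OrderedChain (m + 1) E) :
    boundary m F (map f (m + 1) c) = map f m (boundary m E c) := by
  suffices h : boundary m F ∘ₗ map f (m + 1) = map f m ∘ₗ boundary m E from LinearMap.congr_fun h c
  ext1 v
  ext1
  simp only [LinearMap.comp_apply, Finsupp.lsingle_apply, map_single, boundary_single, map_sum,
    map_smul]
  rfl

theorem map_cone (f : E → F) (b : E) (c : OrderedChain m E) :
    map f (m + 1) (cone b m c) = cone (f b) m (map f m c) := by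
  suffices h : map f (m + 1) ∘ₗ cone b m = cone (f b) m ∘ₗ map f m from LinearMap.congr_fun h c
  ext1 v
  ext1
  simp only [LinearMap.comp_apply, Finsupp.lsingle_apply, map_single, cone_single]
  congr 1
  ext j
  refine Fin.cases ?_ (fun j => ?_) j <;> simp

variable (β : ∀ m : ℕ, (Fin (m + 1) → E) → E)

/-- Barycentric subdivision with respect to a choice `β` of barycenters. -/
noncomputable def subdivision : ∀ m : ℕ, OrderedChain m E →ₗ[ℚ] OrderedChain m E
  | 0 => LinearMap.id
  | m + 1 => Finsupp.linearCombination ℚ fun v =>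
      cone (β m v) m (subdivision m (boundary m E (Finsupp.single v 1)))

/-- The chain homotopy between the identity and barycentric subdivision. -/
noncomputable def subdivisionHomotopy : ∀ m : ℕ, OrderedChain m E →ₗ[ℚ] OrderedChain (m + 1) E
  | 0 => 0
  | m + 1 => Finsupp.linearCombination ℚ fun v =>
      cone (β m v) (m + 1)
        (Finsupp.single v 1 - subdivisionHomotopy m (boundary m E (Finsupp.single v 1)))

theorem subdivision_single (v : Fin (m + 1) → E) :
    subdivision β (m + 1) (Finsupp.single v 1) =
      cone (β m v) m (subdivision β m (boundary m E (Finsupp.single v 1))) := by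
  simp [subdivision]

theorem subdivisionHomotopy_single (v : Fin (m + 1) → E) :
    subdivisionHomotopy β (m + 1) (Finsupp.single v 1) =
      cone (β m v) (m + 1) (Finsupp.single v 1 -
        subdivisionHomotopy β m (boundary m E (Finsupp.single v 1))) := by
  simp [subdivisionHomotopy]

/-- In the cone formula the correction is the cone over the boundary of a subdivided boundary, which
is zero by induction and `boundary_boundary`. -/
theorem boundary_subdivision : ∀ (m : ℕ) (c : OrderedChain (m + 1) E),
    boundary m E (subdivision β (m + 1) c) = subdivision β m (boundary m E c) := by
  intro m c
  suffices h : boundary m E ∘ₗ subdivision β (m + 1) = subdivision β m ∘ₗ boundary m E from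
    LinearMap.congr_fun h c
  induction m with
  | zero =>
    ext1 v
    ext1
    simp only [LinearMap.comp_apply, Finsupp.lsingle_apply, subdivision_single, boundary_cone_zero]
  | succ m ih =>
    ext1 v
    ext1
    simp only [LinearMap.comp_apply, Finsupp.lsingle_apply, subdivision_single, boundary_cone_succ]
    rw [← LinearMap.comp_apply (boundary m E), ih (boundary _ _ (Finsupp.single v 1)),
      LinearMap.comp_apply, boundary_boundary, map_zero, map_zero, sub_zero]

/-- With `T` the homotopy, the chain `v - T ∂v` that is coned off has, by induction, boundary `Sd
∂v`; the cone over that is `Sd v`. The cone formula then reads `∂T v = v - T ∂v - Sd v`. -/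
theorem boundary_subdivisionHomotopy : ∀ (m : ℕ) (c : OrderedChain (m + 1) E),
    boundary (m + 1) E (subdivisionHomotopy β (m + 1) c) =
      c - subdivision β (m + 1) c - subdivisionHomotopy β m (boundary m E c) := by
  intro m c
  suffices h : boundary (m + 1) E ∘ₗ subdivisionHomotopy β (m + 1) =
      LinearMap.id - subdivision β (m + 1) - subdivisionHomotopy β m ∘ₗ boundary m E from
    LinearMap.congr_fun h c
  induction m with
  | zero =>
    ext1 v
    ext1
    simp only [LinearMap.comp_apply, Finsupp.lsingle_apply, subdivisionHomotopy_single,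
      boundary_cone_succ, LinearMap.sub_apply, LinearMap.id_apply, subdivision_single]
    simp [subdivisionHomotopy, subdivision]
  | succ m ih =>
    ext1 v
    ext1
    simp only [LinearMap.comp_apply, Finsupp.lsingle_apply, subdivisionHomotopy_single,
      boundary_cone_succ, LinearMap.sub_apply, LinearMap.id_apply, subdivision_single]
    have := LinearMap.congr_fun (ih (boundary _ _ (Finsupp.single v 1)))
      (boundary _ _ (Finsupp.single v 1))
    simp only [LinearMap.comp_apply, LinearMap.sub_apply, LinearMap.id_apply,
      boundary_boundary, map_zero, sub_zero] at this
    rw [map_sub, this, sub_sub_cancel]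
    abel

theorem map_subdivision {β' : ∀ m : ℕ, (Fin (m + 1) → F) → F} {f : E → F}
    (hf : ∀ m v, f (β m v) = β' m (f ∘ v)) : ∀ (m : ℕ) (c : OrderedChain m E),
    map f m (subdivision β m c) = subdivision β' m (map f m c) := by
  intro m c
  suffices h : map f m ∘ₗ subdivision β m = subdivision β' m ∘ₗ map f m from
    LinearMap.congr_fun h c
  induction m with
  | zero => rfl
  | succ m ih =>
    ext1 v
    ext1
    simp only [LinearMap.comp_apply, Finsupp.lsingle_apply, subdivision_single, map_single,
      map_cone, hf]
    rw [← LinearMap.comp_apply (map f m), ih (boundary _ _ (Finsupp.single v 1)),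
      LinearMap.comp_apply, ← boundary_map, map_single]

theorem map_subdivisionHomotopy {β' : ∀ m : ℕ, (Fin (m + 1) → F) → F} {f : E → F}
    (hf : ∀ m v, f (β m v) = β' m (f ∘ v)) : ∀ (m : ℕ) (c : OrderedChain m E),
    map f (m + 1) (subdivisionHomotopy β m c) = subdivisionHomotopy β' m (map f m c) := by
  intro m c
  suffices h : map f (m + 1) ∘ₗ subdivisionHomotopy β m = subdivisionHomotopy β' m ∘ₗ map f m from
    LinearMap.congr_fun h c
  induction m with
  | zero => simp [subdivisionHomotopy]
  | succ m ih =>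
    ext1 v
    ext1
    simp only [LinearMap.comp_apply, Finsupp.lsingle_apply, subdivisionHomotopy_single, map_single,
      map_cone, hf, map_sub]
    rw [← LinearMap.comp_apply (map f (m + 1)), ih (boundary _ _ (Finsupp.single v 1)),
      LinearMap.comp_apply, ← boundary_map, map_single]

end OrderedChain

/-! ### Singular chains -/

/-- The standard topological simplex with `m` vertices. -/
abbrev TopSimplex (m : ℕ) : Type := stdSimplex ℝ (Fin m)

namespace TopSimplex

variable {k l m : ℕ}

/-- The affine map between standard simplices with prescribed values on the vertices. -/
noncomputable def affine (v : Fin m → TopSimplex k) : C(TopSimplex m, TopSimplex k) where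
  toFun t := ⟨∑ i, t i • (v i : Fin k → ℝ), (convex_stdSimplex ℝ (Fin k)).sum_mem
    (fun i _ => t.2.1 i) t.2.2 (fun i _ => (v i).2)⟩
  continuous_toFun := by
    refine Continuous.subtype_mk (continuous_finsetSum _ fun i _ => ?_) _
    exact ((continuous_apply i).comp continuous_subtype_val).smul continuous_const

theorem coe_affine (v : Fin m → TopSimplex k) (t : TopSimplex m) :
    (affine v t : Fin k → ℝ) = ∑ i, t i • (v i : Fin k → ℝ) := rfl

theorem affine_apply (v : Fin m → TopSimplex k) (t : TopSimplex m) (j : Fin k) :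
    affine v t j = ∑ i, t i * v i j := by
  rw [coe_affine, Finset.sum_apply]
  rfl

/-- The vertices of the standard simplex. -/
noncomputable abbrev vertices (m : ℕ) : Fin m → TopSimplex m := fun i => stdSimplex.vertex i

theorem vertices_apply (i j : Fin m) : vertices m i j = if i = j then 1 else 0 := by
  change (stdSimplex.vertex i : Fin m → ℝ) j = _
  rw [stdSimplex.vertex_coe, Pi.single_apply]
  simp [eq_comm]

theorem affine_vertices_apply (v : Fin m → TopSimplex k) (i : Fin m) :
    affine v (vertices m i) = v i := by
  ext j
  change affine v (vertices m i) j = v i j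
  rw [affine_apply]
  simp [vertices_apply]

theorem affine_vertices : affine (vertices m) = ContinuousMap.id _ := by
  ext t j
  change affine (vertices m) t j = t j
  rw [affine_apply]
  simp [vertices_apply]

theorem affine_affine_apply (u : Fin k → TopSimplex l) (v : Fin m → TopSimplex k)
    (t : TopSimplex m) : affine u (affine v t) = affine (affine u ∘ v) t := by
  ext j
  change affine u (affine v t) j = affine (affine u ∘ v) t j
  simp only [affine_apply, Function.comp_apply, Finset.sum_mul, Finset.mul_sum]
  rw [Finset.sum_comm]
  simp only [mul_assoc]

theorem affine_comp_affine (u : Fin k → TopSimplex l) (v : Fin m → TopSimplex k) :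
    (affine u).comp (affine v) = affine (affine u ∘ v) :=
  ContinuousMap.ext (affine_affine_apply u v)

/-- The barycenter of a tuple of points of a standard simplex. -/
noncomputable def center (m : ℕ) (v : Fin (m + 1) → TopSimplex k) : TopSimplex k :=
  affine v stdSimplex.barycenter

/-- Affine maps preserve barycenters; this is the compatibility that makes subdivision natural. -/
theorem affine_center (u : Fin k → TopSimplex l) (m : ℕ) (v : Fin (m + 1) → TopSimplex k) :
    affine u (center m v) = center m (affine u ∘ v) :=
  affine_affine_apply u v _

/-- A point of an affine simplex is at least as close to a given point as one of the vertices. -/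
theorem dist_affine_le (v : Fin m → TopSimplex k) (t : TopSimplex m) (p : TopSimplex k) {r : ℝ}
    (h : ∀ i, dist (v i) p ≤ r) : dist (affine v t) p ≤ r := by
  have := (convex_closedBall (p : Fin k → ℝ) r).sum_mem (t := Finset.univ) (w := fun i => t i)
    (z := fun i => (v i : Fin k → ℝ)) (fun i _ => t.2.1 i) t.2.2 (fun i _ => h i)
  exact this

/-- The difference is the average of the `m + 1` vectors `v i - v j`, one of which vanishes. -/
theorem dist_center_le (v : Fin (m + 1) → TopSimplex k) {r : ℝ} (h : ∀ i j, dist (v i) (v j) ≤ r)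
    (j : Fin (m + 1)) : dist (center m v) (v j) ≤ (m / (m + 1) : ℝ) * r := by
  have hm : (0 : ℝ) < m + 1 := by positivity
  have e : (center m v).1 - (v j).1 =
      ∑ i, ((1 : ℝ) / (m + 1)) • ((v i).1 - (v j).1) := by
    change (affine v stdSimplex.barycenter : Fin k → ℝ) - (v j : Fin k → ℝ) = _
    rw [coe_affine, ← Finset.smul_sum, Finset.sum_sub_distrib, smul_sub, Finset.smul_sum]
    congr 1
    · refine Finset.sum_congr rfl fun i _ => ?_
      congr 1
      exact (stdSimplex.barycenter_apply i).trans (by simp)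
    · rw [Finset.sum_const, Finset.card_univ, Fintype.card_fin, ← Nat.cast_smul_eq_nsmul ℝ,
        smul_smul]
      push_cast
      rw [one_div, inv_mul_cancel₀ hm.ne', one_smul]
      rfl
  rw [Subtype.dist_eq, dist_eq_norm, e]
  refine (norm_sum_le _ _).trans ?_
  have hi : ∀ i ∈ Finset.univ, ‖((1 : ℝ) / (m + 1)) • ((v i).1 - (v j).1)‖ ≤
      if i = j then 0 else (1 / (m + 1)) * r := by
    intro i _
    split_ifs with hij
    · simp [hij]
    · rw [norm_smul, Real.norm_of_nonneg (by positivity), ← dist_eq_norm, ← Subtype.dist_eq]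
      exact mul_le_mul_of_nonneg_left (h i j) (by positivity)
  refine (Finset.sum_le_sum hi).trans (le_of_eq ?_)
  rw [Finset.sum_ite, Finset.sum_const_zero, zero_add, Finset.sum_const, nsmul_eq_mul,
    Finset.filter_ne', Finset.card_erase_of_mem (Finset.mem_univ _), Finset.card_univ,
    Fintype.card_fin, Nat.add_sub_cancel]
  ring

end TopSimplex

open TopSimplex

/-! ### The mesh of iterated barycentric subdivisions. -/

namespace OrderedChain

theorem induction_support {E : Type u} {m : ℕ} {V : Type v} [AddCommGroup V] [Module ℚ V]
    (f : OrderedChain m E →ₗ[ℚ] V) (P : Submodule ℚ V) (c : OrderedChain m E)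
    (h : ∀ v ∈ c.support, f (Finsupp.single v 1) ∈ P) : f c ∈ P := by
  rw [← Finsupp.sum_single c, Finsupp.sum, map_sum]
  refine Submodule.sum_mem _ fun v hv => ?_
  rw [← mul_one (c v), ← smul_eq_mul, ← Finsupp.smul_single, map_smul]
  exact P.smul_mem _ (h v hv)

/-- The chains of simplices of diameter at most `s` whose vertices lie in every closed ball that
contains `Q`. -/
def fine {k : ℕ} (m : ℕ) (Q : Set (TopSimplex k)) (s : ℝ) :
    Submodule ℚ (OrderedChain m (TopSimplex k)) :=
  Finsupp.supported ℚ ℚ {v | (∀ p r, (∀ q ∈ Q, dist q p ≤ r) → ∀ i, dist (v i) p ≤ r) ∧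
    ∀ i j, dist (v i) (v j) ≤ s}

/-- A new simplex is the barycenter joined to a simplex of a subdivided face. Distances within the
face are handled by induction. All original vertices lie in the ball of radius `m / (m + 1) * s`
about the barycenter, hence so do the new ones. The bound by `N` gives one contraction factor for
all dimensions. -/
theorem subdivision_mem_fine {k : ℕ} (N : ℕ) : ∀ (m : ℕ), m ≤ N + 1 →
    ∀ (v : Fin m → TopSimplex k) (s : ℝ), (∀ i j, dist (v i) (v j) ≤ s) →
    subdivision center m (Finsupp.single v 1) ∈ fine m (Set.range v) ((N / (N + 1) : ℝ) * s) := by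
  intro m
  induction m with
  | zero =>
    intro _ v s _
    exact Finsupp.single_mem_supported ℚ _ ⟨fun _ _ _ i => i.elim0, fun i => i.elim0⟩
  | succ m ih =>
    intro hm v s hv
    have hs : 0 ≤ s := dist_nonneg.trans (hv 0 0)
    have hmN : (m / (m + 1) : ℝ) * s ≤ (N / (N + 1) : ℝ) * s := by
      refine mul_le_mul_of_nonneg_right ?_ hs
      rw [div_le_div_iff₀ (by positivity) (by positivity)]
      have : (m : ℝ) ≤ N := by exact_mod_cast Nat.le_of_succ_le_succ hm
      nlinarith
    rw [subdivision_single, boundary_single, map_sum, map_sum]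
    refine Submodule.sum_mem _ fun i _ => ?_
    rw [map_smul, map_smul]
    refine Submodule.smul_mem _ _ ?_
    have h1 := ih (by omega) (v ∘ i.succAbove) s fun a b => hv _ _
    refine induction_support (cone (center m v) m) (fine (m + 1) _ _) _ fun w hw => ?_
    rw [cone_single]
    obtain ⟨w1, w2⟩ := h1 hw
    have hr : ∀ p r, (∀ q ∈ Set.range v, dist q p ≤ r) → ∀ i, dist (w i) p ≤ r := fun p r hp =>
      w1 p r fun q hq => hp q (Set.range_comp_subset_range _ _ hq)
    have hc : ∀ j, dist (center m v) (w j) ≤ (m / (m + 1) : ℝ) * s := fun j => by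
      rw [dist_comm]
      refine hr _ _ ?_ j
      rintro _ ⟨a, rfl⟩
      rw [dist_comm]
      exact dist_center_le v hv a
    refine Finsupp.single_mem_supported ℚ _ ⟨fun p r hp a => ?_, fun a b => ?_⟩
    · refine Fin.cases ?_ (fun a => ?_) a
      · exact dist_affine_le v _ p fun i => hp _ ⟨i, rfl⟩
      · simpa using hr p r hp a
    · refine Fin.cases ?_ (fun a => ?_) a <;> refine Fin.cases ?_ (fun b => ?_) b
      · simpa using by positivity
      · simpa using (hc b).trans hmN
      · simpa [dist_comm] using (hc a).trans hmN
      · simpa using w2 a b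

theorem iterate_subdivision_mem_fine {m : ℕ} {s : ℝ} (hs : 0 < s) :
    ∃ n : ℕ, (subdivision center m)^[n] (Finsupp.single (vertices m) 1) ∈
      (fine m Set.univ s : Submodule ℚ (OrderedChain m (TopSimplex m))) := by
  have key : ∀ n : ℕ, (subdivision center m)^[n] (Finsupp.single (vertices m) 1) ∈
      (fine m Set.univ ((m / (m + 1) : ℝ) ^ n * 2) : Submodule ℚ (OrderedChain m (TopSimplex m))) := by
    intro n
    induction n with
    | zero =>
      refine Finsupp.single_mem_supported ℚ _ ⟨fun p r h i => h _ trivial, fun i j => ?_⟩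
      rw [pow_zero, one_mul]
      -- The initial constant `2` is a diameter bound: the simplex lies in the unit ball about the
      -- origin.
      have h0 : ∀ x : TopSimplex m, dist x.1 0 ≤ 1 := fun x =>
        stdSimplex_subset_closedBall x.2
      rw [Subtype.dist_eq]
      linarith [dist_triangle_right (vertices m i).1 (vertices m j).1 0,
        h0 (vertices m i), h0 (vertices m j)]
    | succ n ih =>
      rw [Function.iterate_succ_apply']
      refine induction_support (subdivision center m) _ _ fun w hw => ?_
      have := subdivision_mem_fine m m (by omega) w _ (ih hw).2
      refine Finsupp.supported_mono ?_ this
      rintro x ⟨h1, h2⟩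
      refine ⟨fun p r h => h1 p r fun q _ => h q trivial, ?_⟩
      rw [pow_succ', mul_assoc]
      exact h2
  have hlt : (m / (m + 1) : ℝ) < 1 := by
    rw [div_lt_one (by positivity)]; linarith
  obtain ⟨n, hn⟩ := exists_pow_lt_of_lt_one (half_pos hs) hlt
  refine ⟨n, Finsupp.supported_mono ?_ (key n)⟩
  rintro x ⟨h1, h2⟩
  exact ⟨h1, fun i j => (h2 i j).trans (by linarith)⟩

end OrderedChain

open TopSimplex

/-- Rational singular chains of simplices with `m` vertices. -/
abbrev SingularChain (m : ℕ) (M : Type u) [TopologicalSpace M] : Type u := C(TopSimplex m, M) →₀ ℚ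

namespace SingularChain

variable {M : Type u} [TopologicalSpace M] {N : Type v} [TopologicalSpace N] {k m : ℕ}

/-- The singular boundary; in the lowest degree it is the augmentation. -/
noncomputable def boundary (m : ℕ) (M : Type u) [TopologicalSpace M] :
    SingularChain (m + 1) M →ₗ[ℚ] SingularChain m M :=
  Finsupp.linearCombination ℚ fun σ => ∑ i : Fin (m + 1),
    (-1 : ℚ) ^ (i : ℕ) • Finsupp.single (σ.comp (affine (vertices (m + 1) ∘ i.succAbove))) 1

theorem boundary_single (σ : C(TopSimplex (m + 1), M)) :
    boundary m M (Finsupp.single σ 1) = ∑ i : Fin (m + 1), (-1 : ℚ) ^ (i : ℕ) •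
      Finsupp.single (σ.comp (affine (vertices (m + 1) ∘ i.succAbove))) 1 := by
  simp [boundary]

/-- The map on singular chains induced by a continuous map. -/
noncomputable def map (f : C(M, N)) (m : ℕ) : SingularChain m M →ₗ[ℚ] SingularChain m N :=
  Finsupp.lmapDomain ℚ ℚ fun σ => f.comp σ

theorem map_single (f : C(M, N)) (σ : C(TopSimplex m, M)) :
    map f m (Finsupp.single σ 1) = Finsupp.single (f.comp σ) 1 := by
  simp [map]

/-- The singular chain obtained from a chain of affine simplices in the domain of `σ`. -/
noncomputable def realize (σ : C(TopSimplex k, M)) (m : ℕ) :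
    OrderedChain m (TopSimplex k) →ₗ[ℚ] SingularChain m M :=
  Finsupp.lmapDomain ℚ ℚ fun v => σ.comp (affine v)

theorem realize_single (σ : C(TopSimplex k, M)) (v : Fin m → TopSimplex k) :
    realize σ m (Finsupp.single v 1) = Finsupp.single (σ.comp (affine v)) 1 := by
  simp [realize]

theorem realize_vertices (σ : C(TopSimplex m, M)) :
    realize σ m (Finsupp.single (vertices m) 1) = Finsupp.single σ 1 := by
  rw [realize_single, affine_vertices, ContinuousMap.comp_id]

theorem boundary_realize (σ : C(TopSimplex k, M)) (c : OrderedChain (m + 1) (TopSimplex k)) :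
    boundary m M (realize σ (m + 1) c) = realize σ m (OrderedChain.boundary m _ c) := by
  suffices h : boundary m M ∘ₗ realize σ (m + 1) = realize σ m ∘ₗ OrderedChain.boundary m _ from
    LinearMap.congr_fun h c
  ext1 v
  ext1
  simp only [LinearMap.comp_apply, Finsupp.lsingle_apply, realize_single, boundary_single,
    OrderedChain.boundary_single, map_sum, map_smul, ContinuousMap.comp_assoc, affine_comp_affine]
  refine Finset.sum_congr rfl fun i _ => ?_
  congr 4
  funext j
  exact affine_vertices_apply v _

theorem map_realize (f : C(M, N)) (σ : C(TopSimplex k, M)) (c : OrderedChain m (TopSimplex k)) :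
    map f m (realize σ m c) = realize (f.comp σ) m c := by
  suffices h : map f m ∘ₗ realize σ m = realize (f.comp σ) m from LinearMap.congr_fun h c
  ext1 v
  ext1
  simp only [LinearMap.comp_apply, Finsupp.lsingle_apply, realize_single, map_single,
    ContinuousMap.comp_assoc]

theorem realize_comp_affine (σ : C(TopSimplex k, M)) {l : ℕ} (u : Fin l → TopSimplex k)
    (c : OrderedChain m (TopSimplex l)) :
    realize (σ.comp (affine u)) m c = realize σ m (OrderedChain.map (affine u) m c) := by
  suffices h : realize (σ.comp (affine u)) m = realize σ m ∘ₗ OrderedChain.map (affine u) m from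
    LinearMap.congr_fun h c
  ext1 v
  ext1
  simp only [LinearMap.comp_apply, Finsupp.lsingle_apply, realize_single, OrderedChain.map_single,
    ContinuousMap.comp_assoc, affine_comp_affine]

/-- Every singular simplex is the realization of the identity affine simplex, so identities between
natural operators reduce to those of ordered chains. -/
theorem hom_ext_realize {V : Type w} [AddCommGroup V] [Module ℚ V]
    {f g : SingularChain m M →ₗ[ℚ] V}
    (h : ∀ σ : C(TopSimplex m, M), f (realize σ m (Finsupp.single (vertices m) 1)) =
      g (realize σ m (Finsupp.single (vertices m) 1))) : f = g := by
  ext1 σ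
  ext1
  change f (Finsupp.single σ 1) = g (Finsupp.single σ 1)
  rw [← realize_vertices]
  exact h σ

theorem boundary_map (f : C(M, N)) (c : SingularChain (m + 1) M) :
    boundary m N (map f (m + 1) c) = map f m (boundary m M c) := by
  suffices h : boundary m N ∘ₗ map f (m + 1) = map f m ∘ₗ boundary m M from LinearMap.congr_fun h c
  refine hom_ext_realize fun σ => ?_
  simp only [LinearMap.comp_apply, boundary_realize, map_realize]

/-- Barycentric subdivision of singular chains. -/
noncomputable def subdivision (m : ℕ) (M : Type u) [TopologicalSpace M] :
    SingularChain m M →ₗ[ℚ] SingularChain m M :=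
  Finsupp.linearCombination ℚ fun σ =>
    realize σ m (OrderedChain.subdivision center m (Finsupp.single (vertices m) 1))

/-- The natural chain homotopy between the identity and barycentric subdivision. -/
noncomputable def subdivisionHomotopy (m : ℕ) (M : Type u) [TopologicalSpace M] :
    SingularChain m M →ₗ[ℚ] SingularChain (m + 1) M :=
  Finsupp.linearCombination ℚ fun σ =>
    realize σ (m + 1) (OrderedChain.subdivisionHomotopy center m (Finsupp.single (vertices m) 1))

theorem map_affine_vertices (v : Fin m → TopSimplex k) :
    OrderedChain.map (affine v) m (Finsupp.single (vertices m) 1) = Finsupp.single v 1 := by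
  rw [OrderedChain.map_single]
  congr 1
  funext j
  exact affine_vertices_apply v j

/-- Singular subdivision is defined on the universal simplex only; naturality under affine maps
extends the formula to all affine chains. -/
theorem subdivision_realize (σ : C(TopSimplex k, M)) (c : OrderedChain m (TopSimplex k)) :
    subdivision m M (realize σ m c) = realize σ m (OrderedChain.subdivision center m c) := by
  suffices h : subdivision m M ∘ₗ realize σ m =
    realize σ m ∘ₗ OrderedChain.subdivision center m from LinearMap.congr_fun h c
  ext1 v
  ext1
  simp only [LinearMap.comp_apply, Finsupp.lsingle_apply, realize_single, subdivision,
    Finsupp.linearCombination_single, one_smul]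
  rw [realize_comp_affine, OrderedChain.map_subdivision center (affine_center v),
    map_affine_vertices]

theorem subdivisionHomotopy_realize (σ : C(TopSimplex k, M)) (c : OrderedChain m (TopSimplex k)) :
    subdivisionHomotopy m M (realize σ m c) =
      realize σ (m + 1) (OrderedChain.subdivisionHomotopy center m c) := by
  suffices h : subdivisionHomotopy m M ∘ₗ realize σ m =
    realize σ (m + 1) ∘ₗ OrderedChain.subdivisionHomotopy center m from LinearMap.congr_fun h c
  ext1 v
  ext1
  simp only [LinearMap.comp_apply, Finsupp.lsingle_apply, realize_single, subdivisionHomotopy,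
    Finsupp.linearCombination_single, one_smul]
  rw [realize_comp_affine, OrderedChain.map_subdivisionHomotopy center (affine_center v),
    map_affine_vertices]

theorem boundary_subdivision (c : SingularChain (m + 1) M) :
    boundary m M (subdivision (m + 1) M c) = subdivision m M (boundary m M c) := by
  suffices h : boundary m M ∘ₗ subdivision (m + 1) M = subdivision m M ∘ₗ boundary m M from
    LinearMap.congr_fun h c
  refine hom_ext_realize fun σ => ?_
  simp only [LinearMap.comp_apply, subdivision_realize, boundary_realize,
    OrderedChain.boundary_subdivision]

theorem boundary_subdivisionHomotopy (c : SingularChain (m + 1) M) :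
    boundary (m + 1) M (subdivisionHomotopy (m + 1) M c) =
      c - subdivision (m + 1) M c - subdivisionHomotopy m M (boundary m M c) := by
  suffices h : boundary (m + 1) M ∘ₗ subdivisionHomotopy (m + 1) M = LinearMap.id -
      subdivision (m + 1) M - subdivisionHomotopy m M ∘ₗ boundary m M from LinearMap.congr_fun h c
  refine hom_ext_realize fun σ => ?_
  simp only [LinearMap.comp_apply, LinearMap.sub_apply, LinearMap.id_apply, subdivision_realize,
    boundary_realize, subdivisionHomotopy_realize, OrderedChain.boundary_subdivisionHomotopy,
    map_sub]

theorem subdivision_map (f : C(M, N)) (c : SingularChain m M) :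
    subdivision m N (map f m c) = map f m (subdivision m M c) := by
  suffices h : subdivision m N ∘ₗ map f m = map f m ∘ₗ subdivision m M from LinearMap.congr_fun h c
  refine hom_ext_realize fun σ => ?_
  simp only [LinearMap.comp_apply, subdivision_realize, map_realize]

/-! ### Relative chains -/

/-- The chains of the subspace `s`. -/
def supportedIn (s : Set M) (m : ℕ) : Submodule ℚ (SingularChain m M) :=
  Finsupp.supported ℚ ℚ {σ | ∀ t, σ t ∈ s}

theorem induction_support {V : Type w} [AddCommGroup V] [Module ℚ V]
    (f : SingularChain m M →ₗ[ℚ] V) (P : Submodule ℚ V) (c : SingularChain m M)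
    (h : ∀ σ ∈ c.support, f (Finsupp.single σ 1) ∈ P) : f c ∈ P := by
  rw [← Finsupp.sum_single c, Finsupp.sum, map_sum]
  refine Submodule.sum_mem _ fun v hv => ?_
  rw [← mul_one (c v), ← smul_eq_mul, ← Finsupp.smul_single, map_smul]
  exact P.smul_mem _ (h v hv)

theorem realize_mem_supportedIn {s : Set M} {σ : C(TopSimplex k, M)} (hσ : ∀ t, σ t ∈ s)
    (c : OrderedChain m (TopSimplex k)) : realize σ m c ∈ supportedIn s m := by
  refine OrderedChain.induction_support _ _ _ fun v _ => ?_
  rw [realize_single]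
  exact Finsupp.single_mem_supported ℚ _ fun t => hσ _

theorem boundary_mem_supportedIn {s : Set M} {c : SingularChain (m + 1) M}
    (hc : c ∈ supportedIn s (m + 1)) : boundary m M c ∈ supportedIn s m := by
  refine induction_support _ _ _ fun σ hσ => ?_
  rw [← realize_vertices, boundary_realize]
  exact realize_mem_supportedIn (hc hσ) _

theorem subdivision_mem_supportedIn {s : Set M} {c : SingularChain m M}
    (hc : c ∈ supportedIn s m) : subdivision m M c ∈ supportedIn s m := by
  refine induction_support _ _ _ fun σ hσ => ?_
  rw [← realize_vertices, subdivision_realize]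
  exact realize_mem_supportedIn (hc hσ) _

theorem subdivisionHomotopy_mem_supportedIn {s : Set M} {c : SingularChain m M}
    (hc : c ∈ supportedIn s m) : subdivisionHomotopy m M c ∈ supportedIn s (m + 1) := by
  refine induction_support _ _ _ fun σ hσ => ?_
  rw [← realize_vertices, subdivisionHomotopy_realize]
  exact realize_mem_supportedIn (hc hσ) _

theorem iterate_subdivision_mem_supportedIn {s : Set M} {c : SingularChain m M}
    (hc : c ∈ supportedIn s m) (n : ℕ) : (subdivision m M)^[n] c ∈ supportedIn s m := by
  induction n with
  | zero => exact hc
  | succ n ih => rw [Function.iterate_succ_apply']; exact subdivision_mem_supportedIn ih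

theorem iterate_subdivision_realize (σ : C(TopSimplex k, M)) (c : OrderedChain m (TopSimplex k))
    (n : ℕ) : (subdivision m M)^[n] (realize σ m c) =
      realize σ m ((OrderedChain.subdivision center m)^[n] c) := by
  induction n with
  | zero => rfl
  | succ n ih => rw [Function.iterate_succ_apply', ih, subdivision_realize,
      Function.iterate_succ_apply']

/-- Iterated subdivision makes chains subordinate to a cover by two open sets. -/
theorem exists_iterate_subdivision_mem_sup {s t : Set M} (hs : IsOpen s) (ht : IsOpen t)
    (hst : s ∪ t = Set.univ) (c : SingularChain m M) :
    ∃ n : ℕ, (subdivision m M)^[n] c ∈ supportedIn s m ⊔ supportedIn t m := by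
  have mono : ∀ (c : SingularChain m M) (n n' : ℕ), n ≤ n' →
      (subdivision m M)^[n] c ∈ supportedIn s m ⊔ supportedIn t m →
      (subdivision m M)^[n'] c ∈ supportedIn s m ⊔ supportedIn t m := by
    intro c n n' hn h
    obtain ⟨a, ha, b, hb, hab⟩ := Submodule.mem_sup.1 h
    rw [← Nat.sub_add_cancel hn, Function.iterate_add_apply, ← hab]
    rw [← Module.End.coe_pow, map_add, Module.End.coe_pow]
    exact Submodule.add_mem_sup (iterate_subdivision_mem_supportedIn ha _)
      (iterate_subdivision_mem_supportedIn hb _)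
  induction c using Finsupp.induction_linear with
  | zero => exact ⟨0, zero_mem _⟩
  | add a b iha ihb =>
    obtain ⟨n, hn⟩ := iha
    obtain ⟨n', hn'⟩ := ihb
    refine ⟨max n n', ?_⟩
    rw [← Module.End.coe_pow, map_add, Module.End.coe_pow]
    exact add_mem (mono _ _ _ (le_max_left _ _) hn) (mono _ _ _ (le_max_right _ _) hn')
  | single σ q =>
    -- A Lebesgue number of the cover of the simplex by the preimages of `s` and `t`: once the
    -- affine pieces have diameter at most `δ / 2`, each is mapped into one of the two sets.
    obtain ⟨δ, hδ, hball⟩ := lebesgue_number_lemma_of_metric (s := (Set.univ : Set (TopSimplex m)))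
      (c := fun b : Bool => σ ⁻¹' (if b then s else t)) isCompact_univ
      (by rintro (_ | _) <;> exact IsOpen.preimage σ.continuous (by simpa))
      (by
        intro x _
        have : σ x ∈ s ∪ t := hst ▸ Set.mem_univ _
        rcases this with h | h
        · exact Set.mem_iUnion.2 ⟨true, by simpa using h⟩
        · exact Set.mem_iUnion.2 ⟨false, by simpa using h⟩)
    obtain ⟨n, hn⟩ := OrderedChain.iterate_subdivision_mem_fine (m := m) (half_pos hδ)
    refine ⟨n, ?_⟩
    rw [← mul_one q, ← smul_eq_mul, ← Finsupp.smul_single, ← Module.End.coe_pow, map_smul,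
      Module.End.coe_pow, ← realize_vertices, iterate_subdivision_realize]
    refine Submodule.smul_mem _ _ (OrderedChain.induction_support _ _ _ fun v hv => ?_)
    rw [realize_single]
    obtain ⟨-, hv⟩ := hn hv
    rcases Nat.eq_zero_or_pos m with rfl | hm
    -- The simplex without vertices is the empty space, so any support condition on it is vacuous.
    · exact Submodule.mem_sup_left (Finsupp.single_mem_supported ℚ _ fun x =>
        absurd x.2.2 (by simp))
    · obtain ⟨b, hb⟩ := hball (v ⟨0, hm⟩) trivial
      have hin : ∀ x, σ (affine v x) ∈ (if b then s else t) := fun x =>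
        hb (Metric.mem_ball.2 ((dist_affine_le v x _ fun i => hv i _).trans_lt (half_lt_self hδ)))
      cases b
      · exact Submodule.mem_sup_right (Finsupp.single_mem_supported ℚ _ hin)
      · exact Submodule.mem_sup_left (Finsupp.single_mem_supported ℚ _ hin)

/-- The cycles of `M` relative to the subspace `s`. -/
noncomputable def relativeCycles (s : Set M) (m : ℕ) : Submodule ℚ (SingularChain (m + 1) M) :=
  (supportedIn s m).comap (boundary m M)

/-- The boundaries of `M` relative to the subspace `s`. -/
noncomputable def relativeBoundaries (s : Set M) (m : ℕ) : Submodule ℚ (SingularChain (m + 1) M) :=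
  LinearMap.range (boundary (m + 1) M) ⊔ supportedIn s (m + 1)

/-- The singular homology of `M` relative to the subspace `s`, in degree `m`. -/
abbrev RelativeHomology (s : Set M) (m : ℕ) : Type u :=
  relativeCycles s m ⧸ (relativeBoundaries s m).submoduleOf (relativeCycles s m)

/-- The subdivision homotopy preserves chains in `s`, so subdividing does not change the relative
homology class. -/
theorem sub_iterate_subdivision_mem {s : Set M} {c : SingularChain (m + 1) M}
    (hc : c ∈ relativeCycles s m) (n : ℕ) :
    (subdivision (m + 1) M)^[n] c ∈ relativeCycles s m ∧
      c - (subdivision (m + 1) M)^[n] c ∈ relativeBoundaries s m := by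
  induction n with
  | zero => exact ⟨hc, by simp⟩
  | succ n ih =>
    rw [Function.iterate_succ_apply']
    set d := (subdivision (m + 1) M)^[n] c
    obtain ⟨h1, h2⟩ := ih
    refine ⟨?_, ?_⟩
    · rw [relativeCycles, Submodule.mem_comap]
      rw [boundary_subdivision]
      exact subdivision_mem_supportedIn h1
    · rw [← sub_add_sub_cancel c d]
      refine add_mem h2 ?_
      have := boundary_subdivisionHomotopy d
      rw [eq_sub_iff_add_eq] at this
      rw [← this]
      exact Submodule.add_mem_sup ⟨_, rfl⟩ (subdivisionHomotopy_mem_supportedIn h1)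

/-- A simplex with image in the range of an embedding factors continuously through it. -/
theorem mem_range_map {f : C(M, N)} (hf : IsEmbedding f) {c : SingularChain m N}
    (hc : c ∈ supportedIn (Set.range f) m) : ∃ c', map f m c' = c := by
  refine induction_support LinearMap.id (LinearMap.range (map f m) : Submodule ℚ (SingularChain m N))
    c fun σ hσ => ?_
  let τ : C(TopSimplex m, M) := ⟨fun t => hf.toHomeomorph.symm ⟨σ t, hc hσ t⟩, by fun_prop⟩
  refine ⟨Finsupp.single τ 1, ?_⟩
  rw [map_single, LinearMap.id_apply]
  congr 1
  ext t
  exact congrArg Subtype.val (hf.toHomeomorph.apply_symm_apply ⟨σ t, hc hσ t⟩)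

theorem map_mem_supportedIn_iff {f : C(M, N)} (hf : Function.Injective f) {s : Set N}
    {c : SingularChain m M} : map f m c ∈ supportedIn s m ↔ c ∈ supportedIn (f ⁻¹' s) m := by
  have hinj : Function.Injective fun σ : C(TopSimplex m, M) => f.comp σ := fun σ τ h =>
    ContinuousMap.ext fun t => hf (DFunLike.congr_fun h t)
  rw [supportedIn, supportedIn, Finsupp.mem_supported, Finsupp.mem_supported]
  classical
  rw [map, Finsupp.lmapDomain_apply, Finsupp.mapDomain_support_of_injective hinj, Finset.coe_image,
    Set.image_subset_iff]
  rfl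

theorem map_mem_relativeCycles_iff {f : C(M, N)} (hf : Function.Injective f) {s : Set N}
    {c : SingularChain (m + 1) M} :
    map f (m + 1) c ∈ relativeCycles s m ↔ c ∈ relativeCycles (f ⁻¹' s) m := by
  rw [relativeCycles, relativeCycles, Submodule.mem_comap, Submodule.mem_comap, boundary_map,
    map_mem_supportedIn_iff hf]

theorem map_mem_relativeBoundaries {f : C(M, N)} (hf : Function.Injective f) {s : Set N}
    {c : SingularChain (m + 1) M} (hc : c ∈ relativeBoundaries (f ⁻¹' s) m) :
    map f (m + 1) c ∈ relativeBoundaries s m := by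
  obtain ⟨_, ⟨b, rfl⟩, a, ha, rfl⟩ := Submodule.mem_sup.1 hc
  rw [map_add, ← boundary_map]
  exact Submodule.add_mem_sup ⟨_, rfl⟩ ((map_mem_supportedIn_iff hf).2 ha)

/-! ### Excision for open embeddings. -/

/-- Excision, on the level of chains. -/
theorem mem_relativeBoundaries_of_map {f : C(M, N)} (hf : IsOpenEmbedding f) {s : Set N}
    (hs : IsOpen s) (hfs : Set.range f ∪ s = Set.univ) {c : SingularChain (m + 1) M}
    (hcyc : c ∈ relativeCycles (f ⁻¹' s) m) (hc : map f (m + 1) c ∈ relativeBoundaries s m) :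
    c ∈ relativeBoundaries (f ⁻¹' s) m := by
  obtain ⟨_, ⟨b, rfl⟩, a, ha, hab⟩ := Submodule.mem_sup.1 hc
  -- With `f c = ∂b + a`, subdivide until `Sdⁿ b = f b' + a'`, where `a'` lies in `s`. Then `f (Sdⁿ
  -- c - ∂b') = ∂a' + Sdⁿ a` lies in `s`, which exhibits `Sdⁿ c`, and so `c`, as a relative
  -- boundary.
  obtain ⟨n, hn⟩ := exists_iterate_subdivision_mem_sup hf.isOpen_range hs hfs b
  obtain ⟨b', hb', a', ha', hab'⟩ := Submodule.mem_sup.1 hn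
  obtain ⟨b', rfl⟩ := mem_range_map hf.isEmbedding hb'
  have hbd : ∀ n : ℕ, ∀ b : SingularChain (m + 2) N,
      (subdivision (m + 1) N)^[n] (boundary (m + 1) N b) =
        boundary (m + 1) N ((subdivision (m + 2) N)^[n] b) := by
    intro n
    induction n with
    | zero => exact fun b => rfl
    | succ n ih => intro b; rw [Function.iterate_succ_apply, Function.iterate_succ_apply, ← ih,
        boundary_subdivision]
  have hmap : ∀ n : ℕ, ∀ c : SingularChain (m + 1) M,
      (subdivision (m + 1) N)^[n] (map f (m + 1) c) =
        map f (m + 1) ((subdivision (m + 1) M)^[n] c) := by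
    intro n
    induction n with
    | zero => exact fun b => rfl
    | succ n ih => intro b; rw [Function.iterate_succ_apply, Function.iterate_succ_apply, ← ih,
        subdivision_map]
  obtain ⟨-, h2⟩ := sub_iterate_subdivision_mem hcyc n
  rw [← sub_add_cancel c ((subdivision (m + 1) M)^[n] c)]
  refine add_mem h2 ?_
  rw [← add_sub_cancel (boundary (m + 1) M b') ((subdivision (m + 1) M)^[n] c)]
  refine Submodule.add_mem_sup ⟨_, rfl⟩ ((map_mem_supportedIn_iff hf.injective).1 ?_)
  rw [map_sub, ← hmap, ← boundary_map, ← hab, ← Module.End.coe_pow, map_add, Module.End.coe_pow,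
    hbd, ← hab', map_add]
  rw [add_sub_right_comm, add_sub_cancel_left]
  exact add_mem (boundary_mem_supportedIn ha') (iterate_subdivision_mem_supportedIn ha n)

/-- Excision. -/
noncomputable def excision {f : C(M, N)} (hf : IsOpenEmbedding f) {s : Set N}
    (hs : IsOpen s) (hfs : Set.range f ∪ s = Set.univ) (m : ℕ) :
    RelativeHomology (f ⁻¹' s) m ≃ₗ[ℚ] RelativeHomology s m := by
  let φ : relativeCycles (f ⁻¹' s) m →ₗ[ℚ] relativeCycles s m :=
    (map f (m + 1)).restrict fun c hc => (map_mem_relativeCycles_iff hf.injective).2 hc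
  refine LinearEquiv.ofBijective (Submodule.mapQ _ _ φ fun c hc =>
    map_mem_relativeBoundaries hf.injective hc) ⟨?_, ?_⟩
  · refine (injective_iff_map_eq_zero _).2 fun y hy => ?_
    obtain ⟨c, rfl⟩ := Submodule.Quotient.mk_surjective _ y
    have hc : φ c ∈ (relativeBoundaries s m).submoduleOf (relativeCycles s m) :=
      (Submodule.Quotient.mk_eq_zero _).1 hy
    exact (Submodule.Quotient.mk_eq_zero _).2 (mem_relativeBoundaries_of_map hf hs hfs c.2 hc)
  · intro y
    obtain ⟨⟨c, hc⟩, rfl⟩ := Submodule.Quotient.mk_surjective _ y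
    -- A fine subdivision of the cycle splits into a part from `M` and a part in `s`; the part from
    -- `M` represents the same class.
    obtain ⟨n, hn⟩ := exists_iterate_subdivision_mem_sup hf.isOpen_range hs hfs c
    obtain ⟨b', hb', a', ha', hab'⟩ := Submodule.mem_sup.1 hn
    obtain ⟨b', rfl⟩ := mem_range_map hf.isEmbedding hb'
    obtain ⟨h1, h2⟩ := sub_iterate_subdivision_mem hc n
    have hb : b' ∈ relativeCycles (f ⁻¹' s) m := by
      rw [← map_mem_relativeCycles_iff hf.injective, ← add_sub_cancel_right (map f _ b') a', hab']
      exact sub_mem h1 (boundary_mem_supportedIn ha')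
    refine ⟨Submodule.Quotient.mk ⟨b', hb⟩, (Submodule.Quotient.eq _).2 ?_⟩
    change map f (m + 1) b' - c ∈ relativeBoundaries s m
    rw [← neg_mem_iff, neg_sub, ← add_sub_cancel_right (map f _ b') a', hab', ← sub_add]
    exact add_mem h2 (Submodule.mem_sup_right ha')

end SingularChain

/-! ### Comparison with the singular chain complex of Mathlib -/

namespace SingularChain

open Simplicial

/-- The coefficients `ℚ`, in any universe. -/
abbrev coefficients : ModuleCat.{u} ℚ := ModuleCat.of ℚ (ULift.{u} ℚ)

variable (M : TopCat.{u}) (n : ℕ)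

/-- The `n`-simplices of the singular set, as continuous maps. -/
noncomputable def simplexEquiv : (TopCat.toSSet.obj M) _⦋n⦌ ≃ C(TopSimplex (n + 1), M) :=
  TopCat.toSSetObjEquiv M (.op ⦋n⦌)

theorem simplexEquiv_δ (x : (TopCat.toSSet.obj M) _⦋n + 1⦌) (i : Fin (n + 2)) :
    simplexEquiv M n ((TopCat.toSSet.obj M).δ i x) =
      (simplexEquiv M (n + 1) x).comp
        (TopSimplex.affine (TopSimplex.vertices (n + 2) ∘ i.succAbove)) := by
  ext t
  change simplexEquiv M (n + 1) x (stdSimplex.map (SimplexCategory.δ i).toOrderHom t) = _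
  rw [ContinuousMap.comp_apply]
  congr 1
  ext j
  change stdSimplex.map (SimplexCategory.δ i).toOrderHom t j = TopSimplex.affine _ t j
  rw [TopSimplex.affine_apply, stdSimplex.map_coe, FunOnFinite.linearMap_apply_apply,
    Finset.sum_filter]
  simp [TopSimplex.vertices_apply, SimplexCategory.δ]

theorem simplexEquiv_symm_δ (σ : C(TopSimplex (n + 2), M)) (i : Fin (n + 2)) :
    (TopCat.toSSet.obj M).δ i ((simplexEquiv M (n + 1)).symm σ) = (simplexEquiv M n).symm
      (σ.comp (TopSimplex.affine (TopSimplex.vertices (n + 2) ∘ i.succAbove))) := by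
  rw [Equiv.eq_symm_apply, simplexEquiv_δ, Equiv.apply_symm_apply]

/-- The comparison from concrete singular chains to those of Mathlib. -/
noncomputable def toComplex :
    SingularChain (n + 1) M →ₗ[ℚ] ((TopCat.toSSet.obj M).chainComplex coefficients.{u}).X n :=
  Finsupp.linearCombination ℚ fun σ =>
    ((TopCat.toSSet.obj M).ιChainComplex (R := coefficients.{u})
      ((simplexEquiv M n).symm σ)).hom (ULift.up 1)

theorem toComplex_single (σ : C(TopSimplex (n + 1), M)) :
    toComplex M n (Finsupp.single σ 1) =
      ((TopCat.toSSet.obj M).ιChainComplex (R := coefficients.{u})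
        ((simplexEquiv M n).symm σ)).hom (ULift.up 1) := by
  simp [toComplex]

/-- The comparison from the singular chains of Mathlib to the concrete ones. -/
noncomputable def ofComplex :
    ((TopCat.toSSet.obj M).chainComplex coefficients.{u}).X n ⟶
      ModuleCat.of ℚ (SingularChain (n + 1) M) :=
  ((TopCat.toSSet.obj M).isColimitChainComplexXCofan coefficients.{u} n).desc
    (Limits.Cofan.mk _ fun x => ModuleCat.ofHom
      (Finsupp.lsingle (simplexEquiv M n x) ∘ₗ ULift.moduleEquiv.toLinearMap))

theorem ι_ofComplex (x : (TopCat.toSSet.obj M) _⦋n⦌) :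
    (TopCat.toSSet.obj M).ιChainComplex (R := coefficients.{u}) x ≫ ofComplex M n = ModuleCat.ofHom
      (Finsupp.lsingle (simplexEquiv M n x) ∘ₗ ULift.moduleEquiv.toLinearMap) :=
  ((TopCat.toSSet.obj M).isColimitChainComplexXCofan coefficients.{u} n).fac _ ⟨x⟩

/-- The categorical chain group is a coproduct of copies of `ℚ` indexed by singular simplices, and
its universal property supplies the inverse `ofComplex`. -/
theorem toComplex_bijective : Function.Bijective (toComplex M n) := by
  have h1 : (ofComplex M n).hom ∘ₗ toComplex M n = LinearMap.id := by
    ext1 σ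
    ext1
    change (ofComplex M n).hom (toComplex M n (Finsupp.single σ 1)) = Finsupp.single σ 1
    rw [toComplex_single]
    have := congrArg (fun f => f.hom (ULift.up 1)) (ι_ofComplex M n ((simplexEquiv M n).symm σ))
    refine this.trans ?_
    simp
  have h2 : ofComplex M n ≫ ModuleCat.ofHom (toComplex M n) = 𝟙 _ := by
    refine SSet.chainComplex_hom_ext fun x => ?_
    rw [← Category.assoc, ι_ofComplex, Category.comp_id]
    ext ⟨q⟩
    change toComplex M n (Finsupp.single (simplexEquiv M n x) q) = _
    rw [← mul_one q, ← smul_eq_mul, ← Finsupp.smul_single, map_smul, toComplex_single,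
      Equiv.symm_apply_apply, ← map_smul]
    rfl
  exact ⟨Function.LeftInverse.injective (LinearMap.congr_fun h1),
    Function.RightInverse.surjective (f := toComplex M n) fun y =>
      congrArg (fun f => f.hom y) h2⟩

theorem toComplex_boundary (c : SingularChain (n + 2) M) :
    toComplex M n (boundary (n + 1) M c) =
      (((TopCat.toSSet.obj M).chainComplex coefficients.{u}).d (n + 1) n).hom
        (toComplex M (n + 1) c) := by
  suffices h : toComplex M n ∘ₗ boundary (n + 1) M =
      (((TopCat.toSSet.obj M).chainComplex coefficients.{u}).d (n + 1) n).hom ∘ₗ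
        toComplex M (n + 1) from LinearMap.congr_fun h c
  ext1 σ
  ext1
  simp only [LinearMap.comp_apply, Finsupp.lsingle_apply]
  rw [boundary_single, toComplex_single, map_sum]
  have := congrArg (fun f => f.hom (ULift.up 1))
    ((TopCat.toSSet.obj M).ιChainComplex_d (R := coefficients.{u}) ((simplexEquiv M (n + 1)).symm σ))
  refine Eq.trans ?_ this.symm
  rw [ModuleCat.hom_sum, LinearMap.sum_apply]
  refine Finset.sum_congr rfl fun i _ => ?_
  rw [map_smul, toComplex_single, ← simplexEquiv_symm_δ]
  rcases Nat.even_or_odd (i : ℕ) with hi | hi <;> simp [hi.neg_one_pow]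

theorem toComplex_map {M N : TopCat.{u}} (f : M ⟶ N) (c : SingularChain (n + 1) M) :
    toComplex N n (map f.hom (n + 1) c) =
      ((SSet.chainComplexMap (TopCat.toSSet.map f) coefficients.{u}).f n).hom
        (toComplex M n c) := by
  suffices h : toComplex N n ∘ₗ map f.hom (n + 1) =
      ((SSet.chainComplexMap (TopCat.toSSet.map f) coefficients.{u}).f n).hom ∘ₗ
        (toComplex M n) from LinearMap.congr_fun h c
  ext1 σ
  ext1
  simp only [LinearMap.comp_apply, Finsupp.lsingle_apply]
  rw [map_single, toComplex_single, toComplex_single]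
  have := congrArg (fun g => g.hom (ULift.up 1)) (SSet.ι_chainComplexMap_f _ _ (TopCat.toSSet.map f)
    coefficients.{u} ((simplexEquiv M n).symm σ))
  exact this.symm

end SingularChain

/-! ### Local homology computed by concrete relative chains. -/

namespace SingularChain

variable (M : Type u) [TopologicalSpace M] (x : M) (n : ℕ)

/-- The map of singular chain complexes induced by the inclusion of a punctured space. -/
noncomputable abbrev punctureChainMap :
    (TopCat.toSSet.obj (TopCat.of {y : M // y ≠ x})).chainComplex coefficients.{u} ⟶
      (TopCat.toSSet.obj (TopCat.of M)).chainComplex coefficients.{u} :=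
  SSet.chainComplexMap (TopCat.toSSet.map (punctureInclusion M x)) coefficients.{u}

/-- The complex of singular chains relative to the punctured space. -/
noncomputable abbrev localComplex : ChainComplex (ModuleCat.{u} ℚ) ℕ :=
  Limits.cokernel (punctureChainMap M x)

/-- The projection from singular chains to relative chains. -/
noncomputable def toLocalComplex : SingularChain (n + 1) M →ₗ[ℚ] (localComplex M x).X n :=
  ((Limits.cokernel.π (punctureChainMap M x)).f n).hom ∘ₗ toComplex (TopCat.of M) n

theorem toLocalComplex_surjective : Function.Surjective (toLocalComplex M x n) :=
  ((ModuleCat.epi_iff_surjective _).1 inferInstance).comp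
    (toComplex_bijective (TopCat.of M) n).surjective

/-- Exactness at the cokernel holds degreewise, so the kernel is the image of the chains of the
punctured space; those are exactly the chains avoiding `x`. -/
theorem ker_toLocalComplex :
    LinearMap.ker (toLocalComplex M x n) = supportedIn {y | y ≠ x} (n + 1) := by
  have hinc : Set.range (punctureInclusion M x).hom = {y | y ≠ x} := Subtype.range_val
  have hex := (HomologicalComplex.exact_iff_degreewise_exact _).1
    (ShortComplex.exact_cokernel (punctureChainMap M x)) n
  rw [ShortComplex.moduleCat_exact_iff] at hex
  ext c
  constructor
  · intro hc
    obtain ⟨y, hy⟩ := hex (toComplex (TopCat.of M) n c) hc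
    obtain ⟨c', rfl⟩ := (toComplex_bijective (TopCat.of {y : M // y ≠ x}) n).surjective y
    have h : toComplex (TopCat.of M) n (map (punctureInclusion M x).hom (n + 1) c') =
        toComplex (TopCat.of M) n c := (toComplex_map n _ c').trans hy
    rw [← (toComplex_bijective (TopCat.of M) n).injective h]
    refine (map_mem_supportedIn_iff Subtype.val_injective).2 ?_
    intro σ _ t
    exact (σ t).2
  · intro hc
    rw [← hinc] at hc
    obtain ⟨c', rfl⟩ := mem_range_map (f := (punctureInclusion M x).hom) IsEmbedding.subtypeVal hc
    change ((Limits.cokernel.π (punctureChainMap M x)).f n).hom (toComplex (TopCat.of M) n _) = 0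
    rw [toComplex_map]
    have h := congrArg (fun f => (f.f n).hom (toComplex _ n c'))
      (Limits.cokernel.condition (punctureChainMap M x))
    exact h

theorem d_toLocalComplex (c : SingularChain (n + 2) M) :
    ((localComplex M x).d (n + 1) n).hom (toLocalComplex M x (n + 1) c) =
      toLocalComplex M x n (boundary (n + 1) M c) := by
  have h := congrArg (fun f => f.hom (toComplex (TopCat.of M) (n + 1) c))
    ((Limits.cokernel.π (punctureChainMap M x)).comm (n + 1) n)
  refine h.trans ?_
  change ((Limits.cokernel.π (punctureChainMap M x)).f n).hom
    ((((TopCat.toSSet.obj (TopCat.of M)).chainComplex coefficients.{u}).d (n + 1) n).hom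
        (toComplex (TopCat.of M) (n + 1) c)) = _
  rw [← toComplex_boundary]
  rfl

theorem mem_relativeCycles_iff (c : SingularChain (n + 1) M) :
    c ∈ relativeCycles {y | y ≠ x} n ↔
      ((localComplex M x).sc n).g.hom (toLocalComplex M x n c) = 0 := by
  have key : ∀ j, j = (ComplexShape.down ℕ).next n → (c ∈ relativeCycles {y | y ≠ x} n ↔
      ((localComplex M x).d n j).hom (toLocalComplex M x n c) = 0) := by
    rintro j rfl
    cases n with
    | zero =>
      -- In degree `0` the outgoing differential of the complex is zero, while the augmentation
      -- lands in chains on the empty simplex, which count as supported anywhere. So every chain is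
      -- a cycle on both sides.
      rw [HomologicalComplex.shape _ _ _ (by simp)]
      refine iff_of_true (fun σ _ t => absurd t.2.2 (by simp)) rfl
    | succ n =>
      have : (ComplexShape.down ℕ).next (n + 1) = n := ChainComplex.next_nat_succ n
      rw [this, d_toLocalComplex, ← LinearMap.mem_ker, ker_toLocalComplex]
      rfl
  exact key _ rfl

theorem mem_relativeBoundaries_iff (c : SingularChain (n + 1) M) :
    c ∈ relativeBoundaries {y | y ≠ x} n ↔
      ∃ y, ((localComplex M x).sc n).f.hom y = toLocalComplex M x n c := by
  have key : ∀ j, j = n + 1 → (c ∈ relativeBoundaries {y | y ≠ x} n ↔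
      ∃ y, ((localComplex M x).d j n).hom y = toLocalComplex M x n c) := by
    rintro j rfl
    constructor
    · intro hc
      obtain ⟨_, ⟨b, rfl⟩, a, ha, rfl⟩ := Submodule.mem_sup.1 hc
      refine ⟨toLocalComplex M x (n + 1) b, ?_⟩
      rw [← ker_toLocalComplex] at ha
      rw [d_toLocalComplex, map_add, LinearMap.mem_ker.1 ha, add_zero]
    · rintro ⟨y, hy⟩
      obtain ⟨b, rfl⟩ := toLocalComplex_surjective M x (n + 1) y
      rw [d_toLocalComplex] at hy
      rw [← add_sub_cancel (boundary (n + 1) M b) c]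
      refine Submodule.add_mem_sup ⟨b, rfl⟩ ?_
      rw [← ker_toLocalComplex, LinearMap.mem_ker, map_sub, hy, sub_self]
  exact key _ (ChainComplex.prev ℕ n)

/-- The local homology of Mathlib's singular chains is that of the concrete ones. -/
theorem nonempty_equiv_localHomology :
    Nonempty (RelativeHomology {y : M | y ≠ x} n ≃ₗ[ℚ] localHomology M x n) := by
  let S := (localComplex M x).sc n
  let Θ : relativeCycles {y : M | y ≠ x} n →ₗ[ℚ] LinearMap.ker S.g.hom :=
    LinearMap.codRestrict _ (toLocalComplex M x n ∘ₗ Submodule.subtype _) fun c =>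
      (mem_relativeCycles_iff M x n c).1 c.2
  let Ψ := (LinearMap.range S.moduleCatToCycles).mkQ ∘ₗ Θ
  have hΨ : Function.Surjective Ψ := by
    refine (Submodule.mkQ_surjective _).comp ?_
    rintro ⟨y, hy⟩
    obtain ⟨c, rfl⟩ := toLocalComplex_surjective M x n y
    exact ⟨⟨c, (mem_relativeCycles_iff M x n c).2 hy⟩, rfl⟩
  have hker : (relativeBoundaries {y : M | y ≠ x} n).submoduleOf (relativeCycles {y | y ≠ x} n) =
      LinearMap.ker Ψ := by
    ext c
    rw [LinearMap.ker_comp, Submodule.ker_mkQ, Submodule.mem_comap]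
    refine (mem_relativeBoundaries_iff M x n c).trans ?_
    constructor
    · rintro ⟨y, hy⟩
      exact ⟨y, Subtype.ext hy⟩
    · rintro ⟨y, hy⟩
      exact ⟨y, congrArg Subtype.val hy⟩
  exact ⟨(Submodule.quotEquivOfEq _ _ hker).trans ((Ψ.quotKerEquivOfSurjective hΨ).trans
    (S.moduleCatHomologyIso.symm.toLinearEquiv))⟩

end SingularChain

/-! ### Invariance and vanishing of local homology. -/

/-- Local homology is invariant under open embeddings. -/
theorem nonempty_localHomology_equiv {U : Type u} {M : Type v} [TopologicalSpace U]
    [TopologicalSpace M] [T1Space M] {f : U → M} (hf : IsOpenEmbedding f) (x : U) (n : ℕ) :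
    Nonempty (localHomology U x n ≃ₗ[ℚ] localHomology M (f x) n) := by
  obtain ⟨a⟩ := SingularChain.nonempty_equiv_localHomology U x n
  obtain ⟨b⟩ := SingularChain.nonempty_equiv_localHomology M (f x) n
  let F : C(U, M) := ⟨f, hf.continuous⟩
  have hF : F ⁻¹' {y | y ≠ f x} = {y | y ≠ x} := by
    ext y
    exact hf.injective.ne_iff
  -- The complement of the point is open by `T1Space`, and it covers `M` together with the range of
  -- `f`.
  have e := SingularChain.excision (f := F) hf (s := {y | y ≠ f x}) isOpen_ne (by
    refine Set.eq_univ_of_forall fun y => ?_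
    by_cases h : y = f x
    · exact Or.inl ⟨x, h.symm⟩
    · exact Or.inr h) n
  rw [hF] at e
  exact ⟨a.symm.trans (e.trans b)⟩

/-- If `M` can be pushed off the point `x` instantly, the local homology at `x` vanishes. -/
theorem subsingleton_localHomology_of_homotopy {M : Type u} [TopologicalSpace M] (x : M)
    (H : C(unitInterval × M, M)) (h0 : ∀ y, H (0, y) = y)
    (hH : ∀ t y, H (t, y) = x → t = 0 ∧ y = x) (n : ℕ) : Subsingleton (localHomology M x n) := by
  -- The final map misses `x`, and the homotopy restricts to the punctured space. Hence the
  -- inclusion of the latter is a homotopy equivalence, and the relative complex is acyclic.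
  let r : C(M, {y : M // y ≠ x}) := ⟨fun y => ⟨H (1, y), fun h => one_ne_zero (hH 1 y h).1⟩,
    by fun_prop⟩
  let H' : C(unitInterval × {y : M // y ≠ x}, {y : M // y ≠ x}) :=
    ⟨fun p => ⟨H (p.1, p.2.1), fun h => p.2.2 (hH _ _ h).2⟩, by fun_prop⟩
  let i := punctureInclusion M x
  let ρ : TopCat.of M ⟶ TopCat.of {y : M // y ≠ x} := TopCat.ofHom r
  let F := (AlgebraicTopology.singularChainComplexFunctor (ModuleCat.{u} ℚ)).obj
    (ModuleCat.of ℚ (ULift.{u} ℚ))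
  let h1 : TopCat.Homotopy (𝟙 (TopCat.of M)) (ρ ≫ i) :=
    { H with
      map_zero_left := h0
      map_one_left := fun _ => rfl }
  let h2 : TopCat.Homotopy (𝟙 (TopCat.of {y : M // y ≠ x})) (i ≫ ρ) :=
    { H' with
      map_zero_left := fun y => Subtype.ext (h0 _)
      map_one_left := fun _ => rfl }
  let e : HomotopyEquiv (F.obj (TopCat.of {y : M // y ≠ x})) (F.obj (TopCat.of M)) :=
    { hom := F.map i
      inv := F.map ρ
      homotopyHomInvId := ((Homotopy.ofEq (F.map_comp i ρ)).symm.trans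
        (h2.singularChainComplexFunctorObjMap _).symm).trans (Homotopy.ofEq (F.map_id _))
      homotopyInvHomId := ((Homotopy.ofEq (F.map_comp ρ i)).symm.trans
        (h1.singularChainComplexFunctorObjMap _).symm).trans (Homotopy.ofEq (F.map_id _)) }
  have hq : QuasiIso (F.map i) := e.quasiIso_hom
  have hpb : Limits.HasPullbacks (ModuleCat.{u} ℚ) := Abelian.hasPullbacks
  have : Mono i := (TopCat.mono_iff_injective i).2 Subtype.val_injective
  have hS : (ShortComplex.mk (F.map i) (Limits.cokernel.π (F.map i))
      (Limits.cokernel.condition _)).ShortExact :=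
    { exact := ShortComplex.exact_cokernel (F.map i)
      mono_f := F.map_mono i
      epi_g := inferInstanceAs (Epi (Limits.cokernel.π _)) }
  exact ModuleCat.subsingleton_of_isZero ((hS.acyclic_X₃ hq n).isZero_homology)

/-! ### Geometric realizations of locally finite complexes -/

namespace PreAbstractSimplicialComplex

variable {V : Type u} {K L : PreAbstractSimplicialComplex V}

theorem nonempty_of_mem {σ : Finset V} (hσ : σ ∈ K) : σ.Nonempty := (K.isRelLowerSet_faces hσ).1

theorem mem_of_subset {σ τ : Finset V} (hσ : σ ∈ K) (h : τ ⊆ σ) (hτ : τ.Nonempty) : τ ∈ K :=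
  (K.isRelLowerSet_faces hσ).2 h hτ

theorem IsLocallyFinite.mono (hK : K.IsLocallyFinite) (h : L ≤ K) : L.IsLocallyFinite := fun v =>
  (hK v).subset fun _ hσ => ⟨h hσ.1, hσ.2⟩

theorem isClosed_closedSimplex (σ : Finset V) : IsClosed (closedSimplex σ) := by
  have h : closedSimplex σ = (⋂ v, {x : V → ℝ | 0 ≤ x v}) ∩
      ((⋂ (v) (_ : v ∉ σ), {x : V → ℝ | x v = 0}) ∩ {x | ∑ v ∈ σ, x v = 1}) := by
    ext x
    simp [closedSimplex]
  rw [h]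
  refine (isClosed_iInter fun v => isClosed_le continuous_const (continuous_apply v)).inter
    ((isClosed_iInter fun v => isClosed_iInter fun _ =>
      isClosed_eq (continuous_apply v) continuous_const).inter ?_)
  exact isClosed_eq (continuous_finsetSum _ fun v _ => continuous_apply v) continuous_const

theorem isCompact_closedSimplex (σ : Finset V) : IsCompact (closedSimplex σ) := by
  refine (isCompact_univ_pi fun _ : V => isCompact_Icc (a := (0 : ℝ)) (b := 1)).of_isClosed_subset
    (isClosed_closedSimplex σ) fun x hx v _ => ⟨hx.1 v, ?_⟩
  by_cases hv : v ∈ σ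
  · rw [← hx.2.2]
    exact Finset.single_le_sum (fun w _ => hx.1 w) hv
  · rw [hx.2.1 v hv]
    exact zero_le_one

instance (σ : Finset V) : CompactSpace (closedSimplex σ) :=
  isCompact_iff_compactSpace.1 (isCompact_closedSimplex σ)

/-- The support of a point of the realization of `K` is a simplex of `K`. -/
theorem exists_support {x : V → ℝ} (hx : x ∈ polyhedron K) :
    ∃ σ ∈ K, x ∈ closedSimplex σ ∧ ∀ v, v ∈ σ ↔ 0 < x v := by
  classical
  obtain ⟨σ, hσ, h0, h1, h2⟩ := hx
  have hsub : ∑ v ∈ σ.filter (fun v => 0 < x v), x v = 1 := by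
    rw [← h2]
    refine Finset.sum_subset (Finset.filter_subset _ _) fun v hv hv' => ?_
    by_contra hne
    exact hv' (Finset.mem_filter.2 ⟨hv, lt_of_le_of_ne (h0 v) (Ne.symm hne)⟩)
  have hiff : ∀ v, v ∈ σ.filter (fun v => 0 < x v) ↔ 0 < x v := by
    intro v
    rw [Finset.mem_filter, and_iff_right_iff_imp]
    intro hv
    by_contra hne
    exact hv.ne' (h1 v hne)
  refine ⟨σ.filter (fun v => 0 < x v), mem_of_subset hσ (Finset.filter_subset _ _) ?_,
    ⟨h0, fun v hv => ?_, hsub⟩, hiff⟩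
  · rw [Finset.nonempty_iff_ne_empty]
    intro h
    rw [h, Finset.sum_empty] at hsub
    exact zero_ne_one hsub
  · rw [hiff, not_lt] at hv
    exact le_antisymm hv (h0 v)

theorem exists_pos {x : V → ℝ} (hx : x ∈ polyhedron K) : ∃ v, 0 < x v := by
  obtain ⟨σ, hσ, -, h⟩ := exists_support hx
  obtain ⟨v, hv⟩ := nonempty_of_mem hσ
  exact ⟨v, (h v).1 hv⟩

/-- The support of a point is unique, so membership in the realization of a complex is a
combinatorial condition on it. -/
theorem mem_polyhedron_iff_of_support {x : V → ℝ} {σ : Finset V} (hx : x ∈ closedSimplex σ)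
    (hσ : ∀ v, v ∈ σ ↔ 0 < x v) : x ∈ polyhedron K ↔ σ ∈ K := by
  refine ⟨fun h => ?_, fun h => ⟨σ, h, hx⟩⟩
  obtain ⟨τ, hτ, -, h'⟩ := exists_support h
  have : σ = τ := Finset.ext fun v => (hσ v).trans (h' v).symm
  rwa [this]

theorem isOpen_realization_iff {U : Set K.Realization} :
    IsOpen U ↔ ∀ σ : {σ // σ ∈ K}, IsOpen (simplexInclusion K σ ⁻¹' U) := by
  rw [isOpen_iSup_iff]
  exact forall_congr' fun σ => isOpen_coinduced

theorem isClosed_realization_iff {U : Set K.Realization} :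
    IsClosed U ↔ ∀ σ : {σ // σ ∈ K}, IsClosed (simplexInclusion K σ ⁻¹' U) := by
  rw [← isOpen_compl_iff, isOpen_realization_iff]
  exact forall_congr' fun σ => isOpen_compl_iff

theorem continuous_simplexInclusion (σ : {σ // σ ∈ K}) : Continuous (simplexInclusion K σ) :=
  continuous_def.2 fun _ hU => isOpen_realization_iff.1 hU σ

theorem continuous_realization_val : Continuous (fun x : K.Realization => x.1) :=
  continuous_def.2 fun _ hU => isOpen_realization_iff.2 fun _ =>
    hU.preimage continuous_subtype_val

instance : T2Space K.Realization :=
  T2Space.of_injective_continuous (f := fun x : K.Realization => x.1)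
    (fun _ _ h => Subtype.ext h) continuous_realization_val

theorem continuous_coord (v : V) : Continuous fun x : K.Realization => x.1 v :=
  (continuous_apply v).comp (continuous_realization_val (K := K))

/-- The weak topology of a locally finite complex is the topology of pointwise convergence of the
barycentric coordinates. -/
theorem IsLocallyFinite.isInducing (hK : K.IsLocallyFinite) :
    IsInducing (fun x : K.Realization => x.1) := by
  rw [isInducing_iff_nhds]
  intro x
  refine le_antisymm continuous_realization_val.continuousAt.le_comap ?_
  intro N hN
  obtain ⟨U, hUN, hU, hxU⟩ := mem_nhds_iff.1 hN
  obtain ⟨v, hv⟩ := exists_pos x.2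
  -- The part outside `U` of the closed simplices containing `v`. Local finiteness makes it closed
  -- in the product topology, and a point of the realization with positive `v`-coordinate that
  -- avoids it lies in `U`.
  let C : Set (V → ℝ) := ⋃ τ ∈ {τ | τ ∈ K ∧ v ∈ τ},
    {y | y ∈ closedSimplex τ ∧ ∀ h : y ∈ polyhedron K, (⟨y, h⟩ : K.Realization) ∉ U}
  have hC : IsClosed C := by
    refine (hK v).isClosed_biUnion fun τ hτ => ?_
    have h1 := ((isOpen_realization_iff.1 hU) ⟨τ, hτ.1⟩).isClosed_compl
    convert (isClosed_closedSimplex τ).isClosedEmbedding_subtypeVal.isClosedMap _ h1 using 1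
    ext y
    constructor
    · rintro ⟨h, h'⟩
      exact ⟨⟨y, h⟩, h' ⟨τ, hτ.1, h⟩, rfl⟩
    · rintro ⟨y, h', rfl⟩
      exact ⟨y.2, fun _ => h'⟩
  refine mem_comap.2 ⟨{y | 0 < y v} ∩ Cᶜ, IsOpen.mem_nhds ?_ ⟨hv, ?_⟩, ?_⟩
  · exact (isOpen_lt continuous_const (continuous_apply v)).inter hC.isOpen_compl
  · intro h
    obtain ⟨τ, -, -, h⟩ := Set.mem_iUnion₂.1 h
    exact h x.2 hxU
  · rintro y ⟨hy, hyC⟩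
    refine hUN (by_contra fun hyU => hyC ?_)
    obtain ⟨τ, hτ, hyτ⟩ := y.2
    have hvτ : v ∈ τ := by
      by_contra h
      exact (ne_of_gt hy) (hyτ.2.1 v h)
    exact Set.mem_iUnion₂.2 ⟨τ, ⟨hτ, hvτ⟩, hyτ, fun _ => hyU⟩

theorem IsLocallyFinite.continuous_iff (hK : K.IsLocallyFinite) {X : Type*} [TopologicalSpace X]
    {f : X → K.Realization} : Continuous f ↔ ∀ v, Continuous fun x => (f x).1 v := by
  rw [hK.isInducing.continuous_iff, continuous_pi_iff]
  rfl

/-- The supports of the barycentric coordinates form a locally finite family. -/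
theorem IsLocallyFinite.locallyFinite_coord (hK : K.IsLocallyFinite) :
    LocallyFinite fun v => {x : K.Realization | x.1 v ≠ 0} := by
  intro x
  obtain ⟨v, hv⟩ := exists_pos x.2
  refine ⟨{y | 0 < y.1 v}, (isOpen_lt continuous_const (continuous_coord v)).mem_nhds hv, ?_⟩
  refine ((hK v).biUnion fun τ _ => τ.finite_toSet).subset ?_
  rintro w ⟨y, hyw, hyv⟩
  obtain ⟨τ, hτ, -, h⟩ := exists_support y.2
  have hw : 0 < y.1 w := lt_of_le_of_ne (by obtain ⟨_, _, h, _⟩ := y.2; exact h w) (Ne.symm hyw)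
  exact Set.mem_iUnion₂.2 ⟨τ, ⟨hτ, (h v).2 hyv⟩, (h w).2 hw⟩

/-- The inclusion of the realization of a subcomplex. -/
def realizationInclusion (h : L ≤ K) : L.Realization → K.Realization :=
  fun x => ⟨x.1, by obtain ⟨σ, hσ, hx⟩ := x.2; exact ⟨σ, h hσ, hx⟩⟩

/-- Both weak topologies are induced by the coordinates. -/
theorem IsLocallyFinite.isEmbedding_realizationInclusion (hK : K.IsLocallyFinite) (h : L ≤ K) :
    IsEmbedding (realizationInclusion h) := by
  refine ⟨?_, fun x y hxy => Subtype.ext (congrArg (fun x : K.Realization => x.1) hxy)⟩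
  refine IsInducing.of_comp (g := (fun x : K.Realization => x.1)) ?_
    continuous_realization_val (hK.mono h).isInducing
  exact hK.continuous_iff.2 fun v => continuous_coord v

end PreAbstractSimplicialComplex

/-! ### The barycentric subdivision -/

namespace PreAbstractSimplicialComplex

variable {V : Type u} {K L : PreAbstractSimplicialComplex V}

theorem barycentric_mono (h : L ≤ K) : L.barycentric ≤ K.barycentric := fun _ hc =>
  ⟨hc.1, fun σ hσ => h (hc.2.1 σ hσ), hc.2.2⟩

theorem subset_or_subset_of_mem_barycentric {c : Finset (Finset V)} (hc : c ∈ K.barycentric)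
    {σ τ : Finset V} (hσ : σ ∈ c) (hτ : τ ∈ c) : σ ⊆ τ ∨ τ ⊆ σ :=
  hc.2.2.total hσ hτ

theorem _root_.Finset.exists_greatest_of_isChain {c : Finset (Finset V)} (hne : c.Nonempty)
    (hc : IsChain (· ⊆ ·) (c : Set (Finset V))) : ∃ τ ∈ c, ∀ σ ∈ c, σ ⊆ τ := by
  obtain ⟨τ, hτ, hmax⟩ := c.exists_max_image Finset.card hne
  refine ⟨τ, hτ, fun σ hσ => ?_⟩
  rcases hc.total hσ hτ with h | h
  · exact h
  · exact (Finset.eq_of_subset_of_card_le h (hmax σ hσ)).ge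

theorem _root_.Finset.exists_least_of_isChain {c : Finset (Finset V)} (hne : c.Nonempty)
    (hc : IsChain (· ⊆ ·) (c : Set (Finset V))) : ∃ τ ∈ c, ∀ σ ∈ c, τ ⊆ σ := by
  obtain ⟨τ, hτ, hmin⟩ := c.exists_min_image Finset.card hne
  refine ⟨τ, hτ, fun σ hσ => ?_⟩
  rcases hc.total hτ hσ with h | h
  · exact h
  · exact (Finset.eq_of_subset_of_card_le h (hmin σ hσ)).ge

/-- All members of a chain through `σ` are comparable with `σ`, so they share a vertex with it; only
finitely many simplices do. -/
theorem IsLocallyFinite.barycentric (hK : K.IsLocallyFinite) : K.barycentric.IsLocallyFinite := by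
  intro σ
  have hfin : (⋃ v ∈ (σ : Set V), {τ | τ ∈ K ∧ v ∈ τ}).Finite :=
    σ.finite_toSet.biUnion fun v _ => hK v
  refine (hfin.toFinset.powerset.finite_toSet).subset ?_
  rintro c ⟨hc, hσc⟩
  refine Finset.mem_coe.2 (Finset.mem_powerset.2 fun τ hτ => ?_)
  rw [Set.Finite.mem_toFinset]
  have hσ := hc.2.1 σ hσc
  have hτK := hc.2.1 τ hτ
  rcases subset_or_subset_of_mem_barycentric hc hσc hτ with h | h
  · obtain ⟨v, hv⟩ := nonempty_of_mem hσ
    exact Set.mem_iUnion₂.2 ⟨v, hv, hτK, h hv⟩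
  · obtain ⟨v, hv⟩ := nonempty_of_mem hτK
    exact Set.mem_iUnion₂.2 ⟨v, h hv, hτK, hv⟩

variable [DecidableEq V]

/-- The barycentric coordinates with respect to `K` of the point with barycentric coordinates `y`
with respect to the barycentric subdivision of `K`. -/
noncomputable def flatten (y : Finset V → ℝ) (v : V) : ℝ :=
  ∑ᶠ σ : Finset V, if v ∈ σ then y σ / σ.card else 0

theorem flatten_eq_sum {y : Finset V → ℝ} {c : Finset (Finset V)} {v : V}
    (h : ∀ σ, σ ∉ c → v ∈ σ → y σ = 0) :
    flatten y v = ∑ σ ∈ c, if v ∈ σ then y σ / σ.card else 0 := by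
  refine finsum_eq_sum_of_support_subset _ fun σ hσ => ?_
  by_contra hc
  refine hσ ?_
  change (if v ∈ σ then y σ / σ.card else 0) = 0
  split_ifs with hv
  · rw [h σ hc hv, zero_div]
  · rfl

section Chain

variable {y : Finset V → ℝ} {c : Finset (Finset V)}

theorem term_nonneg (hy : y ∈ closedSimplex c) (σ : Finset V) (v : V) :
    0 ≤ if v ∈ σ then y σ / σ.card else 0 := by
  split_ifs
  · exact div_nonneg (hy.1 σ) (Nat.cast_nonneg _)
  · exact le_rfl

theorem flatten_nonneg (hy : y ∈ closedSimplex c) (v : V) : 0 ≤ flatten y v :=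
  finsum_nonneg fun σ => term_nonneg hy σ v

/-- The coordinates are strictly larger on a simplex of the support than outside of it. -/
theorem flatten_lt (hc : c ∈ K.barycentric) (hy : y ∈ closedSimplex c)
    {σ : Finset V} (hσ : 0 < y σ) {v w : V} (hv : v ∈ σ) (hw : w ∉ σ) :
    flatten y w < flatten y v := by
  have h0 : ∀ τ, τ ∉ c → y τ = 0 := hy.2.1
  have hσc : σ ∈ c := by_contra fun h => hσ.ne' (h0 σ h)
  rw [flatten_eq_sum fun τ h _ => h0 τ h, flatten_eq_sum fun τ h _ => h0 τ h]
  refine Finset.sum_lt_sum (fun τ hτ => ?_) ⟨σ, hσc, ?_⟩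
  · by_cases hwτ : w ∈ τ
    -- A member of the chain containing `w` is not contained in `σ`, so it contains `σ` and
    -- therefore `v`.
    · have hvτ : v ∈ τ := by
        rcases subset_or_subset_of_mem_barycentric hc hσc hτ with h | h
        · exact h hv
        · exact absurd (h hwτ) hw
      rw [if_pos hwτ, if_pos hvτ]
    · rw [if_neg hwτ]
      exact term_nonneg hy τ v
  · rw [if_neg hw, if_pos hv]
    exact div_pos hσ (Nat.cast_pos.2 (Finset.card_pos.2 ⟨v, hv⟩))

theorem flatten_pos_iff (hy : y ∈ closedSimplex c)
    (hpos : ∀ σ, σ ∈ c ↔ 0 < y σ) {τ : Finset V} (hτ : τ ∈ c) (hmax : ∀ σ ∈ c, σ ⊆ τ) (v : V) :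
    v ∈ τ ↔ 0 < flatten y v := by
  constructor
  · intro hv
    rw [flatten_eq_sum fun τ h _ => hy.2.1 τ h]
    refine Finset.sum_pos' (fun σ _ => term_nonneg hy σ v) ⟨τ, hτ, ?_⟩
    rw [if_pos hv]
    exact div_pos ((hpos τ).1 hτ) (Nat.cast_pos.2 (Finset.card_pos.2 ⟨v, hv⟩))
  · intro h
    by_contra hv
    rw [flatten_eq_sum fun τ h _ => hy.2.1 τ h,
      Finset.sum_eq_zero fun σ hσ => if_neg fun h => hv (hmax σ hσ h)] at h
    exact lt_irrefl _ h

theorem flatten_mem_closedSimplex (hc : c ∈ K.barycentric) (hy : y ∈ closedSimplex c)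
    {τ : Finset V} (hmax : ∀ σ ∈ c, σ ⊆ τ) : flatten y ∈ closedSimplex τ := by
  refine ⟨flatten_nonneg hy, fun v hv => ?_, ?_⟩
  · rw [flatten_eq_sum fun τ h _ => hy.2.1 τ h,
      Finset.sum_eq_zero fun σ hσ => if_neg fun h => hv (hmax σ hσ h)]
  · have : ∀ v ∈ τ, flatten y v = ∑ σ ∈ c, if v ∈ σ then y σ / σ.card else 0 := fun v _ =>
      flatten_eq_sum fun τ h _ => hy.2.1 τ h
    rw [Finset.sum_congr rfl this, Finset.sum_comm, ← hy.2.2]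
    refine Finset.sum_congr rfl fun σ hσ => ?_
    rw [← Finset.sum_filter, Finset.filter_mem_eq_inter,
      Finset.inter_eq_right.2 (hmax σ hσ), Finset.sum_const, nsmul_eq_mul]
    have : (σ.card : ℝ) ≠ 0 := by
      exact_mod_cast (Finset.card_pos.2 (nonempty_of_mem (hc.2.1 σ hσ))).ne'
    field_simp

end Chain

/-- A point of the barycentric subdivision, its support, and the support of its image. -/
theorem exists_chain_support {y : Finset V → ℝ} (hy : y ∈ polyhedron K.barycentric) :
    ∃ c ∈ K.barycentric, y ∈ closedSimplex c ∧ (∀ σ, σ ∈ c ↔ 0 < y σ) ∧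
      ∃ τ ∈ c, (∀ σ ∈ c, σ ⊆ τ) ∧ flatten y ∈ closedSimplex τ ∧ ∀ v, v ∈ τ ↔ 0 < flatten y v := by
  obtain ⟨c, hc, hyc, hpos⟩ := exists_support hy
  obtain ⟨τ, hτ, hmax⟩ := Finset.exists_greatest_of_isChain hc.1 hc.2.2
  exact ⟨c, hc, hyc, hpos, τ, hτ, hmax, flatten_mem_closedSimplex hc hyc hmax,
    flatten_pos_iff hyc hpos hτ hmax⟩

theorem flatten_mem_polyhedron {y : Finset V → ℝ} (hy : y ∈ polyhedron K.barycentric) :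
    flatten y ∈ polyhedron K := by
  obtain ⟨c, hc, -, -, τ, hτ, -, h, -⟩ := exists_chain_support hy
  exact ⟨τ, hc.2.1 τ hτ, h⟩

theorem flatten_mem_polyhedron_iff {y : Finset V → ℝ} (hy : y ∈ polyhedron K.barycentric) :
    flatten y ∈ polyhedron L ↔ y ∈ polyhedron L.barycentric := by
  obtain ⟨c, hc, hyc, hpos, τ, hτ, hmax, h, hτ'⟩ := exists_chain_support hy
  rw [mem_polyhedron_iff_of_support h hτ', mem_polyhedron_iff_of_support hyc hpos]
  exact ⟨fun hL => ⟨hc.1, fun σ hσ => mem_of_subset hL (hmax σ hσ)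
    (nonempty_of_mem (hc.2.1 σ hσ)), hc.2.2⟩, fun hL => hL.2.1 τ hτ⟩

/-- The canonical map from the realization of the barycentric subdivision to that of `K`. -/
noncomputable def flattenMap (K : PreAbstractSimplicialComplex V) :
    K.barycentric.Realization → K.Realization :=
  fun y => ⟨flatten y.1, flatten_mem_polyhedron y.2⟩

theorem continuous_flattenMap (hK : K.IsLocallyFinite) : Continuous (flattenMap K) := by
  refine hK.continuous_iff.2 fun v => ?_
  have : ∀ y : K.barycentric.Realization, (flattenMap K y).1 v =
      ∑ σ ∈ (hK v).toFinset, if v ∈ σ then y.1 σ / σ.card else 0 := fun y => by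
    refine flatten_eq_sum fun σ hσ hv => ?_
    obtain ⟨c, hc, hy⟩ := y.2
    refine hy.2.1 σ fun hσc => hσ ((hK v).mem_toFinset.2 ⟨hc.2.1 σ hσc, hv⟩)
  simp only [this]
  refine continuous_finsetSum _ fun σ _ => ?_
  split_ifs
  · exact (continuous_coord σ).div_const _
  · exact continuous_const

/-- By `flatten_lt` the image coordinates order the vertices compatibly with either support, so the
two supports together form a single chain. On a common chain the weights are recovered from the top
down. -/
theorem flattenMap_injective : Function.Injective (flattenMap K) := by
  intro y y' h
  have hfl : flatten y.1 = flatten y'.1 := congrArg (fun x : K.Realization => x.1) h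
  obtain ⟨c, hc, hyc, hpos, -⟩ := exists_chain_support y.2
  obtain ⟨c', hc', hyc', hpos', -⟩ := exists_chain_support y'.2
  have hcross : ∀ σ ∈ c, ∀ τ ∈ c', σ ⊆ τ ∨ τ ⊆ σ := by
    intro σ hσ τ hτ
    by_contra! hne
    obtain ⟨v, hv, hv'⟩ := Finset.not_subset.1 hne.1
    obtain ⟨w, hw, hw'⟩ := Finset.not_subset.1 hne.2
    have h1 := flatten_lt hc hyc ((hpos σ).1 hσ) hv hw'
    have h2 := flatten_lt hc' hyc' ((hpos' τ).1 hτ) hw hv'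
    rw [hfl] at h1
    exact lt_asymm h1 h2
  have htot : ∀ σ ∈ c ∪ c', ∀ τ ∈ c ∪ c', σ ⊆ τ ∨ τ ⊆ σ := by
    intro σ hσ τ hτ
    rcases Finset.mem_union.1 hσ with hσ | hσ <;> rcases Finset.mem_union.1 hτ with hτ | hτ
    · exact subset_or_subset_of_mem_barycentric hc hσ hτ
    · exact hcross σ hσ τ hτ
    · exact (hcross τ hτ σ hσ).symm
    · exact subset_or_subset_of_mem_barycentric hc' hσ hτ
  let D := (c ∪ c').filter fun σ => y.1 σ ≠ y'.1 σ
  have hchain : ∀ D' : Finset (Finset V), D' ⊆ c ∪ c' → IsChain (· ⊆ ·) (D' : Set (Finset V)) :=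
    fun D' hD' σ hσ τ hτ _ => htot σ (hD' hσ) τ (hD' hτ)
  by_cases hD : D.Nonempty
  · exfalso
    obtain ⟨τ, hτ, hmax⟩ := Finset.exists_greatest_of_isChain hD
      (hchain D (Finset.filter_subset _ _))
    have hτ1 := (Finset.mem_filter.1 hτ)
    have hτne : τ.Nonempty := by
      rcases Finset.mem_union.1 hτ1.1 with h | h
      · exact nonempty_of_mem (hc.2.1 τ h)
      · exact nonempty_of_mem (hc'.2.1 τ h)
    -- At a vertex of the largest disagreeing simplex `τ` that lies in no smaller disagreeing one,
    -- the difference of the images involves only the weights at `τ`.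
    obtain ⟨v, hv, hvD⟩ : ∃ v ∈ τ, ∀ σ ∈ D, σ ≠ τ → v ∉ σ := by
      by_cases hne : (D.erase τ).Nonempty
      · obtain ⟨ρ, hρ, hρmax⟩ := Finset.exists_greatest_of_isChain hne
          (hchain _ ((Finset.erase_subset _ _).trans (Finset.filter_subset _ _)))
        obtain ⟨hρ1, hρ2⟩ := Finset.mem_erase.1 hρ
        obtain ⟨v, hv, hv'⟩ := Finset.exists_of_ssubset (lt_of_le_of_ne (hmax ρ hρ2) hρ1)
        exact ⟨v, hv, fun σ hσ hne hvσ => hv' (hρmax σ (Finset.mem_erase.2 ⟨hne, hσ⟩) hvσ)⟩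
      · obtain ⟨v, hv⟩ := hτne
        exact ⟨v, hv, fun σ hσ hne' => absurd ⟨σ, Finset.mem_erase.2 ⟨hne', hσ⟩⟩ hne⟩
    have e1 : flatten y.1 v = ∑ σ ∈ c ∪ c', if v ∈ σ then y.1 σ / σ.card else 0 :=
      flatten_eq_sum fun σ h _ => hyc.2.1 σ fun h' => h (Finset.mem_union_left _ h')
    have e2 : flatten y'.1 v = ∑ σ ∈ c ∪ c', if v ∈ σ then y'.1 σ / σ.card else 0 :=
      flatten_eq_sum fun σ h _ => hyc'.2.1 σ fun h' => h (Finset.mem_union_right _ h')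
    have e3 : ∑ σ ∈ c ∪ c', ((if v ∈ σ then y.1 σ / σ.card else 0) -
        (if v ∈ σ then y'.1 σ / σ.card else 0) : ℝ) = 0 := by
      rw [Finset.sum_sub_distrib, ← e1, ← e2, hfl, sub_self]
    rw [Finset.sum_eq_single_of_mem τ hτ1.1, if_pos hv, if_pos hv, ← sub_div] at e3
    · rcases div_eq_zero_iff.1 e3 with h | h
      · exact hτ1.2 (sub_eq_zero.1 h)
      · exact (Finset.card_pos.2 hτne).ne' (by exact_mod_cast h)
    · intro σ hσ hne
      by_cases hvσ : v ∈ σ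
      · have : y.1 σ = y'.1 σ := by
          by_contra hyy
          exact hvD σ (Finset.mem_filter.2 ⟨hσ, hyy⟩) hne hvσ
        rw [this, sub_self]
      · rw [if_neg hvσ, if_neg hvσ, sub_self]
  · refine Subtype.ext (funext fun σ => ?_)
    by_contra hyy
    refine hD ⟨σ, Finset.mem_filter.2 ⟨?_, hyy⟩⟩
    by_contra hσ
    rw [Finset.mem_union, not_or] at hσ
    exact hyy ((hyc.2.1 σ hσ.1).trans (hyc'.2.1 σ hσ.2).symm)

/-- Layer-cake decomposition: subtract the minimal value times the indicator of `τ` and recurse on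
the vertices where something remains. -/
theorem exists_layers (n : ℕ) : ∀ (τ : Finset V) (x : V → ℝ), τ.card ≤ n →
    (∀ v ∈ τ, 0 < x v) → ∃ (c : Finset (Finset V)) (z : Finset V → ℝ),
      (∀ σ ∈ c, σ.Nonempty ∧ σ ⊆ τ) ∧ IsChain (· ⊆ ·) (c : Set (Finset V)) ∧ (∀ σ, 0 ≤ z σ) ∧
      (∀ v ∈ τ, x v = ∑ σ ∈ c, if v ∈ σ then z σ else 0) := by
  induction n with
  | zero =>
    intro τ x hτ _
    have : τ = ∅ := Finset.card_eq_zero.1 (Nat.le_zero.1 hτ)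
    subst this
    exact ⟨∅, 0, by simp, by simp, by simp, by simp⟩
  | succ n ih =>
    intro τ x hτ hx
    rcases τ.eq_empty_or_nonempty with rfl | hne
    · exact ⟨∅, 0, by simp, by simp, by simp, by simp⟩
    obtain ⟨w, hw, hmin⟩ := τ.exists_min_image x hne
    let τ' := τ.filter fun v => x w < x v
    have hτ' : τ' ⊂ τ := Finset.filter_ssubset.2 ⟨w, hw, lt_irrefl _⟩
    obtain ⟨c, z, h1, h2, h3, h4⟩ := ih τ' (fun v => x v - x w)
      (by have := Finset.card_lt_card hτ'; omega)
      (fun v hv => sub_pos.2 (Finset.mem_filter.1 hv).2)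
    have hτc : τ ∉ c := fun h => hτ'.2 (h1 τ h).2
    refine ⟨insert τ c, Function.update z τ (x w), ?_, ?_, ?_, ?_⟩
    · intro σ hσ
      rcases Finset.mem_insert.1 hσ with rfl | hσ
      · exact ⟨hne, subset_rfl⟩
      · exact ⟨(h1 σ hσ).1, (h1 σ hσ).2.trans hτ'.1⟩
    · rw [Finset.coe_insert]
      exact h2.insert fun σ hσ _ => Or.inr ((h1 σ hσ).2.trans hτ'.1)
    · intro σ
      by_cases h : σ = τ
      · rw [h, Function.update_self]; exact (hx w hw).le
      · rw [Function.update_of_ne h]; exact h3 σ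
    · intro v hv
      rw [Finset.sum_insert hτc, if_pos hv, Function.update_self]
      have e : ∑ σ ∈ c, (if v ∈ σ then Function.update z τ (x w) σ else 0) =
          ∑ σ ∈ c, if v ∈ σ then z σ else 0 := Finset.sum_congr rfl fun σ hσ => by
        rw [Function.update_of_ne (ne_of_mem_of_not_mem hσ hτc)]
      rw [e]
      by_cases hv' : v ∈ τ'
      · rw [← h4 v hv']; ring
      · rw [Finset.sum_eq_zero fun σ hσ => if_neg fun h => hv' ((h1 σ hσ).2 h), add_zero]
        by_contra hne'
        exact hv' (Finset.mem_filter.2 ⟨hv, lt_of_le_of_ne (hmin v hv) (Ne.symm hne')⟩)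

theorem flattenMap_surjective : Function.Surjective (flattenMap K) := by
  intro x
  obtain ⟨τ, hτ, hxτ, hpos⟩ := exists_support x.2
  obtain ⟨c, z, h1, h2, h3, h4⟩ := exists_layers τ.card τ x.1 le_rfl fun v hv => (hpos v).1 hv
  -- The factor `σ.card` converts weights of indicator functions into weights of barycenters.
  let y : Finset V → ℝ := fun σ => if σ ∈ c then z σ * σ.card else 0
  have hy0 : ∀ σ, σ ∉ c → y σ = 0 := fun σ hσ => if_neg hσ
  have hx : ∀ v, flatten y v = x.1 v := by
    intro v
    rw [flatten_eq_sum fun σ h _ => hy0 σ h]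
    by_cases hv : v ∈ τ
    · rw [h4 v hv]
      refine Finset.sum_congr rfl fun σ hσ => ?_
      have : (σ.card : ℝ) ≠ 0 := by exact_mod_cast (Finset.card_pos.2 (h1 σ hσ).1).ne'
      simp only [y, if_pos hσ]
      field_simp
    · rw [hxτ.2.1 v hv]
      exact Finset.sum_eq_zero fun σ hσ => if_neg fun h => hv ((h1 σ hσ).2 h)
  have hsum : ∑ σ ∈ c, y σ = 1 := by
    rw [← hxτ.2.2, Finset.sum_congr rfl fun v hv => h4 v hv, Finset.sum_comm]
    refine Finset.sum_congr rfl fun σ hσ => ?_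
    rw [← Finset.sum_filter, Finset.filter_mem_eq_inter, Finset.inter_eq_right.2 (h1 σ hσ).2,
      Finset.sum_const, nsmul_eq_mul]
    simp only [y, if_pos hσ, mul_comm]
  have hne : c.Nonempty := by
    rw [Finset.nonempty_iff_ne_empty]
    rintro rfl
    simp at hsum
  refine ⟨⟨y, c, ⟨hne, fun σ hσ => mem_of_subset hτ (h1 σ hσ).2 (h1 σ hσ).1, h2⟩,
    fun σ => ?_, hy0, hsum⟩, Subtype.ext (funext hx)⟩
  simp only [y]
  split_ifs
  · exact mul_nonneg (h3 σ) (Nat.cast_nonneg _)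
  · exact le_rfl

/-- It suffices to test on one closed simplex. There the image is a finite union, over chains of its
faces, of continuous images of compact sets. -/
theorem isClosedMap_flattenMap : IsClosedMap (flattenMap K) := by
  intro F hF
  refine isClosed_realization_iff.2 fun τ => ?_
  have hsimp : simplexInclusion K τ ⁻¹' (flattenMap K '' F) =
      ⋃ c ∈ {c | c ∈ τ.1.powerset.powerset ∧ c ∈ K.barycentric},
        {x : closedSimplex τ.1 | ∃ y ∈ closedSimplex c,
          (∀ h, (⟨y, h⟩ : K.barycentric.Realization) ∈ F) ∧
          flatten y = x.1} := by
    ext x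
    simp only [Set.mem_preimage, Set.mem_image, Set.mem_iUnion]
    constructor
    · rintro ⟨y, hy, hyx⟩
      have hyx' : flatten y.1 = x.1 := congrArg (fun x : K.Realization => x.1) hyx
      obtain ⟨c, hc, hyc, hpos, ρ, hρ, hmax, h, hρ'⟩ := exists_chain_support y.2
      refine ⟨c, ⟨Finset.mem_powerset.2 fun σ hσ => Finset.mem_powerset.2 ?_, hc⟩, y.1, hyc,
        fun _ => hy, hyx'⟩
      refine (hmax σ hσ).trans fun v hv => ?_
      by_contra hvτ
      have := (hρ' v).1 hv
      rw [hyx', x.2.2.1 v hvτ] at this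
      exact lt_irrefl _ this
    · rintro ⟨c, ⟨-, hc⟩, y, hyc, hyF, hyx⟩
      exact ⟨⟨y, c, hc, hyc⟩, hyF _, Subtype.ext hyx⟩
  rw [hsimp]
  refine Set.Finite.isClosed_biUnion ((τ.1.powerset.powerset.finite_toSet).subset fun c hc => hc.1)
    fun c hc => ?_
  have hmax : ∀ σ ∈ c, σ ⊆ τ.1 := fun σ hσ =>
    Finset.mem_powerset.1 (Finset.mem_powerset.1 hc.1 hσ)
  let f : closedSimplex c → closedSimplex τ.1 := fun y =>
    ⟨flatten y.1, flatten_mem_closedSimplex hc.2 y.2 hmax⟩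
  have hf : Continuous f := by
    refine Continuous.subtype_mk (continuous_pi fun v => ?_) _
    have : ∀ y : closedSimplex c, flatten y.1 v =
        ∑ σ ∈ c, if v ∈ σ then y.1 σ / σ.card else 0 := fun y =>
      flatten_eq_sum fun σ hσ _ => y.2.2.1 σ hσ
    simp only [this]
    refine continuous_finsetSum _ fun σ _ => ?_
    split_ifs
    · exact ((continuous_apply σ).comp continuous_subtype_val).div_const _
    · exact continuous_const
  have hcl := hF.preimage (continuous_simplexInclusion ⟨c, hc.2⟩)
  convert (hcl.isCompact.image hf).isClosed using 1
  ext x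
  constructor
  · rintro ⟨y, hyc, hyF, hyx⟩
    exact ⟨⟨y, hyc⟩, hyF _, Subtype.ext hyx⟩
  · rintro ⟨y, hyF, hyx⟩
    exact ⟨y.1, y.2, fun _ => hyF, congrArg Subtype.val hyx⟩

/-- The realization of the barycentric subdivision is homeomorphic to that of `K`. -/
noncomputable def flattenHomeomorph (hK : K.IsLocallyFinite) :
    K.barycentric.Realization ≃ₜ K.Realization :=
  (Equiv.ofBijective (flattenMap K)
    ⟨flattenMap_injective, flattenMap_surjective⟩).toHomeomorphOfContinuousClosed
    (continuous_flattenMap hK) isClosedMap_flattenMap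

end PreAbstractSimplicialComplex

/-! ### Thickenings -/

namespace PreAbstractSimplicialComplex

variable {V : Type u} {K L : PreAbstractSimplicialComplex V} {A B : Set V}

/-- The full subcomplex of the barycentric subdivision of `K` spanned by the simplices of `K` with
a vertex in `A`. -/
def thickening (K : PreAbstractSimplicialComplex V) (A : Set V) :
    PreAbstractSimplicialComplex (Finset V) where
  faces := {c | c ∈ K.barycentric ∧ ∀ σ ∈ c, ∃ v ∈ σ, v ∈ A}
  isRelLowerSet_faces := by
    rintro c ⟨hc, h⟩
    exact ⟨nonempty_of_mem hc, fun d hd hne => ⟨mem_of_subset hc hd hne, fun σ hσ => h σ (hd hσ)⟩⟩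

/-- The frontier of the thickening is spanned by the simplices with vertices in `A` and in the
complement of `A`. -/
def thickeningFrontier (K : PreAbstractSimplicialComplex V) (A : Set V) :
    PreAbstractSimplicialComplex (Finset V) :=
  K.thickening A ⊓ K.thickening Aᶜ

theorem thickening_le : K.thickening A ≤ K.barycentric := fun _ hc => hc.1

theorem thickening_mono (h : A ⊆ B) : K.thickening A ≤ K.thickening B := fun _ hc =>
  ⟨hc.1, fun σ hσ => let ⟨v, hv, hA⟩ := hc.2 σ hσ; ⟨v, hv, h hA⟩⟩

/-- The vertices of a complex. -/
def vertexSet (K : PreAbstractSimplicialComplex V) : Set V := {v | {v} ∈ K}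

theorem mem_vertexSet {σ : Finset V} (hσ : σ ∈ K) {v : V} (hv : v ∈ σ) : v ∈ K.vertexSet :=
  mem_of_subset hσ (Finset.singleton_subset_iff.2 hv) (Finset.singleton_nonempty v)

theorem barycentric_le_thickening (h : L ≤ K) : L.barycentric ≤ K.thickening L.vertexSet := by
  refine fun c hc => ⟨barycentric_mono h hc, fun σ hσ => ?_⟩
  obtain ⟨v, hv⟩ := nonempty_of_mem (hc.2.1 σ hσ)
  exact ⟨v, hv, mem_vertexSet (hc.2.1 σ hσ) hv⟩

theorem thickening_le_star : K.thickening L.vertexSet ≤ (K.star L).barycentric := by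
  refine fun c hc => ⟨hc.1.1, fun σ hσ => ?_, hc.1.2.2⟩
  obtain ⟨v, hv, hvL⟩ := hc.2 σ hσ
  exact ⟨⟨v, hv⟩, v, hvL, σ, hc.1.2.1 σ hσ, hv, subset_rfl⟩

/-- The thickening consists of the points one of whose largest coordinates belongs to `A`. -/
theorem mem_polyhedron_thickening_iff [DecidableEq V] {y : Finset V → ℝ}
    (hy : y ∈ polyhedron K.barycentric) :
    (y ∈ polyhedron (K.thickening A) ↔ ∃ v ∈ A, ∀ w ∉ A, flatten y w ≤ flatten y v) ∧
    (y ∈ polyhedron (K.thickening A) → ∃ v ∈ A, 0 < flatten y v ∧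
      ∀ w ∉ A, flatten y w ≤ flatten y v) := by
  obtain ⟨c, hc, hyc, hpos, -⟩ := exists_chain_support hy
  obtain ⟨ρ, hρ, hmin⟩ := Finset.exists_least_of_isChain hc.1 hc.2.2
  -- Vertices of the least simplex `ρ` belong to every member of the chain, so they have the largest
  -- coordinates. Membership in the thickening only depends on whether `ρ` meets `A`.
  have hmax : ∀ v ∈ ρ, ∀ w, flatten y w ≤ flatten y v := by
    intro v hv w
    rw [flatten_eq_sum fun τ h _ => hyc.2.1 τ h, flatten_eq_sum fun τ h _ => hyc.2.1 τ h]
    refine Finset.sum_le_sum fun σ hσ => ?_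
    rw [if_pos (hmin σ hσ hv)]
    split_ifs
    · exact le_rfl
    · exact div_nonneg (hyc.1 σ) (Nat.cast_nonneg _)
  rw [mem_polyhedron_iff_of_support hyc hpos]
  have hfwd : c ∈ K.thickening A → ∃ v ∈ A, 0 < flatten y v ∧
      ∀ w ∉ A, flatten y w ≤ flatten y v := by
    intro h
    obtain ⟨v, hv, hvA⟩ := h.2 ρ hρ
    obtain ⟨w, hw⟩ := exists_pos (flatten_mem_polyhedron hy)
    exact ⟨v, hvA, hw.trans_le (hmax v hv w), fun w _ => hmax v hv w⟩
  refine ⟨⟨fun h => ?_, ?_⟩, hfwd⟩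
  · obtain ⟨v, hv, -, hw⟩ := hfwd h
    exact ⟨v, hv, hw⟩
  · rintro ⟨v, hvA, hv⟩
    -- Were `ρ` disjoint from `A`, its vertices would strictly dominate `v` by `flatten_lt`.
    obtain ⟨u, hu, huA⟩ : ∃ u ∈ ρ, u ∈ A := by
      by_contra! hne
      obtain ⟨u, hu⟩ := nonempty_of_mem (hc.2.1 ρ hρ)
      exact (flatten_lt hc hyc ((hpos ρ).1 hρ) hu fun h => hne v h hvA).not_ge (hv u (hne u hu))
    exact ⟨hc, fun σ hσ => ⟨u, hmin σ hσ hu, huA⟩⟩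

/-- The frontier also lies in the thickening of `Aᶜ`, where some coordinate outside `A` dominates
those in `A`. -/
theorem notMem_polyhedron_frontier [DecidableEq V] {y : Finset V → ℝ}
    (hy : y ∈ polyhedron K.barycentric)
    {v : V} (hv : v ∈ A) (hlt : ∀ w ∉ A, flatten y w < flatten y v) :
    y ∉ polyhedron (K.thickeningFrontier A) := by
  rintro ⟨c, hc, hyc⟩
  obtain ⟨w, hw, hle⟩ := (mem_polyhedron_thickening_iff (A := Aᶜ) hy).1.1 ⟨c, hc.2, hyc⟩
  exact (hle v fun h => h hv).not_gt (hlt w hw)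

/-- The interior of the thickening. -/
def thickeningInterior (K : PreAbstractSimplicialComplex V) (A : Set V) :
    Set (K.thickening A).Realization :=
  {y | ∃ σ : Finset V, (∀ v ∈ σ, v ∈ A) ∧ 0 < y.1 σ}

/-- If no simplex of the supporting chain lies inside `A`, all of them meet `Aᶜ` and the chain is in
the frontier. -/
theorem mem_thickeningInterior {y : (K.thickening A).Realization}
    (hy : y ∉ (K.thickening A).realizedSubset (K.thickeningFrontier A)) :
    y ∈ K.thickeningInterior A := by
  obtain ⟨c, hc, hyc, hpos⟩ := exists_support y.2
  by_contra hne
  refine hy ⟨c, ⟨hc, hc.1, fun σ hσ => ?_⟩, hyc⟩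
  by_contra! h
  exact hne ⟨σ, fun v hv => by simpa using h v hv, (hpos σ).1 hσ⟩

theorem isOpen_exists_pos {W : Type v} {E : PreAbstractSimplicialComplex W} (P : W → Prop) :
    IsOpen {y : E.Realization | ∃ σ, P σ ∧ 0 < y.1 σ} := by
  have : {y : E.Realization | ∃ σ, P σ ∧ 0 < y.1 σ} = ⋃ (σ) (_ : P σ), {y | 0 < y.1 σ} := by
    ext y
    simp
  rw [this]
  exact isOpen_iUnion fun σ => isOpen_iUnion fun _ => isOpen_lt continuous_const (continuous_coord σ)

/-- A chain with a member `σ` inside `A` lies entirely in the thickening, because each other member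
contains `σ` or is contained in it. Thus the open condition already defines the interior in the
ambient polyhedron. -/
theorem isOpenEmbedding_thickeningInterior (hK : K.IsLocallyFinite) :
    IsOpenEmbedding fun y : K.thickeningInterior A =>
      realizationInclusion (thickening_le (A := A)) y.1 := by
  refine ⟨(hK.barycentric.isEmbedding_realizationInclusion thickening_le).comp
    IsEmbedding.subtypeVal, ?_⟩
  convert isOpen_exists_pos (E := K.barycentric) fun σ => ∀ v ∈ σ, v ∈ A using 1
  ext y
  constructor
  · rintro ⟨y, rfl⟩
    exact y.2
  · rintro ⟨σ, hσA, hσ⟩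
    obtain ⟨c, hc, hyc, hpos⟩ := exists_support y.2
    have hσc := (hpos σ).2 hσ
    refine ⟨⟨⟨y.1, c, ⟨hc, fun τ hτ => ?_⟩, hyc⟩, σ, hσA, hσ⟩, rfl⟩
    rcases subset_or_subset_of_mem_barycentric hc hσc hτ with h | h
    · obtain ⟨v, hv⟩ := nonempty_of_mem (hc.2.1 σ hσc)
      exact ⟨v, h hv, hσA v hv⟩
    · obtain ⟨v, hv⟩ := nonempty_of_mem (hc.2.1 τ hτ)
      exact ⟨v, hv, hσA v (h hv)⟩

theorem nonempty_localHomology_thickening_equiv [DecidableEq V] (hK : K.IsLocallyFinite)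
    {y : (K.thickening A).Realization} (hy : y ∈ K.thickeningInterior A) (n : ℕ) :
    Nonempty (localHomology (K.thickening A).Realization y n ≃ₗ[ℚ] localHomology K.Realization
      (flattenMap K (realizationInclusion thickening_le y)) n) := by
  have hopen : IsOpen (K.thickeningInterior A) := isOpen_exists_pos _
  obtain ⟨a⟩ := nonempty_localHomology_equiv hopen.isOpenEmbedding_subtypeVal ⟨y, hy⟩ n
  obtain ⟨b⟩ := nonempty_localHomology_equiv ((flattenHomeomorph hK).isOpenEmbedding.comp
    (isOpenEmbedding_thickeningInterior hK)) (⟨y, hy⟩ : K.thickeningInterior A) n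
  exact ⟨a.symm.trans b⟩

/-! ### Pushing the thickening off its frontier. -/

section Push

variable (A) in
/-- The factor by which the coordinate at `v` is scaled at time `t`. -/
noncomputable def pushFactor (t : ℝ) (v : V) : ℝ := open Classical in if v ∈ A then 1 else 1 - t

theorem pushFactor_nonneg {t : ℝ} (ht : t ≤ 1) (v : V) : 0 ≤ pushFactor A t v := by
  unfold pushFactor
  split_ifs <;> linarith

variable (A) in
/-- The total mass after scaling. -/
noncomputable def pushMass (t : ℝ) (x : V → ℝ) : ℝ := ∑ᶠ v, pushFactor A t v * x v

variable (A) in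
/-- The straight line homotopy that scales the coordinates outside of `A` down. -/
noncomputable def push (t : ℝ) (x : V → ℝ) (v : V) : ℝ := pushFactor A t v * x v / pushMass A t x

theorem pushMass_eq_sum {t : ℝ} {x : V → ℝ} {σ : Finset V} (hx : x ∈ closedSimplex σ) :
    pushMass A t x = ∑ v ∈ σ, pushFactor A t v * x v := by
  refine finsum_eq_sum_of_support_subset _ fun v hv => ?_
  by_contra h
  exact hv (by change pushFactor A t v * x v = 0; rw [hx.2.1 v h, mul_zero])

/-- Coordinates in `A` are never scaled, so one positive coordinate there allows renormalization up
to and including `t = 1`. -/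
theorem pushMass_pos {t : ℝ} (ht : t ≤ 1) {x : V → ℝ} (hx : x ∈ polyhedron K) {v : V} (hv : v ∈ A)
    (hpos : 0 < x v) : 0 < pushMass A t x := by
  obtain ⟨σ, hσ, hxσ⟩ := hx
  rw [pushMass_eq_sum hxσ]
  refine Finset.sum_pos' (fun w _ => mul_nonneg (pushFactor_nonneg ht w) (hxσ.1 w)) ⟨v, ?_, ?_⟩
  · by_contra h
    exact hpos.ne' (hxσ.2.1 v h)
  · rw [pushFactor, if_pos hv, one_mul]
    exact hpos

theorem push_mem {t : ℝ} (ht : t ≤ 1) {x : V → ℝ} (hx : x ∈ polyhedron K)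
    (hpos : 0 < pushMass A t x) : push A t x ∈ polyhedron K := by
  obtain ⟨σ, hσ, hxσ⟩ := hx
  refine ⟨σ, hσ, fun v => ?_, fun v hv => ?_, ?_⟩
  · exact div_nonneg (mul_nonneg (pushFactor_nonneg ht v) (hxσ.1 v)) hpos.le
  · rw [push, hxσ.2.1 v hv, mul_zero, zero_div]
  · simp only [push]
    rw [← Finset.sum_div, ← pushMass_eq_sum hxσ, div_self hpos.ne']

theorem push_zero {x : V → ℝ} (hx : x ∈ polyhedron K) : push A 0 x = x := by
  have h1 : ∀ v, pushFactor A 0 v = 1 := fun v => by simp [pushFactor]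
  obtain ⟨σ, hσ, hxσ⟩ := hx
  funext v
  rw [push, pushMass_eq_sum hxσ]
  simp only [h1, one_mul, hxσ.2.2, div_one]

theorem continuous_pushMass (hK : K.IsLocallyFinite) :
    Continuous fun p : ℝ × K.Realization => pushMass A p.1 p.2.1 := by
  have hf : ∀ v, Continuous fun t : ℝ => pushFactor A t v := by
    intro v
    unfold pushFactor
    split_ifs <;> fun_prop
  refine continuous_finsum (fun v => ((hf v).comp continuous_fst).mul
    ((continuous_coord v).comp continuous_snd)) ?_
  refine (hK.locallyFinite_coord.preimage_continuous
    (continuous_snd (X := ℝ) (Y := K.Realization))).subset fun v p hp => ?_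
  exact right_ne_zero_of_mul hp

theorem continuous_push (hK : K.IsLocallyFinite) {X : Type*} [TopologicalSpace X]
    {τ : X → ℝ} (hτ : Continuous τ) {f F : X → K.Realization} (hf : Continuous f)
    (hpos : ∀ p, 0 < pushMass A (τ p) (f p).1) (hF : ∀ p, (F p).1 = push A (τ p) (f p).1) :
    Continuous F := by
  refine hK.continuous_iff.2 fun v => ?_
  simp only [hF, push]
  refine Continuous.div ?_ ((continuous_pushMass hK).comp (hτ.prodMk hf)) fun p => (hpos p).ne'
  refine Continuous.mul ?_ ((continuous_coord v).comp hf)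
  unfold pushFactor
  split_ifs <;> fun_prop

/-- Points of the frontier of the thickening have no local homology. -/
theorem subsingleton_localHomology_frontier [DecidableEq V] (hK : K.IsLocallyFinite)
    {y : (K.thickening A).Realization}
    (hy : y ∈ (K.thickening A).realizedSubset (K.thickeningFrontier A)) (n : ℕ) :
    Subsingleton (localHomology (K.thickening A).Realization y n) := by
  let e := flattenHomeomorph hK
  let g : (K.thickening A).Realization → K.Realization := fun z =>
    e (realizationInclusion thickening_le z)
  have hg : Continuous g :=
    e.continuous.comp (hK.barycentric.isEmbedding_realizationInclusion thickening_le).continuous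
  have hgA : ∀ z, ∃ v ∈ A, 0 < (g z).1 v ∧ ∀ w ∉ A, (g z).1 w ≤ (g z).1 v := fun z =>
    (mem_polyhedron_thickening_iff (realizationInclusion thickening_le z).2).2 z.2
  let X := unitInterval × (K.thickening A).Realization
  have hpos : ∀ p : X, 0 < pushMass A p.1.1 (g p.2).1 := fun p => by
    obtain ⟨v, hv, h0, -⟩ := hgA p.2
    exact pushMass_pos p.1.2.2 (g p.2).2 hv h0
  have hmem : ∀ p : X, push A p.1.1 (g p.2).1 ∈ polyhedron K := fun p =>
    push_mem p.1.2.2 (g p.2).2 (hpos p)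
  let h : X → K.Realization := fun p => ⟨push A p.1.1 (g p.2).1, hmem p⟩
  have hcont : Continuous h := continuous_push hK (continuous_subtype_val.comp continuous_fst)
    (hg.comp continuous_snd) hpos fun _ => rfl
  have hfl : ∀ p, flatten (e.symm (h p)).1 = push A p.1.1 (g p.2).1 := fun p =>
    congrArg (fun x : K.Realization => x.1) (e.apply_symm_apply (h p))
  -- Only the dominated side of the inequality is scaled down, so the homotopy stays in the
  -- thickening.
  have hle : ∀ (p : X), ∀ w ∉ A, ∀ v ∈ A, (g p.2).1 w ≤ (g p.2).1 v →
      push A p.1.1 (g p.2).1 w ≤ push A p.1.1 (g p.2).1 v := by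
    intro p w hw v hv hwv
    have hw0 : 0 ≤ (g p.2).1 w := by obtain ⟨_, _, h, _⟩ := (g p.2).2; exact h w
    have ht0 : 0 ≤ p.1.1 := p.1.2.1
    rw [push, push, div_le_div_iff_of_pos_right (hpos p), pushFactor, pushFactor, if_neg hw,
      if_pos hv]
    nlinarith
  have hthick : ∀ p, (e.symm (h p)).1 ∈ polyhedron (K.thickening A) := by
    intro p
    refine (mem_polyhedron_thickening_iff (e.symm (h p)).2).1.2 ?_
    obtain ⟨v, hv, h0, hw⟩ := hgA p.2
    rw [hfl]
    exact ⟨v, hv, fun w hwA => hle p w hwA v hv (hw w hwA)⟩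
  let H : C(X, (K.thickening A).Realization) := ⟨fun p => ⟨(e.symm (h p)).1, hthick p⟩, by
    refine (hK.barycentric.mono thickening_le).continuous_iff.2 fun σ => ?_
    have := (continuous_coord (K := K.barycentric) σ).comp (e.symm.continuous.comp hcont)
    exact this⟩
  have hH0 : ∀ z, H (0, z) = z := by
    intro z
    have : h (0, z) = g z := Subtype.ext (push_zero (g z).2)
    refine Subtype.ext ?_
    change (e.symm (h (0, z))).1 = z.1
    rw [this, e.symm_apply_apply]
    rfl
  refine subsingleton_localHomology_of_homotopy y H hH0 (fun t z htz => ?_) n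
  by_cases ht : t = 0
  · subst ht
    exact ⟨rfl, (hH0 z).symm.trans htz⟩
  · exfalso
    have ht' : 0 < t.1 := lt_of_le_of_ne t.2.1 fun h => ht (Subtype.ext h.symm)
    obtain ⟨v, hv, h0, hw⟩ := hgA z
    -- For `t > 0` dominance is strict: either the coordinate at `w` is zero and that at `v`
    -- positive, or scaling strictly decreases it. So the moved point cannot be the frontier point
    -- `y`.
    refine notMem_polyhedron_frontier (A := A) (e.symm (h (t, z))).2 hv ?_
      (show (H (t, z)).1 ∈ _ from htz ▸ hy)
    intro w hwA
    rw [hfl, push, push, div_lt_div_iff_of_pos_right (hpos (t, z)), pushFactor, pushFactor,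
      if_neg hwA, if_pos hv]
    have := hw w hwA
    have hw0 : 0 ≤ (g z).1 w := by obtain ⟨_, _, h, _⟩ := (g z).2; exact h w
    change (1 - t.1) * (g z).1 w < 1 * (g z).1 v
    rcases hw0.eq_or_lt with h | h
    · rwa [← h, mul_zero, one_mul]
    · nlinarith

end Push

/-- The boundary of the thickening. -/
def thickeningBoundary (K L : PreAbstractSimplicialComplex V) (A : Set V) :
    PreAbstractSimplicialComplex (Finset V) :=
  K.thickeningFrontier A ⊔ (K.thickening A ⊓ L.barycentric)

theorem realizedSubset_sup (X Y Z : PreAbstractSimplicialComplex V) :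
    X.realizedSubset (Y ⊔ Z) = X.realizedSubset Y ∪ X.realizedSubset Z := by
  ext x
  constructor
  · rintro ⟨σ, hσ | hσ, hx⟩
    · exact Or.inl ⟨σ, hσ, hx⟩
    · exact Or.inr ⟨σ, hσ, hx⟩
  · rintro (⟨σ, hσ, hx⟩ | ⟨σ, hσ, hx⟩)
    · exact ⟨σ, Or.inl hσ, hx⟩
    · exact ⟨σ, Or.inr hσ, hx⟩

theorem mem_realizedSubset_thickening_inf_iff [DecidableEq V] {y : (K.thickening A).Realization} :
    y ∈ (K.thickening A).realizedSubset (K.thickening A ⊓ L.barycentric) ↔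
      flattenMap K (realizationInclusion thickening_le y) ∈ K.realizedSubset L := by
  refine Iff.trans ?_ (flatten_mem_polyhedron_iff (realizationInclusion thickening_le y).2).symm
  obtain ⟨c, hc, hyc, hpos⟩ := exists_support y.2
  change y.1 ∈ polyhedron _ ↔ y.1 ∈ polyhedron _
  rw [mem_polyhedron_iff_of_support hyc hpos, mem_polyhedron_iff_of_support hyc hpos]
  exact ⟨fun h => h.2, fun h => ⟨hc, h⟩⟩

/-- Thickenings in rational homology manifolds are rational homology manifolds. -/
theorem _root_.IsTriangulatedRationalHomologyManifold.thickening [DecidableEq V] {n : ℕ}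
    (h : IsTriangulatedRationalHomologyManifold n K L) (A : Set V) :
    IsTriangulatedRationalHomologyManifold n (K.thickening A) (K.thickeningBoundary L A) := by
  have hK := h.locallyFinite
  refine ⟨sup_le inf_le_left inf_le_left, hK.barycentric.mono thickening_le, ?_⟩
  have hint : ∀ y ∉ (K.thickening A).realizedSubset (K.thickeningBoundary L A),
      y ∈ K.thickeningInterior A ∧
        flattenMap K (realizationInclusion thickening_le y) ∉ K.realizedSubset L := by
    intro y hy
    rw [thickeningBoundary, realizedSubset_sup, Set.mem_union, not_or] at hy
    exact ⟨mem_thickeningInterior hy.1, fun h' => hy.2 (mem_realizedSubset_thickening_inf_iff.2 h')⟩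
  refine ⟨fun y hy => ?_, fun y hy i hi => ?_, fun y hy i => ?_⟩
  · obtain ⟨h1, h2⟩ := hint y hy
    obtain ⟨a⟩ := nonempty_localHomology_thickening_equiv hK h1 n
    obtain ⟨b⟩ := h.manifold.interior_top _ h2
    exact ⟨a.trans b⟩
  · obtain ⟨h1, h2⟩ := hint y hy
    obtain ⟨a⟩ := nonempty_localHomology_thickening_equiv hK h1 i
    have := h.manifold.interior_zero _ h2 i hi
    exact a.toEquiv.subsingleton
  -- Frontier points vanish by the push, including those in `L`; the remaining boundary points are
  -- interior to the thickening and inherit the vanishing from `L`.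
  · by_cases hfr : y ∈ (K.thickening A).realizedSubset (K.thickeningFrontier A)
    · exact subsingleton_localHomology_frontier hK hfr i
    · rw [thickeningBoundary, realizedSubset_sup] at hy
      obtain ⟨a⟩ := nonempty_localHomology_thickening_equiv hK (mem_thickeningInterior hfr) i
      have := h.manifold.boundary_zero _
        (mem_realizedSubset_thickening_inf_iff.1 (hy.resolve_left hfr)) i
      exact a.toEquiv.subsingleton

end PreAbstractSimplicialComplex

/-! ### Regular coverings -/

open PreAbstractSimplicialComplex

/-- The preimage of the subcomplex `L` under the simplicial map `p`. -/
def PreAbstractSimplicialComplex.preimage {V : Type u} {W : Type v} [DecidableEq V]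
    (E : PreAbstractSimplicialComplex W) (p : W → V) (L : PreAbstractSimplicialComplex V) :
    PreAbstractSimplicialComplex W where
  faces := {σ | σ ∈ E ∧ σ.image p ∈ L}
  isRelLowerSet_faces := fun _ hσ => ⟨nonempty_of_mem hσ.1, fun _ hτ hne =>
    ⟨mem_of_subset hσ.1 hτ hne, mem_of_subset hσ.2 (Finset.image_subset_image hτ)
      (hne.image p)⟩⟩

namespace IsRegularCovering

/-! ### Coordinates on the star of a vertex. -/

section Star

variable {V : Type u} {W : Type v} {p : W → V} {N : Finset W}

/-- The coordinates of the image of a point in the open star of a vertex. -/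
noncomputable def pushforward [DecidableEq V] (p : W → V) (N : Finset W) (y : W → ℝ) (u : V) : ℝ :=
  ∑ x ∈ N, if p x = u then y x else 0

/-- The coordinates of the lift of a point to the open star of a vertex. -/
def pullback [DecidableEq W] (p : W → V) (N : Finset W) (z : V → ℝ) (x : W) : ℝ :=
  if x ∈ N then z (p x) else 0

theorem pushforward_eq [DecidableEq V] {y : W → ℝ} (hinj : Set.InjOn p N) {x : W} (hx : x ∈ N) :
    pushforward p N y (p x) = y x := by
  rw [pushforward, Finset.sum_eq_single_of_mem x hx, if_pos rfl]
  exact fun z hz hne => if_neg fun h => hne (hinj hz hx h)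

theorem pushforward_eq_zero [DecidableEq V] {y : W → ℝ} {σ : Finset W} (hy : y ∈ closedSimplex σ)
    {u : V} (hu : u ∉ σ.image p) : pushforward p N y u = 0 :=
  Finset.sum_eq_zero fun x _ => by
    split_ifs with hx
    · exact hy.2.1 x fun h => hu (Finset.mem_image.2 ⟨x, h, hx⟩)
    · rfl

theorem pushforward_mem [DecidableEq V] {y : W → ℝ} {σ : Finset W}
    (hinj : Set.InjOn p N) (hσ : σ ⊆ N) (hy : y ∈ closedSimplex σ) :
    pushforward p N y ∈ closedSimplex (σ.image p) := by
  refine ⟨fun u => Finset.sum_nonneg fun x _ => ?_, fun u hu => pushforward_eq_zero hy hu, ?_⟩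
  · split_ifs
    · exact hy.1 x
    · exact le_rfl
  · rw [Finset.sum_image (hinj.mono (Finset.coe_subset.2 hσ)), ← hy.2.2]
    exact Finset.sum_congr rfl fun x hx => pushforward_eq hinj (hσ hx)

theorem pullback_mem [DecidableEq V] [DecidableEq W] {z : V → ℝ} {σ : Finset W}
    (hinj : Set.InjOn p N) (hσ : σ ⊆ N) (hz : z ∈ closedSimplex (σ.image p)) :
    pullback p N z ∈ closedSimplex σ := by
  refine ⟨fun x => ?_, fun x hx => ?_, ?_⟩
  · rw [pullback]
    split_ifs
    · exact hz.1 _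
    · exact le_rfl
  · rw [pullback]
    split_ifs with hxN
    · refine hz.2.1 _ fun h => hx ?_
      obtain ⟨y, hy, hyx⟩ := Finset.mem_image.1 h
      rwa [← hinj (hσ hy) hxN hyx]
    · rfl
  · rw [← hz.2.2, Finset.sum_image (hinj.mono (Finset.coe_subset.2 hσ))]
    exact Finset.sum_congr rfl fun x hx => if_pos (hσ hx)

theorem pullback_pushforward [DecidableEq V] [DecidableEq W] {y : W → ℝ} {σ : Finset W}
    (hinj : Set.InjOn p N) (hσ : σ ⊆ N) (hy : y ∈ closedSimplex σ) :
    pullback p N (pushforward p N y) = y := by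
  funext x
  rw [pullback]
  split_ifs with hx
  · exact pushforward_eq hinj hx
  · exact (hy.2.1 x fun h => hx (hσ h)).symm

theorem pushforward_pullback [DecidableEq V] [DecidableEq W] {z : V → ℝ} {σ : Finset W}
    (hinj : Set.InjOn p N) (hσ : σ ⊆ N) (hz : z ∈ closedSimplex (σ.image p)) :
    pushforward p N (pullback p N z) = z := by
  funext u
  by_cases hu : u ∈ σ.image p
  · obtain ⟨x, hx, rfl⟩ := Finset.mem_image.1 hu
    rw [pushforward_eq hinj (hσ hx), pullback, if_pos (hσ hx)]
  · rw [pushforward_eq_zero (pullback_mem hinj hσ hz) hu, hz.2.1 u hu]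

end Star

variable {V : Type u} {W : Type v} {Γ : Type w} [DecidableEq V] [DecidableEq W] [Group Γ]
  [MulAction Γ W] {E : PreAbstractSimplicialComplex W} {K L : PreAbstractSimplicialComplex V}
  {p : W → V}

section

variable (h : IsRegularCovering Γ E K p)

include h

theorem image_mem {σ : Finset W} (hσ : σ ∈ E) : σ.image p ∈ K := by
  rw [← h.map_eq]
  exact ⟨σ, hσ, rfl⟩

theorem exists_lift {τ : Finset V} (hτ : τ ∈ K) : ∃ σ ∈ E, σ.image p = τ := by
  rw [← h.map_eq] at hτ
  exact hτ

theorem p_smul {σ : Finset W} (hσ : σ ∈ E) {x : W} (hx : x ∈ σ) (γ : Γ) : p (γ • x) = p x :=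
  h.map_smul γ x (mem_vertexSet hσ hx)

theorem image_smul {σ : Finset W} (hσ : σ ∈ E) (γ : Γ) : (γ • σ).image p = σ.image p := by
  ext u
  simp only [Finset.mem_image, Finset.mem_smul_finset]
  constructor
  · rintro ⟨_, ⟨x, hx, rfl⟩, rfl⟩
    exact ⟨x, hx, (h.p_smul hσ hx γ).symm⟩
  · rintro ⟨x, hx, rfl⟩
    exact ⟨γ • x, ⟨x, hx, rfl⟩, h.p_smul hσ hx γ⟩

/-- A simplex is determined by its image and one of its vertices. -/
theorem eq_of_image_eq {σ τ : Finset W} (hσ : σ ∈ E) (hτ : τ ∈ E)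
    (heq : σ.image p = τ.image p) {x : W} (hxσ : x ∈ σ) (hxτ : x ∈ τ) : σ = τ := by
  obtain ⟨γ, rfl⟩ := h.transitive σ hσ τ hτ heq
  have hγ : γ • x = x := h.injOn _ hτ (Finset.smul_mem_smul_finset hxσ) hxτ (h.p_smul hσ hxσ γ)
  rw [h.free γ x (mem_vertexSet hσ hxσ) hγ, one_smul]

/-- The lift of a simplex can be chosen to contain a given lift of one of its vertices. -/
theorem exists_lift_mem {x : W} (hx : {x} ∈ E) {τ : Finset V} (hτ : τ ∈ K) (hxτ : p x ∈ τ) :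
    ∃ σ ∈ E, σ.image p = τ ∧ x ∈ σ := by
  obtain ⟨σ, hσ, rfl⟩ := h.exists_lift hτ
  obtain ⟨y, hy, hyx⟩ := Finset.mem_image.1 hxτ
  obtain ⟨γ, hγ⟩ := h.transitive {y} (mem_vertexSet hσ hy) {x} hx (by
    rw [Finset.image_singleton, Finset.image_singleton, hyx])
  rw [Finset.smul_finset_singleton, Finset.singleton_inj] at hγ
  exact ⟨γ • σ, h.smul_mem γ σ hσ, h.image_smul hσ γ, hγ ▸ Finset.smul_mem_smul_finset hy⟩

/-- Projection is injective on the simplices containing a fixed vertex, by `eq_of_image_eq`. -/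
theorem isLocallyFinite (hK : K.IsLocallyFinite) : E.IsLocallyFinite := by
  intro x
  refine Set.Finite.of_finite_image (f := fun σ => σ.image p) ((hK (p x)).subset ?_) ?_
  · rintro _ ⟨σ, hσ, rfl⟩
    exact ⟨h.image_mem hσ.1, Finset.mem_image_of_mem p hσ.2⟩
  · exact fun σ hσ τ hτ heq => h.eq_of_image_eq hσ.1 hτ.1 heq hσ.2 hτ.2

/-- Edges at `x` with the same image coincide; the degenerate edge with `y = x` is included. -/
theorem injOn_star (x : W) : Set.InjOn p {y | {x, y} ∈ E} := by
  intro y hy z hz hyz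
  have heq : ({x, y} : Finset W) = {x, z} := by
    refine h.eq_of_image_eq hy hz ?_ (Finset.mem_insert_self x _) (Finset.mem_insert_self x _)
    simp [Finset.image_insert, hyz]
  have hy' : y ∈ ({x, z} : Finset W) := heq ▸ by simp
  have hz' : z ∈ ({x, y} : Finset W) := heq ▸ by simp
  simp only [Finset.mem_insert, Finset.mem_singleton] at hy' hz'
  rcases hy' with rfl | hy'
  · rcases hz' with hz' | hz' <;> exact hz'.symm
  · exact hy'

end

theorem mem_star {x y : W} {σ : Finset W} (hσ : σ ∈ E) (hx : x ∈ σ) (hy : y ∈ σ) :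
    {x, y} ∈ E :=
  mem_of_subset hσ (Finset.insert_subset hx (Finset.singleton_subset_iff.2 hy))
    (Finset.insert_nonempty _ _)

theorem finite_star (hE : E.IsLocallyFinite) (x : W) : {y | {x, y} ∈ E}.Finite := by
  refine ((hE x).biUnion fun τ _ => τ.finite_toSet).subset fun y hy => ?_
  exact Set.mem_iUnion₂.2 ⟨{x, y}, ⟨hy, by simp⟩, by simp⟩

theorem subset_star {N : Finset W} {x : W} (hN : ∀ y, y ∈ N ↔ {x, y} ∈ E) {y : W → ℝ}
    (hy : y ∈ polyhedron E) (hx : 0 < y x) :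
    ∃ σ ∈ E, y ∈ closedSimplex σ ∧ (∀ w, w ∈ σ ↔ 0 < y w) ∧ σ ⊆ N := by
  obtain ⟨σ, hσ, hyσ, hpos⟩ := exists_support hy
  exact ⟨σ, hσ, hyσ, hpos, fun w hw => (hN w).2 (mem_star hσ ((hpos x).2 hx) hw)⟩

section

variable (h : IsRegularCovering Γ E K p)

include h

theorem exists_lift_closedSimplex {N : Finset W} {x : W} (hx : {x} ∈ E)
    (hN : ∀ y, y ∈ N ↔ {x, y} ∈ E) {z : V → ℝ} (hz : z ∈ polyhedron K) (hxz : 0 < z (p x)) :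
    ∃ σ ∈ E, z ∈ closedSimplex (σ.image p) ∧ x ∈ σ ∧ σ ⊆ N := by
  obtain ⟨τ, hτ, hzτ, hpos⟩ := exists_support hz
  obtain ⟨σ, hσ, rfl, hxσ⟩ := h.exists_lift_mem hx hτ ((hpos _).2 hxz)
  exact ⟨σ, hσ, hzτ, hxσ, fun w hw => (hN w).2 (mem_star hσ hxσ hw)⟩

/-- The open star of a vertex of the covering is homeomorphic to the open star of its image. -/
theorem exists_homeomorph_star (hK : K.IsLocallyFinite) {x : W} (hx : {x} ∈ E) :
    ∃ e : {y : E.Realization // 0 < y.1 x} ≃ₜ {z : K.Realization // 0 < z.1 (p x)},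
      ∀ y, (e y).1 ∈ K.realizedSubset L ↔ y.1 ∈ E.realizedSubset (E.preimage p L) := by
  have hE := h.isLocallyFinite hK
  let N := (finite_star hE x).toFinset
  have hN : ∀ y, y ∈ N ↔ {x, y} ∈ E := fun y => Set.Finite.mem_toFinset _
  have hxN : x ∈ N := (hN x).2 (by simpa using hx)
  have hinj : Set.InjOn p N := (h.injOn_star x).mono fun y hy => (hN y).1 hy
  have hmem : ∀ y : E.Realization, 0 < y.1 x → pushforward p N y.1 ∈ polyhedron K := by
    intro y hy
    obtain ⟨σ, hσ, hyσ, -, hσN⟩ := subset_star hN y.2 hy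
    exact ⟨_, h.image_mem hσ, pushforward_mem hinj hσN hyσ⟩
  have hmem' : ∀ z : K.Realization, 0 < z.1 (p x) → pullback p N z.1 ∈ polyhedron E := by
    intro z hz
    obtain ⟨σ, hσ, hzσ, -, hσN⟩ := h.exists_lift_closedSimplex hx hN z.2 hz
    exact ⟨_, hσ, pullback_mem hinj hσN hzσ⟩
  let f : {y : E.Realization // 0 < y.1 x} → K.Realization :=
    fun y => ⟨pushforward p N y.1.1, hmem y.1 y.2⟩
  let g : {z : K.Realization // 0 < z.1 (p x)} → E.Realization :=
    fun z => ⟨pullback p N z.1.1, hmem' z.1 z.2⟩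
  have hf : Continuous f := by
    refine hK.continuous_iff.2 fun u => continuous_finsetSum _ fun w _ => ?_
    split_ifs
    · exact (continuous_coord w).comp continuous_subtype_val
    · exact continuous_const
  have hg : Continuous g := by
    refine hE.continuous_iff.2 fun w => ?_
    change Continuous fun z : {z : K.Realization // 0 < z.1 (p x)} => pullback p N z.1.1 w
    unfold pullback
    split_ifs
    · exact (continuous_coord (p w)).comp continuous_subtype_val
    · exact continuous_const
  have hfx : ∀ y, 0 < (f y).1 (p x) := fun y => by
    change 0 < pushforward p N y.1.1 (p x)
    rw [pushforward_eq hinj hxN]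
    exact y.2
  have hgx : ∀ z, 0 < (g z).1 x := fun z => by
    change 0 < pullback p N z.1.1 x
    rw [pullback, if_pos hxN]
    exact z.2
  refine ⟨⟨⟨fun y => ⟨f y, hfx y⟩, fun z => ⟨g z, hgx z⟩, fun y => ?_, fun z => ?_⟩,
    hf.subtype_mk _, hg.subtype_mk _⟩, fun y => ?_⟩
  · obtain ⟨σ, hσ, hyσ, -, hσN⟩ := subset_star hN y.1.2 y.2
    exact Subtype.ext (Subtype.ext (pullback_pushforward hinj hσN hyσ))
  · obtain ⟨σ, hσ, hzσ, -, hσN⟩ := h.exists_lift_closedSimplex hx hN z.1.2 z.2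
    exact Subtype.ext (Subtype.ext (pushforward_pullback hinj hσN hzσ))
  · obtain ⟨σ, hσ, hyσ, hpos, hσN⟩ := subset_star hN y.1.2 y.2
    have hpos' : ∀ u, u ∈ σ.image p ↔ 0 < pushforward p N y.1.1 u := by
      intro u
      constructor
      · intro hu
        obtain ⟨w, hw, rfl⟩ := Finset.mem_image.1 hu
        rw [pushforward_eq hinj (hσN hw)]
        exact (hpos w).1 hw
      · intro hu
        by_contra hne
        exact hu.ne' (pushforward_eq_zero hyσ hne)
    change pushforward p N y.1.1 ∈ polyhedron L ↔ y.1.1 ∈ polyhedron _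
    rw [mem_polyhedron_iff_of_support (pushforward_mem hinj hσN hyσ) hpos',
      mem_polyhedron_iff_of_support hyσ hpos]
    exact ⟨fun h => ⟨hσ, h⟩, fun h => h.2⟩

/-- The point lies in the open star of any vertex of its support; excise to that star on both sides.
-/
theorem exists_localHomology_equiv (hK : K.IsLocallyFinite) (L : PreAbstractSimplicialComplex V)
    (y : E.Realization) : ∃ z : K.Realization,
      (z ∈ K.realizedSubset L ↔ y ∈ E.realizedSubset (E.preimage p L)) ∧
      ∀ n, Nonempty (localHomology E.Realization y n ≃ₗ[ℚ] localHomology K.Realization z n) := by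
  obtain ⟨σ, hσ, -, hpos⟩ := exists_support y.2
  obtain ⟨x, hxσ⟩ := nonempty_of_mem hσ
  obtain ⟨e, he⟩ := h.exists_homeomorph_star (L := L) hK (mem_vertexSet hσ hxσ)
  have hy := (hpos x).1 hxσ
  have hopen : IsOpen {y : E.Realization | 0 < y.1 x} :=
    isOpen_lt continuous_const (continuous_coord x)
  have hopen' : IsOpen {z : K.Realization | 0 < z.1 (p x)} :=
    isOpen_lt continuous_const (continuous_coord (p x))
  refine ⟨(e ⟨y, hy⟩).1, he ⟨y, hy⟩, fun n => ?_⟩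
  obtain ⟨a⟩ := nonempty_localHomology_equiv hopen.isOpenEmbedding_subtypeVal ⟨y, hy⟩ n
  obtain ⟨b⟩ := nonempty_localHomology_equiv
    (hopen'.isOpenEmbedding_subtypeVal.comp e.isOpenEmbedding) ⟨y, hy⟩ n
  exact ⟨a.symm.trans b⟩

/-- Coverings of rational homology manifolds are rational homology manifolds. -/
theorem isTriangulatedRationalHomologyManifold {n : ℕ}
    (hKL : IsTriangulatedRationalHomologyManifold n K L) :
    IsTriangulatedRationalHomologyManifold n E (E.preimage p L) := by
  have hK := hKL.locallyFinite
  refine ⟨fun σ hσ => hσ.1, h.isLocallyFinite hK, fun y hy => ?_, fun y hy i hi => ?_,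
    fun y hy i => ?_⟩ <;> obtain ⟨z, hz, hn⟩ := h.exists_localHomology_equiv hK L y
  · obtain ⟨a⟩ := hn n
    obtain ⟨b⟩ := hKL.manifold.interior_top z fun h' => hy (hz.1 h')
    exact ⟨a.trans b⟩
  · obtain ⟨a⟩ := hn i
    have := hKL.manifold.interior_zero z (fun h' => hy (hz.1 h')) i hi
    exact a.toEquiv.subsingleton
  · obtain ⟨a⟩ := hn i
    have := hKL.manifold.boundary_zero z (hz.2 hy) i
    exact a.toEquiv.subsingleton

end

end IsRegularCovering

/-! ### Barycentric subdivision of a regular covering. -/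

namespace IsRegularCovering

open PreAbstractSimplicialComplex

variable {V : Type u} {W : Type v} {Γ : Type w} [DecidableEq V] [DecidableEq W] [Group Γ]
  [MulAction Γ W] {E : PreAbstractSimplicialComplex W} {K : PreAbstractSimplicialComplex V}
  {p : W → V}

theorem eq_one_of_smul_eq (h : IsRegularCovering Γ E K p) {σ : Finset W} (hσ : σ ∈ E) {γ : Γ}
    (hγ : γ • σ = σ) : γ = 1 := by
  obtain ⟨x, hx⟩ := nonempty_of_mem hσ
  have hγx : γ • x ∈ σ := hγ ▸ Finset.smul_mem_smul_finset hx
  exact h.free γ x (mem_vertexSet hσ hx) (h.injOn σ hσ hγx hx (h.p_smul hσ hx γ))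

theorem eq_of_subset_of_image_eq (h : IsRegularCovering Γ E K p) {σ ρ ρ' : Finset W} (hσ : σ ∈ E)
    (hρ : ρ ⊆ σ) (hρ' : ρ' ⊆ σ) (heq : ρ.image p = ρ'.image p) : ρ = ρ' := by
  have key : ∀ a b : Finset W, a ⊆ σ → b ⊆ σ → a.image p = b.image p → a ⊆ b := by
    intro a b ha hb hab x hx
    obtain ⟨y, hy, hyx⟩ := Finset.mem_image.1 (hab ▸ Finset.mem_image_of_mem p hx)
    rwa [← h.injOn σ hσ (hb hy) (ha hx) hyx]
  exact (key ρ ρ' hρ hρ' heq).antisymm (key ρ' ρ hρ' hρ heq.symm)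

/-- The barycentric subdivision of a regular covering is a regular covering. -/
theorem barycentric (h : IsRegularCovering Γ E K p) :
    IsRegularCovering Γ E.barycentric K.barycentric (Finset.image p) where
  map_eq := by
    ext c
    constructor
    · rintro ⟨d, hd, rfl⟩
      refine ⟨hd.1.image _, fun σ hσ => ?_, fun σ hσ τ hτ _ => ?_⟩
      · obtain ⟨ρ, hρ, rfl⟩ := Finset.mem_image.1 hσ
        exact h.image_mem (hd.2.1 ρ hρ)
      · obtain ⟨ρ, hρ, rfl⟩ := Finset.mem_image.1 hσ
        obtain ⟨ρ', hρ', rfl⟩ := Finset.mem_image.1 hτ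
        exact (subset_or_subset_of_mem_barycentric hd hρ hρ').imp
          Finset.image_subset_image Finset.image_subset_image
    · intro hc
      obtain ⟨τ, hτ, hmax⟩ := Finset.exists_greatest_of_isChain hc.1 hc.2.2
      -- Lift the greatest simplex of the chain; the others then lift uniquely as faces of that
      -- lift.
      obtain ⟨σ, hσ, rfl⟩ := h.exists_lift (hc.2.1 τ hτ)
      have himg : ∀ ρ ∈ c, (σ.filter fun x => p x ∈ ρ).image p = ρ := by
        intro ρ hρ
        ext u
        simp only [Finset.mem_image, Finset.mem_filter]
        constructor
        · rintro ⟨x, ⟨-, hx⟩, rfl⟩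
          exact hx
        · intro hu
          obtain ⟨x, hx, rfl⟩ := Finset.mem_image.1 (hmax ρ hρ hu)
          exact ⟨x, ⟨hx, hu⟩, rfl⟩
      refine ⟨c.image fun ρ => σ.filter fun x => p x ∈ ρ, ⟨hc.1.image _, fun ρ' hρ' => ?_,
        fun ρ hρ ρ' hρ' _ => ?_⟩, ?_⟩
      · obtain ⟨ρ, hρ, rfl⟩ := Finset.mem_image.1 hρ'
        refine mem_of_subset hσ (Finset.filter_subset _ _) ?_
        rw [← Finset.image_nonempty (f := p), himg ρ hρ]
        exact nonempty_of_mem (hc.2.1 ρ hρ)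
      · obtain ⟨a, ha, rfl⟩ := Finset.mem_image.1 hρ
        obtain ⟨b, hb, rfl⟩ := Finset.mem_image.1 hρ'
        refine (subset_or_subset_of_mem_barycentric hc ha hb).imp ?_ ?_ <;>
          exact fun hab => Finset.monotone_filter_right _ fun x _ hx => hab hx
      · change Finset.image (Finset.image p) (Finset.image _ c) = c
        rw [Finset.image_image]
        refine (Finset.image_congr fun ρ hρ => ?_).trans Finset.image_id
        exact himg ρ hρ
  injOn c hc σ hσ τ hτ heq := by
    obtain ⟨ρ, hρ, hmax⟩ := Finset.exists_greatest_of_isChain hc.1 hc.2.2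
    exact h.eq_of_subset_of_image_eq (hc.2.1 ρ hρ) (hmax σ hσ) (hmax τ hτ) heq
  smul_mem γ c hc := by
    refine ⟨hc.1.smul_finset, fun σ hσ => ?_, fun σ hσ τ hτ _ => ?_⟩
    · obtain ⟨ρ, hρ, rfl⟩ := Finset.mem_smul_finset.1 hσ
      exact h.smul_mem γ ρ (hc.2.1 ρ hρ)
    · obtain ⟨ρ, hρ, rfl⟩ := Finset.mem_smul_finset.1 hσ
      obtain ⟨ρ', hρ', rfl⟩ := Finset.mem_smul_finset.1 hτ
      exact (subset_or_subset_of_mem_barycentric hc hρ hρ').imp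
        Finset.smul_finset_subset_smul_finset Finset.smul_finset_subset_smul_finset
  map_smul γ σ hσ := h.image_smul (hσ.2.1 σ (Finset.mem_singleton_self σ)) γ
  free γ σ hσ hγ := h.eq_one_of_smul_eq (hσ.2.1 σ (Finset.mem_singleton_self σ)) hγ
  transitive c hc d hd heq := by
    obtain ⟨σ, hσ, hσmax⟩ := Finset.exists_greatest_of_isChain hc.1 hc.2.2
    obtain ⟨τ, hτ, hτmax⟩ := Finset.exists_greatest_of_isChain hd.1 hd.2.2
    have hcd : ∀ ρ ∈ c, ∃ ρ' ∈ d, ρ'.image p = ρ.image p := fun ρ hρ =>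
      Finset.mem_image.1 (heq ▸ Finset.mem_image_of_mem (Finset.image p) hρ)
    have hdc : ∀ ρ ∈ d, ∃ ρ' ∈ c, ρ'.image p = ρ.image p := fun ρ hρ =>
      Finset.mem_image.1 (heq.symm ▸ Finset.mem_image_of_mem (Finset.image p) hρ)
    have himg : σ.image p = τ.image p := by
      obtain ⟨ρ, hρ, h1⟩ := hcd σ hσ
      obtain ⟨ρ', hρ', h2⟩ := hdc τ hτ
      rw [← h1]
      refine (Finset.image_subset_image (hτmax ρ hρ)).antisymm ?_
      rw [h1, ← h2]
      exact Finset.image_subset_image (hσmax ρ' hρ')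
    -- An element matching the greatest simplices matches the whole chains, since faces of one
    -- simplex are determined by their images.
    obtain ⟨γ, rfl⟩ := h.transitive σ (hc.2.1 σ hσ) τ (hd.2.1 τ hτ) himg
    have heqρ : ∀ ρ ∈ c, ∀ ρ' ∈ d, ρ'.image p = ρ.image p → γ • ρ = ρ' := fun ρ hρ ρ' hρ' hp =>
      h.eq_of_subset_of_image_eq (hd.2.1 _ hτ)
        (Finset.smul_finset_subset_smul_finset (hσmax ρ hρ)) (hτmax ρ' hρ')
        ((h.image_smul (hc.2.1 ρ hρ) γ).trans hp.symm)
    refine ⟨γ, ?_⟩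
    ext ρ
    rw [Finset.mem_smul_finset]
    constructor
    · rintro ⟨ρ, hρ, rfl⟩
      obtain ⟨ρ', hρ', hp⟩ := hcd ρ hρ
      rwa [heqρ ρ hρ ρ' hρ' hp]
    · intro hρ
      obtain ⟨ρ', hρ', hp⟩ := hdc ρ hρ
      exact ⟨ρ', hρ', heqρ ρ' hρ' ρ hρ hp.symm⟩

end IsRegularCovering

/-! ### Word metrics and Følner sequences -/

section Group

variable {Γ : Type w} [Group Γ]

/-- The elements that are products of `n` generators and inverses of generators. -/
def wordSphere (S : Finset Γ) (n : ℕ) : Set Γ :=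
  {g | ∃ l : List Γ, l.length = n ∧ (∀ s ∈ l, s ∈ S ∨ s⁻¹ ∈ S) ∧ l.prod = g}

theorem finite_wordSphere (S : Finset Γ) (n : ℕ) : (wordSphere S n).Finite := by
  induction n with
  | zero =>
    refine (Set.finite_singleton (1 : Γ)).subset ?_
    rintro g ⟨l, hl, -, rfl⟩
    rw [List.length_eq_zero_iff.1 hl]
    rfl
  | succ n ih =>
    have hS : {s : Γ | s ∈ S ∨ s⁻¹ ∈ S}.Finite :=
      S.finite_toSet.union (S.finite_toSet.preimage inv_injective.injOn)
    refine (hS.mul ih).subset ?_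
    rintro g ⟨l, hl, hlS, rfl⟩
    obtain ⟨s, l, rfl⟩ := List.exists_cons_of_length_eq_add_one hl
    exact ⟨s, hlS s (by simp), l.prod, ⟨l, by simpa using hl, fun t ht => hlS t (by simp [ht]), rfl⟩,
      by simp⟩

theorem exists_mem_wordSphere {S : Finset Γ} (hS : Subgroup.closure (S : Set Γ) = ⊤) (g : Γ) :
    ∃ n, g ∈ wordSphere S n := by
  have hg : g ∈ (Subgroup.closure (S : Set Γ)).toSubmonoid := hS ▸ Subgroup.mem_top g
  rw [Subgroup.closure_toSubmonoid] at hg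
  obtain ⟨l, hl, rfl⟩ := Submonoid.exists_list_of_mem_closure hg
  exact ⟨l.length, l, rfl, hl, rfl⟩

theorem countable_of_closure_eq_top {S : Finset Γ} (hS : Subgroup.closure (S : Set Γ) = ⊤) :
    Countable Γ := by
  rw [← Set.countable_univ_iff]
  refine (Set.countable_iUnion fun n => (finite_wordSphere S n).countable).mono fun g _ => ?_
  exact Set.mem_iUnion.2 (exists_mem_wordSphere hS g)

theorem finite_wordBall {S : Finset Γ} (hS : Subgroup.closure (S : Set Γ) = ⊤) (R : ℝ) :
    {g : Γ | (wordLength S g : ℝ) < R}.Finite := by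
  refine ((Set.finite_Iio ⌈R⌉₊).biUnion fun n _ => finite_wordSphere S n).subset fun g hg => ?_
  exact Set.mem_iUnion₂.2 ⟨wordLength S g, Nat.lt_ceil.2 hg,
    Nat.sInf_mem (exists_mem_wordSphere hS g)⟩

theorem wordDist_self (S : Finset Γ) (g : Γ) : wordDist S g g = 0 := by
  rw [wordDist, inv_mul_cancel]
  exact Nat.sInf_eq_zero.2 (Or.inl ⟨[], rfl, by simp, rfl⟩)

/-- The Følner condition controls left translation, while the left invariant metric calls for right
translation. The set `g F⁻¹` converts one into the other, and a suitable `g ∈ F` makes it contain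
`P`. -/
theorem IsAmenableGroup.exists_superset (h : IsAmenableGroup Γ) (T P : Finset Γ) {ε : ℝ}
    (hε : 0 < ε) : ∃ G : Finset Γ, P ⊆ G ∧ G.Nonempty ∧
      ∀ t ∈ T, ({g | g ∈ G ∧ g * t ∉ G}.ncard : ℝ) ≤ ε * G.card := by
  classical
  let Q := (T ∪ P).image fun t => t⁻¹
  obtain ⟨F, hF, hFQ⟩ := h Q (min ε (1 / (Q.card + 1))) (lt_min hε (by positivity))
  have hF0 : (0 : ℝ) < F.card := Nat.cast_pos.2 (Finset.card_pos.2 hF)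
  -- Each `t ∈ Q` moves at most `|F| / (|Q| + 1)` elements out of `F`, so the bad elements cannot
  -- exhaust `F`.
  obtain ⟨g, hg, hgQ⟩ : ∃ g ∈ F, ∀ t ∈ Q, t * g ∈ F := by
    by_contra! hne
    have hcov : F ⊆ Q.biUnion fun t => F.filter fun g => t * g ∉ F := by
      intro g hg
      obtain ⟨t, ht, htg⟩ := hne g hg
      exact Finset.mem_biUnion.2 ⟨t, ht, Finset.mem_filter.2 ⟨hg, htg⟩⟩
    have h1 : (F.card : ℝ) ≤ ∑ t ∈ Q, ((F.filter fun g => t * g ∉ F).card : ℝ) := by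
      exact_mod_cast (Finset.card_le_card hcov).trans Finset.card_biUnion_le
    have h2 : ∀ t ∈ Q, ((F.filter fun g => t * g ∉ F).card : ℝ) ≤ 1 / (Q.card + 1) * F.card := by
      intro t ht
      rw [← Set.ncard_coe_finset]
      rw [Finset.coe_filter]
      exact (hFQ t ht).trans (mul_le_mul_of_nonneg_right (min_le_right _ _) hF0.le)
    have h3 := h1.trans (Finset.sum_le_sum h2)
    rw [Finset.sum_const, nsmul_eq_mul, ← mul_assoc, mul_one_div] at h3
    have h4 : (Q.card : ℝ) / (Q.card + 1) < 1 := by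
      rw [div_lt_one (by positivity)]; linarith
    nlinarith
  have hinj : Function.Injective fun y : Γ => g * y⁻¹ := fun a b hab =>
    inv_injective (mul_left_cancel hab)
  have hmem : ∀ x, x ∈ F.image (fun y => g * y⁻¹) ↔ x⁻¹ * g ∈ F := by
    intro x
    rw [Finset.mem_image]
    constructor
    · rintro ⟨y, hy, rfl⟩
      simpa using hy
    · exact fun hx => ⟨x⁻¹ * g, hx, by group⟩
  refine ⟨F.image fun y => g * y⁻¹, fun x hx => (hmem x).2 (hgQ _ ?_), hF.image _, fun t ht => ?_⟩
  · exact Finset.mem_image_of_mem _ (Finset.mem_union_right _ hx)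
  · rw [Finset.card_image_of_injective _ hinj]
    refine le_trans ?_ ((hFQ t⁻¹ (Finset.mem_image_of_mem _ (Finset.mem_union_left _ ht))).trans
      (mul_le_mul_of_nonneg_right (min_le_left _ _) hF0.le))
    rw [← Set.ncard_image_of_injective {y | y ∈ F ∧ t⁻¹ * y ∉ F} hinj]
    refine Nat.cast_le.2 (Set.ncard_le_ncard ?_ ((F.finite_toSet.subset fun y hy => hy.1).image _))
    rintro x ⟨hx, hxt⟩
    refine ⟨x⁻¹ * g, ⟨(hmem x).1 hx, fun hx' => hxt ((hmem _).2 ?_)⟩, by group⟩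
    rwa [mul_inv_rev, mul_assoc]

/-- An amenable countable group has an exhaustion by asymptotically invariant finite sets. -/
theorem IsAmenableGroup.exists_sequence [Countable Γ] [DecidableEq Γ] (h : IsAmenableGroup Γ) :
    ∃ G : ℕ → Finset Γ, Monotone G ∧ (∀ k, (G k).Nonempty) ∧ (∀ γ, ∃ k, γ ∈ G k) ∧
      ∀ T : Finset Γ, T.Nonempty →
        Tendsto (fun k => ((G k * T).card : ℝ) / (G k).card) atTop (𝓝 1) := by
  obtain ⟨e, he⟩ := exists_surjective_nat Γ
  let T : ℕ → Finset Γ := fun k => (Finset.range k).image e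
  -- Stage `k` treats the first `k` elements of an enumeration with error `1 / (k + 1)`; absorbing
  -- the previous set and these elements makes the sequence an exhaustion.
  choose next hnext1 hnext2 hnext3 using fun (k : ℕ) (P : Finset Γ) =>
    h.exists_superset (T k) P (ε := 1 / ((k : ℝ) + 1)) (by positivity)
  obtain ⟨G, hG0, hGs⟩ : ∃ G : ℕ → Finset Γ, G 0 = next 0 ∅ ∧
      ∀ k, G (k + 1) = next (k + 1) (G k ∪ T (k + 1)) :=
    ⟨fun k => Nat.rec (next 0 ∅) (fun k P => next (k + 1) (P ∪ T (k + 1))) k, rfl, fun _ => rfl⟩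
  have hG : ∀ k, ∃ P, G k = next k P := fun k => by
    cases k with
    | zero => exact ⟨_, hG0⟩
    | succ k => exact ⟨_, hGs k⟩
  have hne : ∀ k, (G k).Nonempty := fun k => by
    obtain ⟨P, hP⟩ := hG k
    exact hP ▸ hnext2 k P
  have hsucc : ∀ k, G k ∪ T (k + 1) ⊆ G (k + 1) := fun k => hGs k ▸ hnext1 _ _
  refine ⟨G, monotone_nat_of_le_succ fun k => Finset.union_subset_left (hsucc k), hne, fun γ => ?_,
    fun S hS => ?_⟩
  · obtain ⟨n, rfl⟩ := he γ
    exact ⟨n + 1, hsucc n (Finset.mem_union_right _ (Finset.mem_image_of_mem e (by simp)))⟩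
  · have hlow : ∀ k, 1 ≤ ((G k * S).card : ℝ) / (G k).card := by
      intro k
      rw [one_le_div (Nat.cast_pos.2 (Finset.card_pos.2 (hne k)))]
      exact_mod_cast Finset.card_le_card_mul_right hS
    -- Once the enumeration has reached all of `S`, each `s ∈ S` adds at most `|G k| / (k + 1)`
    -- elements.
    have hup : ∀ᶠ k in atTop, ((G k * S).card : ℝ) / (G k).card ≤
        1 + S.card * (1 / ((k : ℝ) + 1)) := by
      choose f hf using he
      filter_upwards [eventually_gt_atTop (S.sup f)] with k hk
      have hST : S ⊆ T k := fun s hs => Finset.mem_image.2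
        ⟨f s, Finset.mem_range.2 ((Finset.le_sup hs).trans_lt hk), hf s⟩
      have hpos : (0 : ℝ) < (G k).card := Nat.cast_pos.2 (Finset.card_pos.2 (hne k))
      rw [div_le_iff₀ hpos]
      obtain ⟨P, hP⟩ := hG k
      let B : Γ → Finset Γ := fun s =>
        ({g ∈ G k | g * s ∉ G k} : Finset Γ).image fun g => g * s
      have hcov : G k * S ⊆ G k ∪ S.biUnion B := by
        intro x hx
        obtain ⟨g, hg, s, hs, rfl⟩ := Finset.mem_mul.1 hx
        by_cases hgs : g * s ∈ G k
        · exact Finset.mem_union_left _ hgs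
        · exact Finset.mem_union_right _ (Finset.mem_biUnion.2 ⟨s, hs,
            Finset.mem_image_of_mem _ (Finset.mem_filter.2 ⟨hg, hgs⟩)⟩)
      have h1 : ((G k * S).card : ℝ) ≤ (G k).card + ∑ s ∈ S, ((B s).card : ℝ) := by
        exact_mod_cast (Finset.card_le_card hcov).trans ((Finset.card_union_le _ _).trans
          (Nat.add_le_add_left Finset.card_biUnion_le _))
      have h2 : ∀ s ∈ S, ((B s).card : ℝ) ≤ 1 / ((k : ℝ) + 1) * (G k).card := by
        intro s hs
        refine le_trans (Nat.cast_le.2 Finset.card_image_le) ?_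
        have := hnext3 k P s (hST hs)
        rw [← hP] at this
        rwa [← Set.ncard_coe_finset, Finset.coe_filter]
      have h3 := h1.trans (add_le_add_right (Finset.sum_le_sum h2) _)
      rw [Finset.sum_const, nsmul_eq_mul] at h3
      linarith
    refine tendsto_of_tendsto_of_tendsto_of_le_of_le' tendsto_const_nhds ?_
      (Eventually.of_forall hlow) hup
    have := (tendsto_one_div_add_atTop_nhds_zero_nat (𝕜 := ℝ)).const_mul (S.card : ℝ)
    simpa using this.const_add 1

end Group

/-! ### Counting simplices of a regular covering -/

namespace IsRegularCovering

open PreAbstractSimplicialComplex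

section

variable {V : Type u} {W : Type v} {Γ : Type w} [DecidableEq W] [Group Γ] [MulAction Γ W]
  {lift : Finset V → Finset W}

/-- The translates by `D` of the chosen lifts of the simplices in `C`. -/
def translates (lift : Finset V → Finset W) (C : Set (Finset V)) (D : Set Γ) : Set (Finset W) :=
  (fun q : Finset V × Γ => q.2 • lift q.1) '' (C ×ˢ D)

theorem smul_lift_mem_translates {C : Set (Finset V)} {D : Set Γ} {c : Finset V} (hc : c ∈ C)
    {γ : Γ} (hγ : γ ∈ D) : γ • lift c ∈ translates lift C D :=
  ⟨(c, γ), ⟨hc, hγ⟩, rfl⟩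

theorem finite_translates {C : Set (Finset V)} (hC : C.Finite) (D : Finset Γ) :
    (translates lift C (D : Set Γ)).Finite :=
  (hC.prod D.finite_toSet).image _

end

variable {V : Type u} {W : Type v} {Γ : Type w} [DecidableEq V] [DecidableEq W] [Group Γ]
  [MulAction Γ W] {E : PreAbstractSimplicialComplex W} {K : PreAbstractSimplicialComplex V}
  {p : W → V} {lift : Finset V → Finset W}

theorem image_smul_lift (h : IsRegularCovering Γ E K p) (hlift : IsLiftChoice E K p lift)
    {c : Finset V} (hc : c ∈ K) (γ : Γ) : (γ • lift c).image p = c :=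
  (h.image_smul (hlift c hc).1 γ).trans (hlift c hc).2

theorem exists_smul_lift (h : IsRegularCovering Γ E K p) (hlift : IsLiftChoice E K p lift)
    {τ : Finset W} (hτ : τ ∈ E) : ∃ γ : Γ, γ • lift (τ.image p) = τ :=
  have hc := hlift _ (h.image_mem hτ)
  h.transitive _ hc.1 τ hτ hc.2

/-- Only finitely many elements of the covering group move a vertex in a given finite set to
another one. -/
theorem finite_setOf_smul_mem (h : IsRegularCovering Γ E K p) {A : Set W} (hA : A.Finite)
    (hAE : ∀ x ∈ A, {x} ∈ E) : {γ : Γ | ∃ x ∈ A, γ • x ∈ A}.Finite := by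
  refine (hA.biUnion fun x hx => (hA.preimage (f := fun γ : Γ => γ • x) ?_)).subset ?_
  · intro γ _ δ _ hγδ
    refine (inv_mul_eq_one.1 (h.free (δ⁻¹ * γ) x (hAE x hx) ?_)).symm
    rw [mul_smul, inv_smul_eq_iff]
    exact hγδ
  · rintro γ ⟨x, hx, hγx⟩
    exact Set.mem_iUnion₂.2 ⟨x, hx, hγx⟩

/-- Projection recovers `c` from a translate of its lift, and freeness recovers the group element.
-/
theorem ncard_translates (h : IsRegularCovering Γ E K p) (hlift : IsLiftChoice E K p lift)
    {C : Set (Finset V)} (hC : C ⊆ K.faces) (D : Finset Γ) :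
    (translates lift C (D : Set Γ)).ncard = C.ncard * D.card := by
  rw [translates, Set.InjOn.ncard_image, Set.ncard_prod, Set.ncard_coe_finset]
  rintro ⟨c, γ⟩ ⟨hc, -⟩ ⟨c', γ'⟩ ⟨hc', -⟩ heq
  change γ • lift c = γ' • lift c' at heq
  obtain rfl : c = c' := by
    have hc : c ∈ K := hC hc
    have hc' : c' ∈ K := hC hc'
    rw [← h.image_smul_lift hlift hc γ, heq, h.image_smul_lift hlift hc' γ']
  rw [← inv_smul_eq_iff, ← mul_smul] at heq
  rw [inv_mul_eq_one.1 (h.eq_one_of_smul_eq (hlift c (hC hc)).1 heq)]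

/-- A family of subcomplexes of an amenable regular covering, indexed by the finite subsets `G` of
the covering group and roughly consisting of the translates by `G` of a fundamental domain,
contains a balanced amenable exhaustion. -/
theorem exists_exhaustion (h : IsRegularCovering Γ E K p) (hK : K.faces.Finite)
    (hne : K.faces.Nonempty) {S : Finset Γ} (hS : Subgroup.closure (S : Set Γ) = ⊤)
    (hΓ : IsAmenableGroup Γ) (hlift : IsLiftChoice E K p lift)
    {X : Finset Γ → PreAbstractSimplicialComplex W} (hmono : Monotone X) (hXE : ∀ G, X G ≤ E)
    {T : Finset Γ} (hmem : ∀ G, ∀ c ∈ K, ∀ γ ∈ G, γ • lift c ∈ X G)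
    (hT : ∀ G, ∀ c ∈ K, ∀ γ, γ • lift c ∈ X G → ∃ g ∈ G, ∃ t ∈ T, γ = g * t) :
    ∃ G : ℕ → Finset Γ, IsAmenableExhaustion E K S lift (fun k => X (G k)) ∧
      IsBalancedExhaustion Γ E K (fun k => X (G k)) := by
  classical
  have := countable_of_closure_eq_top hS
  obtain ⟨G, hG, hGne, hGex, hGT⟩ := hΓ.exists_sequence
  have hTne : T.Nonempty := by
    obtain ⟨c, hc⟩ := hne
    obtain ⟨-, -, t, ht, -⟩ := hT {1} c hc 1 (hmem {1} c hc 1 (Finset.mem_singleton_self 1))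
    exact ⟨t, ht⟩
  have hm : (0 : ℝ) < K.faces.ncard := Nat.cast_pos.2 ((Set.ncard_pos hK).2 hne)
  have hGpos : ∀ k, (0 : ℝ) < (G k).card := fun k => Nat.cast_pos.2 (Finset.card_pos.2 (hGne k))
  have hup : ∀ D, (X D).faces ⊆ translates lift K.faces ((D * T : Finset Γ) : Set Γ) := by
    intro D τ hτ
    have hc := h.image_mem (hXE D hτ)
    obtain ⟨γ, hγ⟩ := h.exists_smul_lift hlift (hXE D hτ)
    obtain ⟨g, hg, t, ht, rfl⟩ := hT D _ hc γ (hγ.symm ▸ hτ)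
    exact hγ ▸ smul_lift_mem_translates hc (Finset.mul_mem_mul hg ht)
  have hfin : ∀ D, (X D).faces.Finite := fun D => (finite_translates hK _).subset (hup D)
  have hXlow : ∀ D, (K.faces.ncard * D.card : ℝ) ≤ (X D).faces.ncard := by
    intro D
    rw [← Nat.cast_mul, ← h.ncard_translates hlift subset_rfl]
    refine Nat.cast_le.2 (Set.ncard_le_ncard ?_ (hfin D))
    rintro _ ⟨⟨c, γ⟩, ⟨hc, hγ⟩, rfl⟩
    exact hmem D c hc γ hγ
  have hXup : ∀ D, ((X D).faces.ncard : ℝ) ≤ K.faces.ncard * (D * T).card := by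
    intro D
    rw [← Nat.cast_mul, ← h.ncard_translates hlift subset_rfl]
    exact Nat.cast_le.2 (Set.ncard_le_ncard (hup D) (finite_translates hK _))
  have hXpos : ∀ k, (0 : ℝ) < (X (G k)).faces.ncard := fun k =>
    (mul_pos hm (hGpos k)).trans_le (hXlow _)
  refine ⟨G, ⟨fun i j hij => hmono (hG hij), fun k => hfin _, ?_, fun R hR => ?_⟩, fun σ hσ => ?_⟩
  · refine (Set.iUnion_subset fun k => hXE _).antisymm fun τ hτ => ?_
    obtain ⟨γ, hγ⟩ := h.exists_smul_lift hlift hτ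
    obtain ⟨k, hk⟩ := hGex γ
    exact Set.mem_iUnion.2 ⟨k, hγ ▸ hmem _ _ (h.image_mem hτ) γ hk⟩
  · have hA : (⋃ c ∈ K.faces, (lift c : Set W)).Finite :=
      hK.biUnion fun c _ => (lift c).finite_toSet
    have hQ := h.finite_setOf_smul_mem hA fun x hx => by
      obtain ⟨c, hc, hx⟩ := Set.mem_iUnion₂.1 hx
      exact mem_vertexSet (hlift c hc).1 hx
    let Q := hQ.toFinset
    let B := (finite_wordBall hS R).toFinset
    -- If `γ₁ • lift c` meets a simplex `(g * t) • lift c'` of `X D`, then `(g * t)⁻¹ * γ₁ ∈ Q` and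
    -- `γ₁⁻¹ * γ ∈ B`, so `γ` lies in `D * T * Q * B`. The inserted `1` only ensures that `T'` is
    -- nonempty.
    let T' : Finset Γ := insert 1 (T * (Q * B))
    have hU : ∀ D, wordNeighborhood K S lift R (X D) ⊆
        translates lift K.faces ((D * T' : Finset Γ) : Set Γ) := by
      rintro D _ ⟨c, hc, γ, γ₁, rfl, hd, ρ, hρ, w, hw⟩
      obtain ⟨hw, hwρ⟩ := Finset.mem_inter.1 hw
      obtain ⟨x, hx, rfl⟩ := Finset.mem_smul_finset.1 hw
      have hc' := h.image_mem (hXE D hρ)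
      obtain ⟨δ, hδ⟩ := h.exists_smul_lift hlift (hXE D hρ)
      obtain ⟨g, hg, t, ht, rfl⟩ := hT D _ hc' δ (hδ.symm ▸ hρ)
      rw [← hδ] at hwρ
      obtain ⟨y, hy, hyx⟩ := Finset.mem_smul_finset.1 hwρ
      have hq : (g * t)⁻¹ * γ₁ ∈ Q := hQ.mem_toFinset.2
        ⟨x, Set.mem_iUnion₂.2 ⟨c, hc, hx⟩, Set.mem_iUnion₂.2 ⟨_, hc', by
          rwa [mul_smul, ← hyx, inv_smul_smul]⟩⟩
      have hb : γ₁⁻¹ * γ ∈ B := (finite_wordBall hS R).mem_toFinset.2 hd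
      refine smul_lift_mem_translates hc (Finset.mem_coe.2 (Finset.mem_mul.2
        ⟨g, hg, _, Finset.mem_insert_of_mem (Finset.mul_mem_mul ht (Finset.mul_mem_mul hq hb)), ?_⟩))
      group
    have hUX : ∀ D, (X D).faces ⊆ wordNeighborhood K S lift R (X D) := by
      intro D τ hτ
      obtain ⟨γ, hγ⟩ := h.exists_smul_lift hlift (hXE D hτ)
      refine ⟨_, h.image_mem (hXE D hτ), γ, γ, hγ.symm, ?_, τ, hτ, ?_⟩
      · rwa [wordDist_self, Nat.cast_zero]
      · rw [hγ, Finset.inter_self]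
        exact nonempty_of_mem hτ
    refine tendsto_of_tendsto_of_tendsto_of_le_of_le tendsto_const_nhds
      (hGT T' (Finset.insert_nonempty _ _)) (fun k => ?_) fun k => ?_
    · change 1 ≤ _ / _
      rw [one_le_div (hXpos k)]
      exact Nat.cast_le.2 (Set.ncard_le_ncard (hUX _) ((finite_translates hK _).subset (hU _)))
    · change _ / _ ≤ _ / _
      rw [← mul_div_mul_left _ ((G k).card : ℝ) hm.ne']
      refine div_le_div₀ (by positivity) ?_ (mul_pos hm (hGpos k)) (hXlow _)
      rw [← Nat.cast_mul, ← h.ncard_translates hlift subset_rfl]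
      exact Nat.cast_le.2 (Set.ncard_le_ncard (hU _) (finite_translates hK _))
  · have hc := h.image_mem hσ
    have hsub : {σ.image p} ⊆ K.faces := Set.singleton_subset_iff.2 hc
    have hlow : ∀ D, (D.card : ℝ) ≤ ({τ | τ ∈ X D ∧ ∃ γ : Γ, τ = γ • σ}.ncard : ℝ) := by
      intro D
      have := h.ncard_translates hlift hsub D
      rw [Set.ncard_singleton, one_mul] at this
      rw [← this]
      refine Nat.cast_le.2 (Set.ncard_le_ncard ?_ ((hfin D).subset fun τ hτ => hτ.1))
      rintro _ ⟨⟨c, γ⟩, ⟨rfl, hγ⟩, rfl⟩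
      obtain ⟨δ, hδ⟩ := h.transitive σ hσ (γ • lift (σ.image p))
        (h.smul_mem γ _ (hlift _ hc).1) (h.image_smul_lift hlift hc γ).symm
      exact ⟨hmem D _ hc γ hγ, δ, hδ.symm⟩
    have hupp : ∀ D, ({τ | τ ∈ X D ∧ ∃ γ : Γ, τ = γ • σ}.ncard : ℝ) ≤ (D * T).card := by
      intro D
      have := h.ncard_translates hlift hsub (D * T)
      rw [Set.ncard_singleton, one_mul] at this
      rw [← this]
      refine Nat.cast_le.2 (Set.ncard_le_ncard ?_ (finite_translates (Set.finite_singleton _) _))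
      rintro _ ⟨hτ, γ, rfl⟩
      obtain ⟨δ, hδ⟩ := h.exists_smul_lift hlift hσ
      rw [← hδ, ← mul_smul] at hτ ⊢
      rw [hδ]
      obtain ⟨g, hg, t, ht, hgt⟩ := hT D _ hc _ hτ
      exact smul_lift_mem_translates (Set.mem_singleton _)
        (Finset.mem_coe.2 (hgt ▸ Finset.mul_mem_mul hg ht))
    have hlim := hGT T hTne
    have hlim1 : Tendsto (fun k => 1 / (K.faces.ncard : ℝ) *
        (((G k * T).card : ℝ) / (G k).card)⁻¹) atTop (𝓝 (1 / (K.faces.ncard : ℝ))) := by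
      simpa using (hlim.inv₀ one_ne_zero).const_mul (1 / (K.faces.ncard : ℝ))
    have hlim2 : Tendsto (fun k => 1 / (K.faces.ncard : ℝ) *
        (((G k * T).card : ℝ) / (G k).card)) atTop (𝓝 (1 / (K.faces.ncard : ℝ))) := by
      simpa using hlim.const_mul (1 / (K.faces.ncard : ℝ))
    -- The orbit count lies between `|G|` and `|G * T|`, and the total between `|K|` times these;
    -- dividing opposite bounds gives the two limits.
    refine tendsto_of_tendsto_of_tendsto_of_le_of_le hlim1 hlim2 (fun k => ?_) fun k => ?_
    · change _ * _ ≤ _ / _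
      rw [inv_div, div_mul_div_comm, one_mul]
      exact div_le_div₀ (Nat.cast_nonneg _) (hlow _) (hXpos k) (hXup _)
    · change _ / _ ≤ _ * _
      rw [div_mul_div_comm, one_mul]
      exact div_le_div₀ (Nat.cast_nonneg _) (hupp _) (mul_pos hm (hGpos k)) (hXlow _)

end IsRegularCovering

namespace PreAbstractSimplicialComplex

theorem finite_faces_barycentric {V : Type u} {K : PreAbstractSimplicialComplex V}
    (hK : K.faces.Finite) : K.barycentric.faces.Finite := by
  refine (Set.Finite.finite_subsets hK).preimage (f := fun c : Finset (Finset V) =>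
    (c : Set (Finset V))) Finset.coe_injective.injOn |>.subset fun c hc σ hσ => hc.2.1 σ hσ

theorem nonempty_faces_barycentric {V : Type u} {K : PreAbstractSimplicialComplex V}
    (hK : K.faces.Nonempty) : K.barycentric.faces.Nonempty := by
  obtain ⟨σ, hσ⟩ := hK
  refine ⟨{σ}, Finset.singleton_nonempty σ, fun τ hτ => Finset.mem_singleton.1 hτ ▸ hσ, ?_⟩
  rw [Finset.coe_singleton]
  exact IsChain.singleton

end PreAbstractSimplicialComplex

open PreAbstractSimplicialComplex in
/-- The thickenings of the translates of a fundamental domain contain a balanced amenable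
exhaustion. -/
theorem IsRegularCovering.exists_thickening_exhaustion {V : Type u} {W : Type v} {Γ : Type w}
    [DecidableEq V] [DecidableEq W] [Group Γ] [MulAction Γ W]
    {E : PreAbstractSimplicialComplex W} {K : PreAbstractSimplicialComplex V} {p : W → V}
    (h : IsRegularCovering Γ E K p) (hK : K.faces.Finite) (hne : K.faces.Nonempty) {S : Finset Γ}
    (hS : Subgroup.closure (S : Set Γ) = ⊤) (hΓ : IsAmenableGroup Γ)
    {lift : Finset (Finset V) → Finset (Finset W)}
    (hlift : IsLiftChoice E.barycentric K.barycentric (Finset.image p) lift) :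
    ∃ A : ℕ → Set W,
      IsAmenableExhaustion E.barycentric K.barycentric S lift (fun k => E.thickening (A k)) ∧
      IsBalancedExhaustion Γ E.barycentric K.barycentric (fun k => E.thickening (A k)) := by
  have hKb := finite_faces_barycentric hK
  -- The vertices of the original covering, not of its subdivision, that occur in the chosen lifts.
  let D : Set W := ⋃ c ∈ K.barycentric.faces, ⋃ σ ∈ lift c, (σ : Set W)
  have hD : D.Finite := hKb.biUnion fun c _ => (lift c).finite_toSet.biUnion fun σ _ =>
    σ.finite_toSet
  have hmemD : ∀ {c σ x}, c ∈ K.barycentric → σ ∈ lift c → x ∈ σ → x ∈ D := fun hc hσ hx =>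
    Set.mem_iUnion₂.2 ⟨_, hc, Set.mem_iUnion₂.2 ⟨_, hσ, hx⟩⟩
  have hT := h.finite_setOf_smul_mem hD fun x hx => by
    obtain ⟨c, hc, hx⟩ := Set.mem_iUnion₂.1 hx
    obtain ⟨σ, hσ, hx⟩ := Set.mem_iUnion₂.1 hx
    exact mem_vertexSet ((hlift c hc).1.2.1 σ hσ) hx
  let X : Finset Γ → PreAbstractSimplicialComplex (Finset W) := fun G =>
    E.thickening {w | ∃ g ∈ G, ∃ x ∈ D, w = g • x}
  have hmem : ∀ G, ∀ c ∈ K.barycentric, ∀ γ ∈ G, γ • lift c ∈ X G := by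
    intro G c hc γ hγ
    refine ⟨h.barycentric.smul_mem γ _ (hlift c hc).1, fun σ hσ => ?_⟩
    obtain ⟨ρ, hρ, rfl⟩ := Finset.mem_smul_finset.1 hσ
    obtain ⟨x, hx⟩ := nonempty_of_mem ((hlift c hc).1.2.1 ρ hρ)
    exact ⟨γ • x, Finset.smul_mem_smul_finset hx, γ, hγ, x, hmemD hc hρ hx, rfl⟩
  have hXT : ∀ G, ∀ c ∈ K.barycentric, ∀ γ, γ • lift c ∈ X G →
      ∃ g ∈ G, ∃ t ∈ hT.toFinset, γ = g * t := by
    intro G c hc γ hγ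
    obtain ⟨ρ, hρ⟩ := (hlift c hc).1.1
    -- Any one member `ρ` of the lifted chain suffices: a common vertex `γ • y = g • x` shows that
    -- `g⁻¹ * γ` moves a point of `D` into `D`.
    obtain ⟨v, hv, g, hg, x, hx, rfl⟩ := hγ.2 (γ • ρ) (Finset.smul_mem_smul_finset hρ)
    obtain ⟨y, hy, hyx⟩ := Finset.mem_smul_finset.1 hv
    refine ⟨g, hg, g⁻¹ * γ, hT.mem_toFinset.2 ⟨y, hmemD hc hρ hy, ?_⟩, by group⟩
    rwa [mul_smul, hyx, inv_smul_smul]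
  obtain ⟨G, hG⟩ := h.barycentric.exists_exhaustion hKb (nonempty_faces_barycentric hne) hS hΓ hlift
    (X := X) (fun G G' hGG' => thickening_mono fun w ⟨g, hg, hw⟩ => ⟨g, hGG' hg, hw⟩)
    (fun G => thickening_le) hmem hXT
  exact ⟨_, hG⟩

/-- Thickening of subcomplexes of a triangulated rational homology manifold `(K, L)`, and the
resulting balanced amenable exhaustions of the amenable regular coverings of `K` if it is compact. -/
theorem lemma2 {V : Type u} [DecidableEq V] (n : ℕ) (K L : PreAbstractSimplicialComplex V)
    (hKL : IsTriangulatedRationalHomologyManifold n K L) :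
    (∀ X' : PreAbstractSimplicialComplex V, X' ≤ K →
      ∃ X Y : PreAbstractSimplicialComplex (Finset V),
        X ≤ K.barycentric ∧
        X'.barycentric ≤ X ∧
        X ≤ (K.star X').barycentric ∧
        IsTriangulatedRationalHomologyManifold n X Y ∧
        X ⊓ L.barycentric ≤ Y) ∧
    (∀ {W : Type v} {Γ : Type w} [DecidableEq W] [Group Γ] [MulAction Γ W]
      (E : PreAbstractSimplicialComplex W) (p : W → V) (S : Finset Γ)
      (lift : Finset (Finset V) → Finset (Finset W)),
      K.faces.Finite → K.faces.Nonempty →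
      IsRegularCovering Γ E K p →
      Subgroup.closure (S : Set Γ) = ⊤ →
      IsAmenableGroup Γ →
      IsLiftChoice E.barycentric K.barycentric (Finset.image p) lift →
      ∃ X Y : ℕ → PreAbstractSimplicialComplex (Finset W),
        IsAmenableExhaustion E.barycentric K.barycentric S lift X ∧
        IsBalancedExhaustion Γ E.barycentric K.barycentric X ∧
        ∀ k, IsTriangulatedRationalHomologyManifold n (X k) (Y k)) := by
  refine ⟨fun X' hX' => ?_, fun E p S lift hK hne h hS hΓ hlift => ?_⟩
  · exact ⟨K.thickening X'.vertexSet, K.thickeningBoundary L X'.vertexSet,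
      PreAbstractSimplicialComplex.thickening_le,
      PreAbstractSimplicialComplex.barycentric_le_thickening hX',
      PreAbstractSimplicialComplex.thickening_le_star, hKL.thickening _, le_sup_right⟩
  · obtain ⟨A, hA, hA'⟩ := h.exists_thickening_exhaustion hK hne hS hΓ hlift
    -- The covering is a manifold with boundary the preimage of `L`, so the thickening result
    -- applies upstairs.
    exact ⟨_, fun k => E.thickeningBoundary (E.preimage p L) (A k), hA, hA', fun k =>
      (h.isTriangulatedRationalHomologyManifold hKL).thickening _⟩
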